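/- Setting. Consider Minkowski space with coordinates $(t,\vec x)\in\mathbb R\times\mathbb R^3$ and metric $\eta=\mathrm{diag}(1,-1,-1,-1)$, a compact gauge group $G\subset U(N)$ with Lie algebra basis $t^a$, $[t^a,t^b]=iC^{abc}t^c$ with totally antisymmetric structure constants $C^{abc}$, Hermitian generators $T^a$, $[T^a,T^b]=iC^{abc}T^c$, acting on a finite-dimensional complex inner product space $W$, a coupling $g\in\mathbb R$, and a potential $V:[0,\infty)\to\mathbb R$, differentiable (one-sidedly at $0$), with $V(0)=0$. For $\phi:\mathbb R^4\to W$ and real fields $A^a_\mu$ let $D_\mu\phi=\partial_\mu\phi-igT^aA^a_\mu\phi$ and $F^a_{\mu\nu}=\partial_\mu A^a_\nu-\partial_\nu A^a_\mu+gC^{abc}A^b_\mu A^c_\nu$, and consider the equations of motion of the action $$S=\int d^4x\Big[\eta^{\mu\nu}(D_\mu\phi)^\dagger D_\nu\phi-V(\phi^\dagger\phi)-\tfrac14F^{a\,\mu\nu}F^a_{\mu\nu}\Big].$$ Call a solution admissible if (i) all fields are smooth and, for each $t$, tend to $0$ as $|\vec x|\to\infty$; (ii) for some $T\in(0,\infty)$,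 $\Omega\in SO(3)$ and $\vec l\in\mathbb R^3$ with $\Omega\vec l=\vec l$ and $|\vec l|/T<1$, all fields satisfy $\Psi(t+T,\vec x)=\Lambda(\Omega)\Psi(t,\Omega^{-1}\vec x-\vec l)$, where $\phi$ and $A_0$ are scalars and $(A_1,A_2,A_3)$ is a vector under rotations; (iii) the integrals over $[0,T]\times\mathbb R^3$ of $(D_0\phi)^\dagger D_0\phi$, $\sum_i(D_i\phi)^\dagger D_i\phi$, $\tfrac12\sum_{i,a}(F^a_{0i})^2$, $\tfrac14\sum_{i,j,a}(F^a_{ij})^2$, $V(\phi^\dagger\phi)$ and $V'(\phi^\dagger\phi)\phi^\dagger\phi$ are finite (absolutely convergent). The gauge field is trivial if $F^a_{\mu\nu}\equiv0$ and it is a pure gauge: there is a smooth $U:\mathbb R^4\to G$ with $\partial_\mu U=igA^a_\mu t^aU$. Corollary 1. 1. An admissible solution $(\phi,A)$ with $V(\phi^\dagger\phi)\ge0$ and $V'(\phi^\dagger\phi)\phi^\dagger\phi-V(\phi^\dagger\phi)\ge0$ for all values of $\phi$ occurring in it has $\phi\equiv0$ and a trivial gauge field; that is, there are no solitons. 2.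 The same holds if $V(\phi^\dagger\phi)\le0$ for all values of $\phi$ occurring in the solution and $V'(\phi^\dagger\phi)\phi^\dagger\phi-3V(\phi^\dagger\phi)>0$ for all non-zero ones. 3. Both statements hold for the theory of the scalar field alone (no gauge field, $D_\mu$ replaced by $\partial_\mu$): under the conditions of 1 or of 2 every admissible solution has $\phi\equiv0$. 4. In pure Yang–Mills theory (no scalar field) every admissible solution has a trivial gauge field. -/

import Mathlib

open MeasureTheory Filter Topology
open scoped ContDiff

noncomputable section

namespace YMSoliton

/-- Three-dimensional Euclidean space. -/
abbrev Space : Type := EuclideanSpace ℝ (Fin 3)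

/-- Minkowski space in inertial coordinates `(t, x)`. -/
abbrev Spacetime : Type := ℝ × Space

/-- The coordinate directions: `dir 0` is the time direction, `dir i.succ` is the `i`-th
spatial one. -/
def dir : Fin 4 → Spacetime :=
  Fin.cons (1, 0) (fun i : Fin 3 => (0, EuclideanSpace.single i 1))

/-- The diagonal entries of the Minkowski metric `diag (1, -1, -1, -1)`. -/
def eta : Fin 4 → ℝ := Fin.cons 1 (fun _ : Fin 3 => -1)

/-- The partial derivative `∂_μ f`. -/
def pd {E : Type*} [NormedAddCommGroup E] [NormedSpace ℝ E]
    (μ : Fin 4) (f : Spacetime → E) (p : Spacetime) : E :=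
  fderiv ℝ f p (dir μ)

/-! ### Gauge group, representation, potential -/

/-- The complex matrices that represent the elements of a group `G` of unitary matrices. -/
def matrices {N : ℕ} (G : Subgroup (Matrix.unitaryGroup (Fin N) ℂ)) :
    Set (Matrix (Fin N) (Fin N) ℂ) :=
  (fun u : Matrix.unitaryGroup (Fin N) ℂ => (u : Matrix (Fin N) (Fin N) ℂ)) '' (G : Set _)

/-- The Lie algebra of `G` in the convention of physics, that is, the set of all matrices `X` whose
one-parameter group `exp (i s X)` lies in `G`. -/
def lieAlg {N : ℕ} (G : Subgroup (Matrix.unitaryGroup (Fin N) ℂ)) :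
    Set (Matrix (Fin N) (Fin N) ℂ) :=
  {X | ∀ s : ℝ, NormedSpace.exp ((Complex.I * (s : ℂ)) • X) ∈ matrices G}

/-- A compact gauge group (a closed group of unitary matrices) of dimension `d`, with a basis
`t ^ a` of its Lie algebra for which the structure constants `C ^ {abc}` are totally antisymmetric,
that is, a basis that is orthonormal for an invariant inner product. -/
structure GaugeGroup (N d : ℕ) where
  /-- the group -/
  G : Subgroup (Matrix.unitaryGroup (Fin N) ℂ)
  /-- the group is closed in the compact group of all unitary matrices, hence compact -/
  closed : IsClosed (G : Set (Matrix.unitaryGroup (Fin N) ℂ))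
  /-- the basis of the Lie algebra -/
  t : Fin d → Matrix (Fin N) (Fin N) ℂ
  linInd : LinearIndependent ℝ t
  span_eq : (Submodule.span ℝ (Set.range t) : Set (Matrix (Fin N) (Fin N) ℂ)) = lieAlg G
  /-- the structure constants -/
  C : Fin d → Fin d → Fin d → ℝ
  comm : ∀ a b, t a * t b - t b * t a = Complex.I • ∑ c, (C a b c : ℂ) • t c
  antisymm₁₂ : ∀ a b c, C a b c = -C b a c
  antisymm₂₃ : ∀ a b c, C a b c = -C a c b

/-- Hermitian generators `T ^ a` of the gauge group in the space `W` of values of the scalar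
field. -/
structure Generators {N d : ℕ} (𝒢 : GaugeGroup N d) (W : Type*)
    [NormedAddCommGroup W] [InnerProductSpace ℂ W] where
  /-- the generators -/
  T : Fin d → W →L[ℂ] W
  hermitian : ∀ a (v w : W), inner ℂ (T a v) w = inner ℂ v (T a w)
  comm : ∀ a b (w : W),
    T a (T b w) - T b (T a w) = Complex.I • ∑ c, (𝒢.C a b c : ℂ) • T c w

/-- Scalar potentials: functions `V` of `s = φ†φ ∈ [0, ∞)` with a (finite) derivative at every
`s ≥ 0` (one-sided at `0`) and with `V 0 = 0`. -/
structure IsPotential (V : ℝ → ℝ) : Prop where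
  differentiable : DifferentiableOn ℝ V (Set.Ici 0)
  zero : V 0 = 0

/-- The derivative `dV/ds` on `[0, ∞)`. -/
def dV (V : ℝ → ℝ) (s : ℝ) : ℝ := derivWithin V (Set.Ici 0) s

/-! ### Periodicity in time up to a rotation and a shift -/

/-- The action of a matrix on space. -/
def rot (M : Matrix (Fin 3) (Fin 3) ℝ) (x : Space) : Space :=
  WithLp.toLp 2 (M.mulVec x.ofLp)

/-- The data of a periodicity: a period `T`, a rotation `Ω`, and a shift `l` along the axis of the
rotation, slower than light. -/
structure Period where
  /-- the period -/
  T : ℝ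
  /-- the rotation -/
  Ω : Matrix.specialOrthogonalGroup (Fin 3) ℝ
  /-- the shift -/
  l : Space
  T_pos : 0 < T
  rot_l : rot (Ω : Matrix (Fin 3) (Fin 3) ℝ) l = l
  subluminal : ‖l‖ / T < 1

/-- The point `Ω⁻¹ x - l`. -/
def Period.back (P : Period) (x : Space) : Space :=
  rot ((P.Ω⁻¹ : Matrix.specialOrthogonalGroup (Fin 3) ℝ) : Matrix (Fin 3) (Fin 3) ℝ) x - P.l

/-- One period of time, over all of space. -/
def Period.slab (P : Period) : Set Spacetime := Set.Icc 0 P.T ×ˢ Set.univ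

/-- Periodicity of a scalar field. -/
def IsPeriodicScalar {E : Type*} (P : Period) (f : Spacetime → E) : Prop :=
  ∀ (t : ℝ) (x : Space), f (t + P.T, x) = f (t, P.back x)

/-- Periodicity of a vector field: `A_0` is a scalar and `(A_1, A_2, A_3)` a vector under
rotations. -/
def IsPeriodicVector {d : ℕ} (P : Period) (A : Spacetime → Fin 4 → Fin d → ℝ) : Prop :=
  ∀ (t : ℝ) (x : Space) (a : Fin d),
    A (t + P.T, x) 0 a = A (t, P.back x) 0 a ∧
    ∀ i : Fin 3, A (t + P.T, x) i.succ a =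
      ∑ j : Fin 3, (P.Ω : Matrix (Fin 3) (Fin 3) ℝ) i j * A (t, P.back x) j.succ a

/-- `f (t, x) → 0` as `|x| → ∞`, at each time `t`. -/
def VanishesAtInfinity {E : Type*} [NormedAddCommGroup E] (f : Spacetime → E) : Prop :=
  ∀ t : ℝ, Tendsto (fun x : Space => f (t, x)) (cocompact Space) (𝓝 0)

/-! ### Field strength, covariant derivatives, equations of motion -/

section Theory

variable {N d : ℕ} (𝒢 : GaugeGroup N d) (g : ℝ) (A : Spacetime → Fin 4 → Fin d → ℝ)

/-- The field strength
`F_{μν}^a = ∂_μ A_ν^a - ∂_ν A_μ^a + g C^{abc} A_μ^b A_ν^c`. -/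
def fieldStrength (μ ν : Fin 4) (a : Fin d) (p : Spacetime) : ℝ :=
  pd μ (fun q => A q ν a) p - pd ν (fun q => A q μ a) p
    + g * ∑ b, ∑ c, 𝒢.C a b c * A p μ b * A p ν c

/-- The component `D^μ F_{μν}^a` (`ν` a lower index) of the covariant divergence of the field
strength, `D_μ F_{μν}^a = ∂_μ F_{μν}^a + g C^{abc} A_μ^b F_{μν}^c`. -/
def divF (ν : Fin 4) (a : Fin d) (p : Spacetime) : ℝ :=
  ∑ μ, eta μ * (pd μ (fieldStrength 𝒢 g A μ ν a) p
    + g * ∑ b, ∑ c, 𝒢.C a b c * A p μ b * fieldStrength 𝒢 g A μ ν c p)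

variable {W : Type*} [NormedAddCommGroup W] [InnerProductSpace ℂ W]

/-- The covariant derivative `D_μ ψ = ∂_μ ψ - i g T^a A_μ^a ψ`. -/
def covD {𝒢 : GaugeGroup N d} (𝒯 : Generators 𝒢 W) (g : ℝ)
    (A : Spacetime → Fin 4 → Fin d → ℝ) (μ : Fin 4) (ψ : Spacetime → W) (p : Spacetime) : W :=
  pd μ ψ p - (Complex.I * (g : ℂ)) • ∑ a, (A p μ a : ℂ) • 𝒯.T a (ψ p)

/-- The Euler–Lagrange equations of
`∫ d⁴x [η^{μν} (D_μ φ)† D_ν φ - V(φ†φ) - (1/4) F^{a μν} F^a_{μν}]`, namely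
`D^μ D_μ φ + V'(φ†φ) φ = 0` and `D^μ F_{μν}^a = 2 g Im ((T^a φ)† D_ν φ)`. -/
structure SolvesYMScalar {𝒢 : GaugeGroup N d} (𝒯 : Generators 𝒢 W) (g : ℝ) (V : ℝ → ℝ)
    (φ : Spacetime → W) (A : Spacetime → Fin 4 → Fin d → ℝ) : Prop where
  scalar : ∀ p, ∑ μ, eta μ • covD 𝒯 g A μ (covD 𝒯 g A μ φ) p + dV V (‖φ p‖ ^ 2) • φ p = 0
  gauge : ∀ ν a p,
    divF 𝒢 g A ν a p = 2 * g * (inner ℂ (𝒯.T a (φ p)) (covD 𝒯 g A ν φ p)).im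

/-- The Yang–Mills equations `D^μ F_{μν}^a = 0`, the equations of motion of the theory without the
scalar field. -/
def SolvesYM : Prop := ∀ ν a p, divF 𝒢 g A ν a p = 0

/-- The equation `∂^μ ∂_μ φ + V'(φ†φ) φ = 0`, the equation of motion of the theory without the
gauge field. -/
def SolvesScalar (V : ℝ → ℝ) (φ : Spacetime → W) : Prop :=
  ∀ p, ∑ μ, eta μ • pd μ (pd μ φ) p + dV V (‖φ p‖ ^ 2) • φ p = 0

/-! ### The class of configurations among which solitons are sought -/

/-- The conditions on a gauge field: smooth, vanishing at spatial infinity, periodic, and with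
`∫ (1/2) F_{0i}^a F_{0i}^a` and `∫ (1/4) F_{ij}^a F_{ij}^a` finite over one period. -/
structure GaugeAdmissible (P : Period) : Prop where
  smooth : ∀ μ a, ContDiff ℝ ∞ (fun p => A p μ a)
  vanishing : ∀ μ a, VanishesAtInfinity (fun p => A p μ a)
  periodic : IsPeriodicVector P A
  finite_electric : IntegrableOn (fun p : Spacetime =>
    (1 / 2 : ℝ) * ∑ i : Fin 3, ∑ a, fieldStrength 𝒢 g A 0 i.succ a p ^ 2) P.slab
  finite_magnetic : IntegrableOn (fun p : Spacetime =>
    (1 / 4 : ℝ) * ∑ i : Fin 3, ∑ j : Fin 3, ∑ a, fieldStrength 𝒢 g A i.succ j.succ a p ^ 2) P.slab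

/-- The conditions on a scalar field with (covariant) derivatives `Dφ μ`: smooth, vanishing at
spatial infinity, periodic, and with the integrals of `(D_0 φ)† D_0 φ`, `(D_i φ)† D_i φ`, `V(φ†φ)`
and `V'(φ†φ) φ†φ` finite over one period. -/
structure ScalarAdmissible (P : Period) (V : ℝ → ℝ) (φ : Spacetime → W)
    (Dφ : Fin 4 → Spacetime → W) : Prop where
  smooth : ContDiff ℝ ∞ φ
  vanishing : VanishesAtInfinity φ
  periodic : IsPeriodicScalar P φ
  finite_kinetic : IntegrableOn (fun p : Spacetime => ‖Dφ 0 p‖ ^ 2) P.slab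
  finite_gradient : IntegrableOn (fun p : Spacetime => ∑ i : Fin 3, ‖Dφ i.succ p‖ ^ 2) P.slab
  finite_potential : IntegrableOn (fun p : Spacetime => V (‖φ p‖ ^ 2)) P.slab
  finite_dV : IntegrableOn (fun p : Spacetime => dV V (‖φ p‖ ^ 2) * ‖φ p‖ ^ 2) P.slab

/-- The gauge field is trivial: its field strength vanishes and it is a pure gauge, that is, a
smooth gauge transformation `U` with values in the gauge group satisfies
`∂_μ U = i g A_μ^a t^a U`, so that it transforms the matrix field `g A_μ^a t^a` to `0`. -/
def GaugeTrivial : Prop :=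
  (∀ μ ν a p, fieldStrength 𝒢 g A μ ν a p = 0) ∧
  ∃ U : Spacetime → Matrix (Fin N) (Fin N) ℂ,
    (∀ p, U p ∈ matrices 𝒢.G) ∧
    (∀ i j, ContDiff ℝ ∞ (fun p => U p i j)) ∧
    ∀ μ p i j, pd μ (fun q => U q i j) p =
      (((Complex.I * (g : ℂ)) • ∑ a, (A p μ a : ℂ) • 𝒢.t a) * U p) i j

end Theory

end YMSoliton

end

open YMSoliton

open YMSoliton

noncomputable section

/-! Regard `A` as a connection form and `φ` as a field with covariant derivative D and curvature F.
A solution has a conserved symmetric stress tensor Θ (`stress_conserved`). The fields are invariant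
under a Poincaré transformation whose translation part (T, l) is parallel to the four-velocity u of
the velocity l / T and whose linear part fixes u. In the rest frame of u the solution is therefore
periodic in time up to a rotation, and the argument takes place there.

Two identities result from the divergence theorem over one period; the boundary terms in time cancel
by periodicity, those in space are removed by a cutoff. (1) Contract Θ with the dilation field of
the rest space: by conservation the divergence is, up to sign, Σ Θ_ii, so ∫ Σ Θ_ii = 0
(`IsSoliton.integral_trace_stress`). The cutoff error tends to 0 because Θ is integrable. (2) Pair
the scalar equation with φ: ∫ (|D_0 φ|² - Σ |D_i φ|² - V' φ†φ) = 0 (`IsSoliton.integral_scalar`).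
The cutoff error now contains φ itself, which need not be square integrable; Hardy's inequality on
time slices makes |φ|² / (1 + r²) integrable, which is enough (`IsSoliton.integrable_hardy`).

The gauge part of Θ has no trace in four dimensions, so Σ Θ_ii = 3 |D_0 φ|² - Σ |D_i φ|² - 3 V + e
with e ≥ 0 the energy density of the gauge field. Identity (1) minus a times (2) reads ∫ [(3 - a)
|D_0 φ|² + (a - 1) Σ |D_i φ|² + (a V' φ†φ - 3 V) + e] = 0. For a = 3 and for a = 1 the two sign
conditions on the potential make every term non-negative, so all terms vanish. With a = 3, φ is
covariantly constant in the rest space, so |φ| is constant along a line running to infinity, and φ =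
0. With a = 1, the strict inequality forces φ = 0. In both cases e = 0, so F = 0.

A flat connection on a vector space is a pure gauge: parallel transport from the origin along rays
is the gauge transformation (`exists_pure_gauge`), and it stays in the compact gauge group
(`exists_transport`). The scalar theory is the case g = 0, A = 0, and pure Yang–Mills theory the
case φ = 0. -/

namespace YMSoliton

/-! ### Connections, curvature, and the conservation law -/

section Connection

variable {E : Type*} [NormedAddCommGroup E] [NormedSpace ℝ E]
  {W : Type*} [NormedAddCommGroup W] [InnerProductSpace ℝ W]
  {𝔤 : Type*} [NormedAddCommGroup 𝔤] [InnerProductSpace ℝ 𝔤]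

/-- A skew-symmetric representation `ρ` of a Lie bracket. -/
structure SkewRep (br : 𝔤 →L[ℝ] 𝔤 →L[ℝ] 𝔤) (ρ : 𝔤 →L[ℝ] W →L[ℝ] W) : Prop where
  rep : ∀ u v w, ρ (br u v) w = ρ u (ρ v w) - ρ v (ρ u w)
  skew : ∀ u v w, inner ℝ (ρ u v) w = -inner ℝ v (ρ u w)

/-- The covariant derivative in the direction `h`. -/
def covDir (ρ : 𝔤 →L[ℝ] W →L[ℝ] W) (A : E → E →L[ℝ] 𝔤) (h : E) (ψ : E → W) (p : E) : W :=
  fderiv ℝ ψ p h + ρ (A p h) (ψ p)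

/-- The curvature in the directions `h`, `k`. -/
def curv (br : 𝔤 →L[ℝ] 𝔤 →L[ℝ] 𝔤) (A : E → E →L[ℝ] 𝔤) (h k : E) (p : E) : 𝔤 :=
  fderiv ℝ (fun q => A q k) p h - fderiv ℝ (fun q => A q h) p k + br (A p h) (A p k)

variable {br : 𝔤 →L[ℝ] 𝔤 →L[ℝ] 𝔤} {ρ : 𝔤 →L[ℝ] W →L[ℝ] W} {A : E → E →L[ℝ] 𝔤}

@[fun_prop]
theorem contDiff_fderiv_apply_const {F : Type*} [NormedAddCommGroup F] [NormedSpace ℝ F]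
    {f : E → F} (hf : ContDiff ℝ ∞ f) (h : E) : ContDiff ℝ ∞ (fun p => fderiv ℝ f p h) :=
  (hf.fderiv_right (m := ∞) (by simp)).clm_apply contDiff_const

theorem contDiff_covDir (hA : ContDiff ℝ ∞ A) {ψ : E → W} (hψ : ContDiff ℝ ∞ ψ) (h : E) :
    ContDiff ℝ ∞ (covDir ρ A h ψ) := by
  have h1 := contDiff_fderiv_apply_const hψ h
  have h2 : ContDiff ℝ ∞ (fun p => ρ (A p h)) := ρ.contDiff.comp (hA.clm_apply contDiff_const)
  exact h1.add (h2.clm_apply hψ)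

theorem contDiff_curv (hA : ContDiff ℝ ∞ A) (h k : E) :
    ContDiff ℝ ∞ (curv br A h k) := by
  have h1 : ∀ h, ContDiff ℝ ∞ (fun q => A q h) := fun h => hA.clm_apply contDiff_const
  have h2 : ContDiff ℝ ∞ (fun p => br (A p h)) := br.contDiff.comp (h1 h)
  exact ((contDiff_fderiv_apply_const (h1 k) h).sub (contDiff_fderiv_apply_const (h1 h) k)).add
    (h2.clm_apply (h1 k))

theorem curv_antisymm (hbr : ∀ u v, br u v = -br v u) (h k p : E) :
    curv br A h k p = -curv br A k h p := by
  simp only [curv, hbr (A p h) (A p k)]; abel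

theorem curv_self (hbr : ∀ u v, br u v = -br v u) (h p : E) : curv br A h h p = 0 := by
  have h1 := curv_antisymm (A := A) hbr h h p
  rw [eq_neg_iff_add_eq_zero, ← two_smul ℝ] at h1
  exact (smul_eq_zero_iff_right two_ne_zero).1 h1

/-- Linearity in the directions turns contractions over a frame into traces of bilinear forms, which
makes them independent of the frame. -/
theorem isLinearMap_covDir (h : E → W) (p : E) : IsLinearMap ℝ (fun k => covDir ρ A k h p) where
  map_add x y := by simp [covDir]; abel
  map_smul c x := by simp [covDir]

theorem isLinearMap_curv (hA : ContDiff ℝ ∞ A) (k p : E) :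
    IsLinearMap ℝ (fun h => curv br A h k p) where
  map_add x y := by
    have hd : ∀ h, DifferentiableAt ℝ (fun q => A q h) p := fun h =>
      ((hA.clm_apply contDiff_const).differentiable (by simp)) p
    simp only [curv, map_add, fderiv_fun_add (hd x) (hd y), add_apply]
    abel
  map_smul c x := by
    have hd : ∀ h, DifferentiableAt ℝ (fun q => A q h) p := fun h =>
      ((hA.clm_apply contDiff_const).differentiable (by simp)) p
    simp only [curv, map_smul, fderiv_fun_const_smul (hd x), smul_apply]
    module

theorem fderiv_covDir (hA : ContDiff ℝ ∞ A) {ψ : E → W} (hψ : ContDiff ℝ ∞ ψ) (h k p : E) :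
    fderiv ℝ (covDir ρ A k ψ) p h = fderiv ℝ (fderiv ℝ ψ) p h k
      + (ρ (fderiv ℝ (fun q => A q k) p h) (ψ p) + ρ (A p k) (fderiv ℝ ψ p h)) := by
  have h1 : HasFDerivAt (fderiv ℝ ψ) (fderiv ℝ (fderiv ℝ ψ) p) p :=
    (((hψ.fderiv_right (m := ∞) (by simp)).differentiable (by simp)) p).hasFDerivAt
  have h2 : HasFDerivAt (fun q => A q k) (fderiv ℝ (fun q => A q k) p) p :=
    (((hA.clm_apply contDiff_const).differentiable (by simp)) p).hasFDerivAt
  have h3 : HasFDerivAt ψ (fderiv ℝ ψ p) p := ((hψ.differentiable (by simp)) p).hasFDerivAt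
  have h4 := (h1.clm_apply (hasFDerivAt_const k p)).add
    ((ρ.hasFDerivAt.comp p h2).clm_apply h3)
  have h5 : HasFDerivAt (covDir ρ A k ψ) _ p := h4
  rw [h5.fderiv]
  simp
  abel

theorem fderiv_fderiv_symm {F : Type*} [NormedAddCommGroup F] [NormedSpace ℝ F]
    {f : E → F} (hf : ContDiff ℝ ∞ f) (p h k : E) :
    fderiv ℝ (fderiv ℝ f) p h k = fderiv ℝ (fderiv ℝ f) p k h :=
  (hf.contDiffAt.isSymmSndFDerivAt (by simpa using WithTop.coe_le_coe.2 (le_top : (2 : ℕ∞) ≤ ⊤))) h k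

/-- Second derivatives of ψ cancel by symmetry, the mixed terms cancel in pairs, and the commutator
of the two connection terms is ρ of a bracket. -/
theorem covDir_comm (hρ : SkewRep br ρ) (hA : ContDiff ℝ ∞ A) {ψ : E → W}
    (hψ : ContDiff ℝ ∞ ψ) (h k p : E) :
    covDir ρ A h (covDir ρ A k ψ) p - covDir ρ A k (covDir ρ A h ψ) p
      = ρ (curv br A h k p) (ψ p) := by
  rw [covDir.eq_def ρ A h (covDir ρ A k ψ), covDir.eq_def ρ A k (covDir ρ A h ψ),
    fderiv_covDir hA hψ, fderiv_covDir hA hψ,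
    fderiv_fderiv_symm hψ p h k]
  simp only [covDir, curv, map_add, map_sub, add_apply,
    sub_apply, hρ.rep]
  abel

/-- The connection is metric: by skewness the two connection terms on the right cancel. -/
theorem fderiv_inner_covDir (hρ : ∀ u v w, inner ℝ (ρ u v) w = -inner ℝ v (ρ u w))
    {ψ χ : E → W} {p : E}
    (hψ : DifferentiableAt ℝ ψ p) (hχ : DifferentiableAt ℝ χ p) (h : E) :
    fderiv ℝ (fun q => inner ℝ (ψ q) (χ q)) p h
      = inner ℝ (covDir ρ A h ψ p) (χ p) + inner ℝ (ψ p) (covDir ρ A h χ p) := by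
  rw [fderiv_inner_apply ℝ hψ hχ]
  simp only [covDir, inner_add_left, inner_add_right, hρ]
  ring

/-- The cyclic sum kills the second derivatives of `A` by symmetry and the terms A · ∂A by
antisymmetry of the bracket; the cubic terms are the Jacobi identity, here in the form that the
adjoint action is a representation. -/
theorem bianchi (hbr : ∀ u v, br u v = -br v u) (hJ : SkewRep br br) (hA : ContDiff ℝ ∞ A)
    (h k l p : E) :
    covDir br A h (curv br A k l) p + covDir br A k (curv br A l h) p
      + covDir br A l (curv br A h k) p = 0 := by
  have hAk : ∀ k, ContDiff ℝ ∞ (fun q => A q k) := fun k => hA.clm_apply contDiff_const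
  have key : ∀ h k l, fderiv ℝ (curv br A k l) p h =
      fderiv ℝ (fderiv ℝ (fun q => A q l)) p h k - fderiv ℝ (fderiv ℝ (fun q => A q k)) p h l
      + (br (fderiv ℝ (fun q => A q k) p h) (A p l)
        + br (A p k) (fderiv ℝ (fun q => A q l) p h)) := by
    intro h k l
    have h1 : ∀ k l, HasFDerivAt (fun q => fderiv ℝ (fun q => A q k) q l) _ p := fun k l =>
      ((((hAk k).fderiv_right (m := ∞) (by simp)).differentiable (by simp)) p).hasFDerivAt.clm_apply
        (hasFDerivAt_const l p)
    have h2 : ∀ k, HasFDerivAt (fun q => A q k) (fderiv ℝ (fun q => A q k) p) p := fun k =>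
      (((hAk k).differentiable (by simp)) p).hasFDerivAt
    have h5 : HasFDerivAt (curv br A k l) _ p := ((h1 l k).sub (h1 k l)).add
      ((br.hasFDerivAt.comp p (h2 k)).clm_apply (h2 l))
    rw [h5.fderiv]
    simp
    abel
  simp only [covDir, key]
  rw [fderiv_fderiv_symm (hAk h) p k l, fderiv_fderiv_symm (hAk k) p h l,
    fderiv_fderiv_symm (hAk l) p h k]
  simp only [curv, map_add, map_sub]
  linear_combination (norm := module) -hJ.rep (A p h) (A p k) (A p l) + hbr (br (A p h) (A p k)) (A p l)
    + congrArg (br (A p k)) (hbr (A p l) (A p h))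
    + hbr (fderiv ℝ (fun q => A q k) p h) (A p l)
    + hbr (fderiv ℝ (fun q => A q l) p k) (A p h)
    + hbr (fderiv ℝ (fun q => A q h) p l) (A p k) + map_neg (br (A p k)) (br (A p h) (A p l))

/-! ### The stress-energy tensor and its conservation. -/

section Stress

variable {ι : Type*} [Fintype ι] (br ρ A) (η : ι → ℝ) (e : ι → E) (m : E → E → ℝ) (φ : E → W)
  (𝒱 : E → ℝ)

/-- The Lagrangian density in the frame `e` with potential term `𝒱`. -/
def lagr (p : E) : ℝ :=
  ∑ α, η α * inner ℝ (covDir ρ A (e α) φ p) (covDir ρ A (e α) φ p) - 𝒱 p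
    - (1 / 4) * ∑ α, ∑ β, η α * η β *
        inner ℝ (curv br A (e α) (e β) p) (curv br A (e α) (e β) p)

/-- The components of the stress-energy tensor in the directions `h`, `k`, for the metric `m`. -/
def stress (h k p : E) : ℝ :=
  2 * inner ℝ (covDir ρ A h φ p) (covDir ρ A k φ p)
    - ∑ β, η β * inner ℝ (curv br A h (e β) p) (curv br A k (e β) p)
    - m h k * lagr br ρ A η e φ 𝒱 p

variable {br ρ A φ 𝒱 η e m}

/-- The order `n` is that of the potential term: V is only differentiable, so along a solution 𝒱 is
merely C¹ while everything else is smooth. -/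
theorem contDiff_lagr {n : ℕ∞} (hA : ContDiff ℝ ∞ A) (hφ : ContDiff ℝ ∞ φ)
    (h𝒱 : ContDiff ℝ n 𝒱) : ContDiff ℝ n (lagr br ρ A η e φ 𝒱) := by
  have hn : (n : WithTop ℕ∞) ≤ ∞ := mod_cast le_top
  have h1 : ∀ h, ContDiff ℝ n (covDir ρ A h φ) := fun h => (contDiff_covDir hA hφ h).of_le hn
  have h2 : ∀ h k, ContDiff ℝ n (curv br A h k) := fun h k => (contDiff_curv hA h k).of_le hn
  refine ((ContDiff.sum fun α _ => contDiff_const.mul ((h1 _).inner ℝ (h1 _))).sub h𝒱).sub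
    (contDiff_const.mul (ContDiff.sum fun α _ => ContDiff.sum fun β _ =>
      contDiff_const.mul ((h2 _ _).inner ℝ (h2 _ _))))

theorem contDiff_stress {n : ℕ∞} (hA : ContDiff ℝ ∞ A) (hφ : ContDiff ℝ ∞ φ)
    (h𝒱 : ContDiff ℝ n 𝒱) (h k : E) : ContDiff ℝ n (stress br ρ A η e m φ 𝒱 h k) := by
  have hn : (n : WithTop ℕ∞) ≤ ∞ := mod_cast le_top
  have h1 : ∀ h, ContDiff ℝ n (covDir ρ A h φ) := fun h => (contDiff_covDir hA hφ h).of_le hn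
  have h2 : ∀ h k, ContDiff ℝ n (curv br A h k) := fun h k => (contDiff_curv hA h k).of_le hn
  exact ((contDiff_const.mul ((h1 _).inner ℝ (h1 _))).sub
    (ContDiff.sum fun β _ => contDiff_const.mul ((h2 _ _).inner ℝ (h2 _ _)))).sub
    (contDiff_const.mul (contDiff_lagr hA hφ h𝒱))

theorem stress_symm (hm : ∀ h k, m h k = m k h) (h k p : E) :
    stress br ρ A η e m φ 𝒱 h k p = stress br ρ A η e m φ 𝒱 k h p := by
  simp only [stress, hm h k, real_inner_comm]

theorem isLinearMap_stress (hA : ContDiff ℝ ∞ A) (hm : ∀ k, IsLinearMap ℝ (fun h => m h k))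
    (k p : E) : IsLinearMap ℝ (fun h => stress br ρ A η e m φ 𝒱 h k p) where
  map_add x y := by
    simp only [stress, (isLinearMap_covDir (ρ := ρ) (A := A) φ p).map_add, (hm k).map_add,
      (isLinearMap_curv (br := br) hA _ p).map_add, inner_add_left, mul_add,
      Finset.sum_add_distrib]
    ring
  map_smul c x := by
    simp only [stress, (isLinearMap_covDir (ρ := ρ) (A := A) φ p).map_smul, (hm k).map_smul,
      (isLinearMap_curv (br := br) hA _ p).map_smul, real_inner_smul_left, smul_eq_mul,
      mul_left_comm _ c, ← Finset.mul_sum]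
    ring

theorem fderiv_lagr (hρ : SkewRep br ρ) (hJ : SkewRep br br)
    (hA : ContDiff ℝ ∞ A) (hφ : ContDiff ℝ ∞ φ) {p : E} (h𝒱 : DifferentiableAt ℝ 𝒱 p) (k : E) :
    fderiv ℝ (lagr br ρ A η e φ 𝒱) p k =
      2 * ∑ α, η α * inner ℝ (covDir ρ A k (covDir ρ A (e α) φ) p) (covDir ρ A (e α) φ p)
      - fderiv ℝ 𝒱 p k
      - (1 / 2) * ∑ α, ∑ β, η α * η β *
        inner ℝ (covDir br A k (curv br A (e α) (e β)) p) (curv br A (e α) (e β) p) := by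
  have d1 : ∀ h, DifferentiableAt ℝ (covDir ρ A h φ) p := fun h =>
    ((contDiff_covDir hA hφ h).differentiable (by simp)) p
  have d2 : ∀ h k, DifferentiableAt ℝ (curv br A h k) p := fun h k =>
    ((contDiff_curv hA h k).differentiable (by simp)) p
  have h1 : ∀ α, HasFDerivAt (fun q => η α * inner ℝ (covDir ρ A (e α) φ q)
      (covDir ρ A (e α) φ q)) _ p := fun α =>
    (((d1 (e α)).inner ℝ (d1 (e α))).hasFDerivAt).const_mul (η α)
  have h2 : ∀ α β, HasFDerivAt (fun q => η α * η β * inner ℝ (curv br A (e α) (e β) q)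
      (curv br A (e α) (e β) q)) _ p := fun α β =>
    (((d2 (e α) (e β)).inner ℝ (d2 (e α) (e β))).hasFDerivAt).const_mul (η α * η β)
  have h3 : HasFDerivAt (lagr br ρ A η e φ 𝒱) _ p :=
    ((HasFDerivAt.fun_sum fun α (_ : α ∈ Finset.univ) => h1 α).sub h𝒱.hasFDerivAt).sub
      ((HasFDerivAt.fun_sum fun α (_ : α ∈ Finset.univ) =>
        HasFDerivAt.fun_sum fun β (_ : β ∈ Finset.univ) => h2 α β).const_mul (1 / 4))
  rw [h3.fderiv]
  simp only [sub_apply, smul_apply, sum_apply, smul_eq_mul,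
    fderiv_inner_covDir (A := A) hρ.skew (d1 _) (d1 _),
    fderiv_inner_covDir (A := A) hJ.skew (d2 _ _) (d2 _ _)]
  simp only [real_inner_comm (covDir ρ A k (covDir ρ A (e _) φ) p),
    real_inner_comm (covDir br A k (curv br A (e _) (e _)) p), ← two_mul, Finset.mul_sum]
  congr 1
  · congr 1
    exact Finset.sum_congr rfl fun _ _ => by ring
  · exact Finset.sum_congr rfl fun _ _ => Finset.sum_congr rfl fun _ _ => by ring

theorem fderiv_stress (hρ : SkewRep br ρ) (hJ : SkewRep br br)
    (hA : ContDiff ℝ ∞ A) (hφ : ContDiff ℝ ∞ φ) {p : E} (h𝒱 : DifferentiableAt ℝ 𝒱 p)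
    (h k l : E) :
    fderiv ℝ (stress br ρ A η e m φ 𝒱 h k) p l =
      2 * (inner ℝ (covDir ρ A l (covDir ρ A h φ) p) (covDir ρ A k φ p)
        + inner ℝ (covDir ρ A h φ p) (covDir ρ A l (covDir ρ A k φ) p))
      - ∑ β, η β * (inner ℝ (covDir br A l (curv br A h (e β)) p) (curv br A k (e β) p)
        + inner ℝ (curv br A h (e β) p) (covDir br A l (curv br A k (e β)) p))
      - m h k * fderiv ℝ (lagr br ρ A η e φ 𝒱) p l := by
  have d1 : ∀ h, DifferentiableAt ℝ (covDir ρ A h φ) p := fun h =>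
    ((contDiff_covDir hA hφ h).differentiable (by simp)) p
  have d2 : ∀ h k, DifferentiableAt ℝ (curv br A h k) p := fun h k =>
    ((contDiff_curv hA h k).differentiable (by simp)) p
  -- At this point 𝒱 is only known to be differentiable at `p`, so the smooth remainder is split off
  -- as the Lagrangian with zero potential.
  have d3 : DifferentiableAt ℝ (lagr br ρ A η e φ 𝒱) p := by
    have h1 : ContDiff ℝ ∞ (lagr br ρ A η e φ 0) := contDiff_lagr hA hφ contDiff_const
    have h2 : lagr br ρ A η e φ 𝒱 = fun q => lagr br ρ A η e φ 0 q - 𝒱 q := by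
      ext q; simp only [lagr, Pi.zero_apply]; ring
    rw [h2]
    exact (h1.differentiable (by simp) p).sub h𝒱
  have h3 : HasFDerivAt (stress br ρ A η e m φ 𝒱 h k) _ p :=
    ((((d1 h).inner ℝ (d1 k)).hasFDerivAt.const_mul 2).sub
      (HasFDerivAt.fun_sum fun β (_ : β ∈ Finset.univ) =>
        ((d2 h (e β)).inner ℝ (d2 k (e β))).hasFDerivAt.const_mul (η β))).sub
      (d3.hasFDerivAt.const_mul (m h k))
  rw [h3.fderiv]
  simp only [sub_apply, smul_apply, sum_apply, smul_eq_mul,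
    fderiv_inner_covDir (A := A) hρ.skew (d1 _) (d1 _),
    fderiv_inner_covDir (A := A) hJ.skew (d2 _ _) (d2 _ _)]

/-- The stress-energy tensor of a solution of the field equations is conserved. -/
theorem stress_conserved (hρ : SkewRep br ρ) (hJ : SkewRep br br)
    (hbr : ∀ u v, br u v = -br v u) (hA : ContDiff ℝ ∞ A) (hφ : ContDiff ℝ ∞ φ) {p : E}
    (h𝒱 : DifferentiableAt ℝ 𝒱 p) {S : W}
    (hS : ∀ k, fderiv ℝ 𝒱 p k = 2 * inner ℝ S (covDir ρ A k φ p))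
    (heq : ∑ α, η α • covDir ρ A (e α) (covDir ρ A (e α) φ) p + S = 0)
    (hgauge : ∀ β u, inner ℝ (∑ α, η α • covDir br A (e α) (curv br A (e α) (e β)) p) u
      = -2 * inner ℝ (ρ u (φ p)) (covDir ρ A (e β) φ p))
    (hframe : ∀ k, ∑ α, (η α * m (e α) k) • e α = k) (k : E) :
    ∑ α, η α * fderiv ℝ (stress br ρ A η e m φ 𝒱 (e α) k) p (e α) = 0 := by
  -- Completeness of the frame contracts the metric term of the stress tensor to the derivative of
  -- the Lagrangian along `k`.
  have hl : ∑ α, η α * (m (e α) k * fderiv ℝ (lagr br ρ A η e φ 𝒱) p (e α))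
      = fderiv ℝ (lagr br ρ A η e φ 𝒱) p k := by
    conv_rhs => rw [← hframe k, map_sum]
    exact Finset.sum_congr rfl fun α _ => by rw [map_smul, smul_eq_mul]; ring
  have h1 : ∑ α, η α * inner ℝ (covDir ρ A (e α) (covDir ρ A (e α) φ) p) (covDir ρ A k φ p)
      = -inner ℝ S (covDir ρ A k φ p) := by
    rw [← inner_neg_left, ← eq_neg_of_add_eq_zero_left heq, sum_inner]
    simp only [real_inner_smul_left]
  -- Exchanging the two covariant derivatives of φ produces the force of the field on the current;
  -- the Yang–Mills equation in `h3` produces the same term with the opposite sign.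
  have h2 : ∀ α, inner ℝ (covDir ρ A (e α) φ p) (covDir ρ A (e α) (covDir ρ A k φ) p)
      = inner ℝ (covDir ρ A k (covDir ρ A (e α) φ) p) (covDir ρ A (e α) φ p)
        - inner ℝ (ρ (curv br A k (e α) p) (φ p)) (covDir ρ A (e α) φ p) := by
    intro α
    rw [← covDir_comm hρ hA hφ, inner_sub_left, real_inner_comm]
    ring
  have h3 : ∑ α, η α * ∑ β, η β *
        inner ℝ (covDir br A (e α) (curv br A (e α) (e β)) p) (curv br A k (e β) p)
      = -2 * ∑ β, η β * inner ℝ (ρ (curv br A k (e β) p) (φ p)) (covDir ρ A (e β) φ p) := by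
    simp only [Finset.mul_sum]
    rw [Finset.sum_comm]
    refine Finset.sum_congr rfl fun β _ => ?_
    rw [mul_left_comm, ← hgauge, sum_inner, Finset.mul_sum]
    refine Finset.sum_congr rfl fun α _ => ?_
    rw [real_inner_smul_left]; ring
  -- Symmetrizing the left side in α and β and applying the Bianchi identity gives the gauge part of
  -- the derivative of the Lagrangian along `k`.
  have h4 : 2 * ∑ α, ∑ β, η α * η β *
        inner ℝ (curv br A (e α) (e β) p) (covDir br A (e α) (curv br A k (e β)) p)
      = ∑ α, ∑ β, η α * η β *
        inner ℝ (covDir br A k (curv br A (e α) (e β)) p) (curv br A (e α) (e β) p) := by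
    have hneg : ∀ h k l, covDir br A h (curv br A k l) p = -covDir br A h (curv br A l k) p := by
      intro h k l
      have : curv br A k l = -curv br A l k := funext fun q => curv_antisymm hbr k l q
      simp only [this, covDir, fderiv_neg, Pi.neg_apply, map_neg, neg_apply]
      abel
    rw [two_mul]
    nth_rewrite 2 [Finset.sum_comm]
    simp only [← Finset.sum_add_distrib]
    refine Finset.sum_congr rfl fun α _ => Finset.sum_congr rfl fun β _ => ?_
    have hb := bianchi hbr hJ hA (e α) (e β) k p
    have hb' : covDir br A k (curv br A (e α) (e β)) p
        = covDir br A (e α) (curv br A k (e β)) p - covDir br A (e β) (curv br A k (e α)) p := by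
      rw [hneg (e α) (e β) k] at hb
      linear_combination (norm := module) hb
    rw [hb', curv_antisymm hbr (e β) (e α), inner_neg_left, inner_sub_left,
      real_inner_comm (covDir br A (e α) (curv br A k (e β)) p),
      real_inner_comm (covDir br A (e β) (curv br A k (e α)) p)]
    ring
  simp only [fderiv_stress hρ hJ hA hφ h𝒱, mul_sub, Finset.sum_sub_distrib, hl]
  simp only [fderiv_lagr hρ hJ hA hφ h𝒱, hS, h2, mul_sub, Finset.sum_sub_distrib, mul_add, Finset.sum_add_distrib, mul_left_comm _ (2 : ℝ),
    ← Finset.mul_sum, h1, h3]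
  have h5 : ∑ α, η α * ∑ β, η β *
        inner ℝ (curv br A (e α) (e β) p) (covDir br A (e α) (curv br A k (e β)) p)
      = ∑ α, ∑ β, η α * η β *
        inner ℝ (curv br A (e α) (e β) p) (covDir br A (e α) (curv br A k (e β)) p) := by
    simp only [Finset.mul_sum, mul_assoc]
  rw [h5, ← h4]
  ring

end Stress

end Connection

/-! ### Minkowski geometry -/

/-- The Minkowski product. -/
def mink (p q : Spacetime) : ℝ := p.1 * q.1 - inner ℝ p.2 q.2

theorem mink_symm (p q : Spacetime) : mink p q = mink q p := by
  simp only [mink, real_inner_comm]; ring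

theorem isLinearMap_mink_left (q : Spacetime) : IsLinearMap ℝ (fun p => mink p q) where
  map_add x y := by simp only [mink, Prod.fst_add, Prod.snd_add, inner_add_left]; ring
  map_smul c x := by
    simp only [mink, Prod.smul_fst, Prod.smul_snd, real_inner_smul_left, smul_eq_mul]; ring

theorem isLinearMap_mink_right (p : Spacetime) : IsLinearMap ℝ (fun q => mink p q) := by
  simpa only [mink_symm p] using isLinearMap_mink_left p

@[fun_prop]
theorem contDiff_mink {E : Type*} [NormedAddCommGroup E] [NormedSpace ℝ E] {n : WithTop ℕ∞}
    {f g : E → Spacetime} (hf : ContDiff ℝ n f) (hg : ContDiff ℝ n g) :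
    ContDiff ℝ n (fun p => mink (f p) (g p)) :=
  (hf.fst.mul hg.fst).sub (hf.snd.inner ℝ hg.snd)

/-- A frame `e` that is orthonormal for the Minkowski product. -/
def IsFrame (e : Fin 4 → Spacetime) : Prop :=
  ∀ p, ∑ α, (eta α * mink (e α) p) • e α = p

theorem sum_isLinearMap {Z : Type*} [AddCommGroup Z] [Module ℝ Z] {f : Spacetime → Z}
    (hf : IsLinearMap ℝ f) (c : Fin 4 → ℝ) (e : Fin 4 → Spacetime) :
    f (∑ α, c α • e α) = ∑ α, c α • f (e α) := by
  have := map_sum (hf.mk' f) (fun α => c α • e α) Finset.univ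
  simpa only [IsLinearMap.mk'_apply, hf.map_smul] using this

/-- The trace of a bilinear form does not depend on the frame. -/
theorem IsFrame.trace_eq {e f : Fin 4 → Spacetime} (he : IsFrame e) (hf : IsFrame f)
    {Z : Type*} [AddCommGroup Z] [Module ℝ Z] {Q : Spacetime → Spacetime → Z}
    (h1 : ∀ k, IsLinearMap ℝ (fun h => Q h k)) (h2 : ∀ h, IsLinearMap ℝ (fun k => Q h k)) :
    ∑ α, eta α • Q (e α) (e α) = ∑ α, eta α • Q (f α) (f α) := by
  -- Each trace is expanded in one slot only, in the other frame; both become the same sum over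
  -- mixed entries `Q (e α) (f β)`.
  have a : ∀ α, Q (e α) (e α) = ∑ β, (eta β * mink (f β) (e α)) • Q (e α) (f β) := by
    intro α
    conv_lhs => rw [← hf (e α)]
    rw [hf (e α)]
    nth_rewrite 2 [← hf (e α)]
    exact sum_isLinearMap (h2 (e α)) _ _
  have b : ∀ β, Q (f β) (f β) = ∑ α, (eta α * mink (e α) (f β)) • Q (e α) (f β) := by
    intro β
    nth_rewrite 1 [← he (f β)]
    exact sum_isLinearMap (h1 (f β)) _ _
  simp only [a, b, Finset.smul_sum, smul_smul]
  rw [Finset.sum_comm]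
  refine Finset.sum_congr rfl fun β _ => Finset.sum_congr rfl fun α _ => ?_
  rw [mink_symm (f β)]
  congr 1
  ring

theorem inner_single_space (i : Fin 3) (x : Space) :
    inner ℝ (EuclideanSpace.single i (1 : ℝ)) x = x i := by
  simp [EuclideanSpace.inner_single_left]

theorem sum_smul_single (x : Space) : ∑ i, x i • EuclideanSpace.single i (1 : ℝ) = x := by
  ext j; simp [Finset.sum_apply, Pi.single_apply]

theorem isFrame_dir : IsFrame dir := by
  intro p
  rw [Fin.sum_univ_succ]
  simp only [eta, dir, mink, Fin.cons_zero, Fin.cons_succ, inner_single_space]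
  ext1
  · simp [Prod.fst_sum]
  · simp only [Prod.snd_add, Prod.snd_sum, Prod.smul_snd]
    simp [sum_smul_single]

/-- The rest frame of an observer with velocity `v`. -/
def boostFrame (v : Space) : Fin 4 → Spacetime :=
  Fin.cons ((√(1 - ‖v‖ ^ 2))⁻¹ • (1, v)) fun i : Fin 3 =>
    ((√(1 - ‖v‖ ^ 2))⁻¹ * v i, EuclideanSpace.single i 1 +
      ((√(1 - ‖v‖ ^ 2))⁻¹ ^ 2 / ((√(1 - ‖v‖ ^ 2))⁻¹ + 1) * v i) • v)

/-- The four-velocity. -/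
def fourVel (v : Space) : Spacetime := (√(1 - ‖v‖ ^ 2))⁻¹ • (1, v)

theorem boostFrame_zero (v : Space) : boostFrame v 0 = fourVel v := rfl

theorem lorentz_factor {v : Space} (hv : ‖v‖ < 1) :
    0 < (√(1 - ‖v‖ ^ 2))⁻¹ ∧ (√(1 - ‖v‖ ^ 2))⁻¹ ^ 2 * (1 - ‖v‖ ^ 2) = 1 := by
  have h : 0 < 1 - ‖v‖ ^ 2 := by nlinarith [norm_nonneg v]
  refine ⟨by positivity, ?_⟩
  rw [inv_pow, Real.sq_sqrt h.le, inv_mul_cancel₀ h.ne']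

theorem sum_sq_space (v : Space) : ∑ i, v i * v i = ‖v‖ ^ 2 := by
  rw [EuclideanSpace.real_norm_sq_eq]
  simp only [sq]

theorem sum_mul_space (v x : Space) : ∑ i, v i * x i = inner ℝ v x := by
  simp [PiLp.inner_apply, mul_comm]

theorem isFrame_boostFrame {v : Space} (hv : ‖v‖ < 1) : IsFrame (boostFrame v) := by
  obtain ⟨h0, h1⟩ := lorentz_factor hv
  intro p
  rw [Fin.sum_univ_succ]
  simp only [boostFrame, eta, Fin.cons_zero, Fin.cons_succ]
  set γ := (√(1 - ‖v‖ ^ 2))⁻¹ with hγ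
  -- κ is (γ - 1) / ‖v‖² written without division by ‖v‖², so that v = 0 is not exceptional.
  obtain ⟨κ, hκ⟩ : ∃ κ, κ = γ ^ 2 / (γ + 1) := ⟨_, rfl⟩
  have h2 : κ * ‖v‖ ^ 2 = γ - 1 := by
    rw [hκ]; field_simp; linear_combination -h1
  have h2' : κ * (γ + 1) = γ ^ 2 := by rw [hκ]; field_simp
  rw [← hκ]
  simp only [mink, Prod.smul_mk, inner_add_left, real_inner_smul_left, inner_single_space,
    smul_eq_mul]
  have e1 := sum_sq_space v
  have e2 := sum_mul_space v p.2
  set s := inner ℝ v p.2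
  ext1
  · simp only [Prod.fst_add, Prod.fst_sum]
    have : ∑ i, -1 * (γ * v i * p.1 - (p.2 i + κ * v i * s)) * (γ * v i) =
        (-γ ^ 2 * p.1 + γ * κ * s) * (∑ i, v i * v i) + γ * ∑ i, v i * p.2 i := by
      simp only [Finset.mul_sum, ← Finset.sum_add_distrib]
      exact Finset.sum_congr rfl fun _ _ => by ring
    rw [this, e1, e2]
    linear_combination p.1 * h1 + γ * s * h2
  · simp only [Prod.snd_add, Prod.snd_sum]
    have : ∑ i, (-1 * (γ * v i * p.1 - (p.2 i + κ * v i * s))) •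
          (EuclideanSpace.single i (1 : ℝ) + (κ * v i) • v) =
        ∑ i, p.2 i • EuclideanSpace.single i (1 : ℝ)
        + (-γ * p.1 + κ * s) • ∑ i, v i • EuclideanSpace.single i (1 : ℝ)
        + ((-γ * p.1 + κ * s) * κ * (∑ i, v i * v i) + κ * ∑ i, v i * p.2 i) • v := by
      simp only [Finset.mul_sum, Finset.smul_sum, ← Finset.sum_add_distrib, Finset.sum_smul]
      exact Finset.sum_congr rfl fun _ _ => by module
    rw [this, e1, e2, sum_smul_single, sum_smul_single]
    match_scalars
    · linear_combination (-γ * p.1 + κ * s) * h2 + s * h2'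
    · ring

theorem mink_boostFrame {v : Space} (hv : ‖v‖ < 1) (i j : Fin 3) :
    mink (boostFrame v i.succ) (boostFrame v j.succ) = if i = j then -1 else 0 := by
  obtain ⟨h0, h1⟩ := lorentz_factor hv
  simp only [boostFrame, Fin.cons_succ]
  set γ := (√(1 - ‖v‖ ^ 2))⁻¹ with hγ
  obtain ⟨κ, hκ⟩ : ∃ κ, κ = γ ^ 2 / (γ + 1) := ⟨_, rfl⟩
  have h2 : κ * ‖v‖ ^ 2 = γ - 1 := by
    rw [hκ]; field_simp; linear_combination -h1
  have h2' : κ * (γ + 1) = γ ^ 2 := by rw [hκ]; field_simp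
  rw [← hκ]
  simp only [mink, inner_add_left, inner_add_right, real_inner_smul_left, real_inner_smul_right,
    inner_single_space, real_inner_self_eq_norm_sq,
    real_inner_comm (EuclideanSpace.single j (1 : ℝ)) v]
  have : (EuclideanSpace.single j (1 : ℝ)) i = if i = j then (1 : ℝ) else 0 := by
    simp [PiLp.single_apply]
  rw [this]
  split_ifs with hij
  · subst hij
    linear_combination -v i * v i * h2' - κ * v i * v i * h2
  · linear_combination -v i * v j * h2' - κ * v i * v j * h2

theorem mink_fourVel_boostFrame {v : Space} (hv : ‖v‖ < 1) (i : Fin 3) :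
    mink (fourVel v) (boostFrame v i.succ) = 0 := by
  obtain ⟨h0, h1⟩ := lorentz_factor hv
  simp only [boostFrame, fourVel, Fin.cons_succ]
  set γ := (√(1 - ‖v‖ ^ 2))⁻¹ with hγ
  obtain ⟨κ, hκ⟩ : ∃ κ, κ = γ ^ 2 / (γ + 1) := ⟨_, rfl⟩
  have h2 : κ * ‖v‖ ^ 2 = γ - 1 := by
    rw [hκ]; field_simp; linear_combination -h1
  rw [← hκ]
  simp only [mink, inner_add_right, real_inner_smul_left, real_inner_smul_right, Prod.smul_mk,
    real_inner_self_eq_norm_sq, real_inner_comm (EuclideanSpace.single i (1 : ℝ)) v,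
    inner_single_space, smul_eq_mul]
  linear_combination -γ * v i * h2

theorem mink_fourVel_self {v : Space} (hv : ‖v‖ < 1) : mink (fourVel v) (fourVel v) = 1 := by
  obtain ⟨h0, h1⟩ := lorentz_factor hv
  simp only [fourVel, mink, Prod.smul_mk, real_inner_self_eq_norm_sq, smul_eq_mul, norm_smul,
    mul_pow, Real.norm_eq_abs, sq_abs]
  linear_combination h1

/-! ### The divergence theorem over one period -/

theorem inner_rot (M : Matrix.specialOrthogonalGroup (Fin 3) ℝ) (x y : Space) :
    inner ℝ (rot (M : Matrix (Fin 3) (Fin 3) ℝ) x) (rot M y) = inner ℝ x y := by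
  have h : (M : Matrix (Fin 3) (Fin 3) ℝ).transpose * M = 1 := by
    have := (Matrix.mem_orthogonalGroup_iff' (Fin 3) ℝ).1
      (Matrix.mem_specialOrthogonalGroup_iff.1 M.2).1
    simpa [Matrix.star_eq_conjTranspose] using this
  simp only [rot, EuclideanSpace.inner_eq_star_dotProduct, star_trivial]
  rw [Matrix.dotProduct_mulVec, ← Matrix.mulVec_transpose, Matrix.mulVec_mulVec, h,
    Matrix.one_mulVec]

theorem rot_mul (M M' : Matrix (Fin 3) (Fin 3) ℝ) (x : Space) :
    rot (M * M') x = rot M (rot M' x) := by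
  simp [rot, Matrix.mulVec_mulVec]

theorem rot_one (x : Space) : rot 1 x = x := by simp [rot]

/-- A rotation as a linear isometry of space. -/
def rotIso (M : Matrix.specialOrthogonalGroup (Fin 3) ℝ) : Space ≃ₗᵢ[ℝ] Space where
  toFun x := rot (M : Matrix (Fin 3) (Fin 3) ℝ) x
  invFun x := rot ((M⁻¹ : Matrix.specialOrthogonalGroup (Fin 3) ℝ) : Matrix (Fin 3) (Fin 3) ℝ) x
  map_add' x y := by simp [rot, Matrix.mulVec_add]
  map_smul' c x := by simp [rot, Matrix.mulVec_smul]
  left_inv x := by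
    show rot _ (rot _ x) = x
    rw [← rot_mul, ← Submonoid.coe_mul, inv_mul_cancel, Submonoid.coe_one, rot_one]
  right_inv x := by
    show rot _ (rot _ x) = x
    rw [← rot_mul, ← Submonoid.coe_mul, mul_inv_cancel, Submonoid.coe_one, rot_one]
  norm_map' x := by
    have := inner_rot M x x
    rw [real_inner_self_eq_norm_sq, real_inner_self_eq_norm_sq] at this
    exact (pow_left_inj₀ (norm_nonneg _) (norm_nonneg _) two_ne_zero).1 this

namespace Period

variable (P : Period)

theorem back_eq (x : Space) : P.back x = (rotIso P.Ω).symm x - P.l := rfl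

theorem measurePreserving_back : MeasurePreserving P.back := by
  have h1 := (rotIso P.Ω).symm.measurePreserving
  have h2 := measurePreserving_sub_right (volume : Measure Space) P.l
  exact h2.comp h1

/-- The velocity of the periodic motion. -/
def vel : Space := P.T⁻¹ • P.l

theorem norm_vel_lt : ‖P.vel‖ < 1 := by
  rw [vel, norm_smul, norm_inv, Real.norm_of_nonneg P.T_pos.le, inv_mul_eq_div]
  exact P.subluminal

theorem T_smul_vel : P.T • P.vel = P.l := by
  rw [vel, smul_smul, mul_inv_cancel₀ P.T_pos.ne', one_smul]

theorem rot_vel : rotIso P.Ω P.vel = P.vel := by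
  rw [vel, map_smul]; congr 1; exact P.rot_l

theorem measurableSet_slab : MeasurableSet P.slab := measurableSet_Icc.prod MeasurableSet.univ

theorem volume_restrict_slab : (volume : Measure Spacetime).restrict P.slab
    = ((volume : Measure ℝ).restrict (Set.Icc 0 P.T)).prod (volume : Measure Space) := by
  rw [slab, Measure.volume_eq_prod, ← Measure.prod_restrict, Measure.restrict_univ]

/-- During one period the axis of motion moves by at most T ‖v‖, so the part of the tube of radius
`R` in the slab lies in a compact cylinder. -/
theorem integrableOn_slab_of_support {f : Spacetime → ℝ} (hf : Continuous f) {R : ℝ}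
    (hR : ∀ p : Spacetime, R < ‖p.2 - p.1 • P.vel‖ → f p = 0) : IntegrableOn f P.slab := by
  set K : Set Spacetime := Set.Icc 0 P.T ×ˢ Metric.closedBall 0 (R + P.T * ‖P.vel‖)
  have hK : IsCompact K := isCompact_Icc.prod (isCompact_closedBall _ _)
  refine (hf.continuousOn.integrableOn_compact hK).of_forall_sdiff_eq_zero P.measurableSet_slab ?_
  rintro ⟨t, x⟩ ⟨⟨ht, -⟩, hx⟩
  apply hR
  have hx' : R + P.T * ‖P.vel‖ < ‖x‖ := by
    by_contra h
    exact hx ⟨ht, by simpa using not_lt.1 h⟩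
  have h1 := norm_sub_norm_le x (t • P.vel)
  rw [norm_smul, Real.norm_of_nonneg ht.1] at h1
  have h2 : t * ‖P.vel‖ ≤ P.T * ‖P.vel‖ := mul_le_mul_of_nonneg_right ht.2 (norm_nonneg _)
  simp only
  linarith

end Period

theorem pd_eq_zero_of_support {J : Spacetime → ℝ} {v : Space} {R : ℝ}
    (hR : ∀ p : Spacetime, R ≤ ‖p.2 - p.1 • v‖ → J p = 0) (h p : Spacetime)
    (hp : R < ‖p.2 - p.1 • v‖) : fderiv ℝ J p h = 0 := by
  have h1 : J =ᶠ[𝓝 p] fun _ => 0 := by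
    have : IsOpen {q : Spacetime | R < ‖q.2 - q.1 • v‖} :=
      isOpen_lt continuous_const (by fun_prop)
    filter_upwards [this.mem_nhds hp] with q hq using hR q (le_of_lt hq)
  rw [h1.fderiv_eq]; simp

/-- Integration by parts against the constant function 1. -/
theorem integral_fderiv_space_eq_zero {f : Space → ℝ} (hf : ContDiff ℝ 1 f)
    (hs : HasCompactSupport f) (h : Space) : ∫ x, fderiv ℝ f x h = 0 := by
  have h1 : Integrable f := hf.continuous.integrable_of_hasCompactSupport hs
  have h2 : Integrable (fun x => fderiv ℝ f x h) := by
    refine Continuous.integrable_of_hasCompactSupport ?_ (hs.fderiv_apply ℝ h)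
    exact (hf.continuous_fderiv (by simp)).clm_apply continuous_const
  have := integral_mul_fderiv_eq_neg_fderiv_mul_of_integrable (μ := (volume : Measure Space))
    (f := fun _ => (1 : ℝ)) (g := f) (v := h) (by simp) (by simpa using h2) (by simpa using h1)
    (fun _ _ => by fun_prop) (fun x _ => (hf.differentiable (by simp)) x)
  simpa using this

/-- Spatial derivatives integrate to zero on each time slice by compact support. The time derivative
leaves the difference of the final and initial slices, which are related by the measure-preserving
map `back`; hence only the time component has to be periodic. -/
theorem integral_slab_div_eq_zero (P : Period) {J : Fin 4 → Spacetime → ℝ}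
    (hJ : ∀ μ, ContDiff ℝ 1 (J μ)) {R : ℝ}
    (hR : ∀ μ (p : Spacetime), R ≤ ‖p.2 - p.1 • P.vel‖ → J μ p = 0)
    (hper : IsPeriodicScalar P (J 0)) :
    ∫ p in P.slab, ∑ μ, pd μ (J μ) p = 0 := by
  have hc : ∀ μ, Continuous (pd μ (J μ)) := fun μ =>
    ((hJ μ).continuous_fderiv (by simp)).clm_apply continuous_const
  have hi : ∀ μ, IntegrableOn (pd μ (J μ)) P.slab := fun μ =>
    P.integrableOn_slab_of_support (hc μ) fun p hp => pd_eq_zero_of_support (hR μ) _ p hp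
  have hd : ∀ μ p, HasFDerivAt (J μ) (fderiv ℝ (J μ) p) p := fun μ p =>
    ((hJ μ).differentiable (by simp) p).hasFDerivAt
  have hcs : ∀ μ t, HasCompactSupport fun x => J μ (t, x) := by
    intro μ t
    refine HasCompactSupport.intro (isCompact_closedBall (t • P.vel) R) fun x hx => ?_
    apply hR
    rw [Metric.mem_closedBall, dist_eq_norm, not_le] at hx
    exact hx.le
  rw [integral_finsetSum _ fun μ _ => hi μ]
  rw [Fin.sum_univ_succ]
  have hspace : ∀ i : Fin 3, ∫ p in P.slab, pd i.succ (J i.succ) p = 0 := by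
    intro i
    have h := hi i.succ
    rw [IntegrableOn, P.volume_restrict_slab] at h
    rw [P.volume_restrict_slab, integral_prod _ h]
    refine integral_eq_zero_of_ae (Eventually.of_forall fun t => ?_)
    have hx : ∀ x, pd i.succ (J i.succ) (t, x)
        = fderiv ℝ (fun x => J i.succ (t, x)) x (EuclideanSpace.single i 1) := by
      intro x
      have : HasFDerivAt (fun x => J i.succ (t, x)) _ x :=
        (hd i.succ (t, x)).comp x (hasFDerivAt_prodMk_right t x)
      rw [this.fderiv]
      simp [pd, dir]
    simp only [hx]
    refine integral_fderiv_space_eq_zero ?_ (hcs _ t) _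
    exact (hJ i.succ).comp (contDiff_prodMk_right t)
  have htime : ∫ p in P.slab, pd 0 (J 0) p = 0 := by
    have h := hi 0
    rw [IntegrableOn, P.volume_restrict_slab] at h
    rw [P.volume_restrict_slab, integral_prod_symm _ h]
    have hx : ∀ x : Space, ∫ t in Set.Icc 0 P.T, pd 0 (J 0) (t, x) = J 0 (P.T, x) - J 0 (0, x) := by
      intro x
      rw [integral_Icc_eq_integral_Ioc, ← intervalIntegral.integral_of_le P.T_pos.le]
      refine intervalIntegral.integral_eq_sub_of_hasDerivAt (f := fun t => J 0 (t, x))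
        (fun t _ => ?_) ?_
      · have := (hd 0 (t, x)).comp_hasDerivAt t ((hasDerivAt_id t).prodMk (hasDerivAt_const t x))
        simpa [pd, dir, Function.comp_def] using this
      · exact (((hc 0).comp (Continuous.prodMk_left x)).intervalIntegrable _ _)
    simp only [hx]
    have hint : ∀ t, Integrable fun x => J 0 (t, x) := fun t =>
      ((hJ 0).continuous.comp (Continuous.prodMk_right t)).integrable_of_hasCompactSupport (hcs 0 t)
    rw [integral_sub (hint _) (hint _)]
    have : ∀ x, J 0 (P.T, x) = J 0 (0, P.back x) := fun x => by
      have := hper 0 x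
      rwa [zero_add] at this
    simp only [this]
    have hb := P.measurePreserving_back.integral_comp' (f := ((rotIso P.Ω).symm.toHomeomorph.trans
      (Homeomorph.subRight P.l)).toMeasurableEquiv) (fun x => J 0 (0, x))
    rw [sub_eq_zero]
    exact hb
  simp [hspace, htime]

/-! ### Change of frame and periodicity of the fields -/

section Fields

variable {W : Type*} [NormedAddCommGroup W] [InnerProductSpace ℝ W]
  {𝔤 : Type*} [NormedAddCommGroup 𝔤] [InnerProductSpace ℝ 𝔤]
  {br : 𝔤 →L[ℝ] 𝔤 →L[ℝ] 𝔤} {ρ : 𝔤 →L[ℝ] W →L[ℝ] W} {A : Spacetime → Spacetime →L[ℝ] 𝔤}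
  {φ : Spacetime → W}

theorem isLinearMap_covDir_right {E : Type*} [NormedAddCommGroup E] [NormedSpace ℝ E]
    {A : E → E →L[ℝ] 𝔤} {f : E → E → W}
    (hf : ∀ k, Differentiable ℝ (f k)) (hl : ∀ q, IsLinearMap ℝ (fun k => f k q)) (h p : E) :
    IsLinearMap ℝ (fun k => covDir ρ A h (f k) p) where
  map_add x y := by
    have : f (x + y) = fun q => f x q + f y q := funext fun q => (hl q).map_add x y
    simp only [covDir, this, fderiv_fun_add (hf x p) (hf y p), map_add, add_apply]
    abel
  map_smul c x := by
    have : f (c • x) = fun q => c • f x q := funext fun q => (hl q).map_smul c x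
    simp only [covDir, this, fderiv_fun_const_smul (hf x p), map_smul, smul_apply, smul_add]

/-- The field equations are given in the coordinate frame and used in the rest frame; their
second-order parts are traces, so nothing changes. -/
theorem IsFrame.box_eq {e f : Fin 4 → Spacetime} (he : IsFrame e) (hf : IsFrame f)
    (hA : ContDiff ℝ ∞ A) (hφ : ContDiff ℝ ∞ φ) (p : Spacetime) :
    ∑ α, eta α • covDir ρ A (e α) (covDir ρ A (e α) φ) p
      = ∑ α, eta α • covDir ρ A (f α) (covDir ρ A (f α) φ) p :=
  he.trace_eq hf (Q := fun h k => covDir ρ A h (covDir ρ A k φ) p)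
    (fun _ => isLinearMap_covDir _ _)
    (fun h => isLinearMap_covDir_right
      (fun k => (contDiff_covDir hA hφ k).differentiable (by simp))
      (fun q => isLinearMap_covDir φ q) h p)

theorem IsFrame.divCurv_eq {e f : Fin 4 → Spacetime} (he : IsFrame e) (hf : IsFrame f)
    (hA : ContDiff ℝ ∞ A) (k p : Spacetime) :
    ∑ α, eta α • covDir br A (e α) (curv br A (e α) k) p
      = ∑ α, eta α • covDir br A (f α) (curv br A (f α) k) p :=
  he.trace_eq hf (Q := fun h l => covDir br A h (curv br A l k) p)
    (fun _ => isLinearMap_covDir _ _)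
    (fun h => isLinearMap_covDir_right (f := fun l => curv br A l k)
      (fun l => (contDiff_curv hA l k).differentiable (by simp))
      (fun q => isLinearMap_curv hA k q) h p)

theorem isLinearMap_curv_right (hbr : ∀ u v, br u v = -br v u) (hA : ContDiff ℝ ∞ A)
    (h p : Spacetime) : IsLinearMap ℝ (fun k => curv br A h k p) := by
  have h1 := isLinearMap_curv (br := br) hA h p
  simp only [curv_antisymm hbr h]
  exact ⟨fun x y => by simp only [h1.map_add]; abel, fun c x => by simp only [h1.map_smul, smul_neg]⟩

theorem isLinearMap_inner_left {f : Spacetime → W} (hf : IsLinearMap ℝ f) (w : W) :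
    IsLinearMap ℝ (fun k => inner ℝ (f k) w) where
  map_add x y := by simp only [hf.map_add, inner_add_left]
  map_smul c x := by simp only [hf.map_smul, real_inner_smul_left, smul_eq_mul]

theorem isLinearMap_inner_right {f : Spacetime → W} (hf : IsLinearMap ℝ f) (w : W) :
    IsLinearMap ℝ (fun k => inner ℝ w (f k)) where
  map_add x y := by simp only [hf.map_add, inner_add_right]
  map_smul c x := by simp only [hf.map_smul, real_inner_smul_right, smul_eq_mul]

/-! ### The periodicity as a symmetry of spacetime. -/

namespace Period

variable (P : Period)

/-- The linear part of the symmetry of spacetime under which the fields are invariant. -/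
def lin : Spacetime ≃L[ℝ] Spacetime :=
  (ContinuousLinearEquiv.refl ℝ ℝ).prodCongr (rotIso P.Ω).toContinuousLinearEquiv

/-- The symmetry of spacetime under which the fields are invariant. -/
def shift (p : Spacetime) : Spacetime := P.lin p + (P.T, P.l)

theorem lin_apply (p : Spacetime) : P.lin p = (p.1, rotIso P.Ω p.2) := rfl

theorem shift_apply (t : ℝ) (x : Space) : P.shift (t, x) = (t + P.T, rotIso P.Ω x + P.l) := rfl

theorem rotIso_l : rotIso P.Ω P.l = P.l := P.rot_l

theorem back_shift (x : Space) : P.back (rotIso P.Ω x + P.l) = x := by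
  rw [back_eq, map_add, LinearIsometryEquiv.symm_apply_apply]
  conv_lhs => rw [← P.rotIso_l, LinearIsometryEquiv.symm_apply_apply, P.rotIso_l]
  rw [add_sub_cancel_right]

theorem shift_back (t : ℝ) (x : Space) : P.shift (t, P.back x) = (t + P.T, x) := by
  rw [shift_apply, back_eq, map_sub, LinearIsometryEquiv.apply_symm_apply, rotIso_l,
    sub_add_cancel]

theorem shift_surjective : Function.Surjective P.shift := fun p =>
  ⟨(p.1 - P.T, P.back p.2), by rw [shift_back, sub_add_cancel]⟩

theorem mink_lin (p q : Spacetime) : mink (P.lin p) (P.lin q) = mink p q := by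
  simp [mink, lin_apply]

theorem lin_fourVel : P.lin (fourVel P.vel) = fourVel P.vel := by
  rw [fourVel, map_smul, lin_apply, rot_vel]

theorem lin_dir_zero : P.lin (dir 0) = dir 0 := by
  simp [lin_apply, dir]

theorem isFrame_lin {e : Fin 4 → Spacetime} (he : IsFrame e) : IsFrame (fun α => P.lin (e α)) := by
  intro p
  obtain ⟨q, rfl⟩ := P.lin.surjective p
  simp only [mink_lin, ← map_smul, ← map_sum]
  rw [he q]

theorem isPeriodicScalar_of_shift {F : Type*} {f : Spacetime → F}
    (hf : ∀ p, f (P.shift p) = f p) : IsPeriodicScalar P f := fun t x => by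
  rw [← P.shift_back t x, hf]

theorem shift_of_isPeriodicScalar {F : Type*} {f : Spacetime → F} (hf : IsPeriodicScalar P f)
    (p : Spacetime) : f (P.shift p) = f p := by
  obtain ⟨t, x⟩ := p
  rw [shift_apply, hf, back_shift]

/-- The chain rule, with a second function `f'` because components of a form taken along fixed
directions are not invariant: the component along `P.lin k` is carried to the one along `k`. -/
theorem fderiv_shift {F : Type*} [NormedAddCommGroup F] [NormedSpace ℝ F] {f f' : Spacetime → F}
    (h : ∀ p, f (P.shift p) = f' p) {p : Spacetime} (hf : DifferentiableAt ℝ f (P.shift p))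
    (k : Spacetime) : fderiv ℝ f (P.shift p) (P.lin k) = fderiv ℝ f' p k := by
  have h1 : HasFDerivAt P.shift (P.lin : Spacetime →L[ℝ] Spacetime) p :=
    P.lin.hasFDerivAt.add_const _
  have h2 : HasFDerivAt f'
      ((fderiv ℝ f (P.shift p)).comp (P.lin : Spacetime →L[ℝ] Spacetime)) p := by
    rw [show f' = f ∘ P.shift from (funext h).symm]
    exact hf.hasFDerivAt.comp p h1
  rw [h2.fderiv]; rfl

/-- A property of points that is invariant under the symmetry and holds for one period holds
everywhere. -/
theorem forall_of_slab {p : Spacetime → Prop} (hp : ∀ q, p (P.shift q) ↔ p q)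
    (h : ∀ q ∈ P.slab, p q) (q : Spacetime) : p q := by
  -- The time window grows by one period at each end: earlier points are moved forward by the
  -- symmetry, later ones back.
  have hn : ∀ (n : ℕ) (q : Spacetime), q.1 ∈ Set.Icc (-(n * P.T)) ((n + 1) * P.T) → p q := by
    intro n
    induction n with
    | zero => exact fun q hq => h q ⟨by simpa using hq, trivial⟩
    | succ n ih =>
      rintro q ⟨h1, h2⟩
      push_cast at h1 h2
      have hT := P.T_pos
      rcases lt_or_ge q.1 0 with h0 | h0
      · rw [← hp]
        apply ih
        have : (P.shift q).1 = q.1 + P.T := rfl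
        rw [this]
        constructor
        · linarith
        · have : 0 ≤ n * P.T := by positivity
          linarith
      · rcases le_or_gt q.1 P.T with h3 | h3
        · exact h q ⟨⟨h0, h3⟩, trivial⟩
        obtain ⟨q', rfl⟩ := P.shift_surjective q
        have : (P.shift q').1 = q'.1 + P.T := rfl
        rw [this] at h0 h1 h2 h3
        rw [hp]
        apply ih
        have : 0 ≤ n * P.T := by positivity
        constructor <;> linarith
  obtain ⟨n, hn'⟩ := exists_nat_ge (|q.1| / P.T)
  rw [div_le_iff₀ P.T_pos] at hn'
  have h1 := abs_le.1 (le_refl |q.1|)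
  refine hn n q ⟨by linarith [h1.1], ?_⟩
  have := P.T_pos
  linarith [h1.2]

end Period

variable {P : Period}

theorem covDir_shift (hA : ∀ p k, A (P.shift p) (P.lin k) = A p k)
    {ψ ψ' : Spacetime → W} (h : ∀ p, ψ (P.shift p) = ψ' p) {p : Spacetime}
    (hψ : DifferentiableAt ℝ ψ (P.shift p)) (k : Spacetime) :
    covDir ρ A (P.lin k) ψ (P.shift p) = covDir ρ A k ψ' p := by
  rw [covDir, covDir, P.fderiv_shift h hψ, hA, h]

theorem curv_shift (hA' : ContDiff ℝ ∞ A) (hA : ∀ p k, A (P.shift p) (P.lin k) = A p k)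
    (h k p : Spacetime) :
    curv br A (P.lin h) (P.lin k) (P.shift p) = curv br A h k p := by
  have hd : ∀ k, DifferentiableAt ℝ (fun q => A q k) (P.shift p) := fun k =>
    ((hA'.clm_apply contDiff_const).differentiable (by simp)) _
  rw [curv, curv, P.fderiv_shift (fun p => hA p k) (hd _), P.fderiv_shift (fun p => hA p h) (hd _),
    hA, hA]

theorem lagr_frame_eq {e f : Fin 4 → Spacetime} (he : IsFrame e) (hf : IsFrame f)
    (hbr : ∀ u v, br u v = -br v u)
    (hA : ContDiff ℝ ∞ A) (𝒱 : Spacetime → ℝ) (p : Spacetime) :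
    lagr br ρ A eta e φ 𝒱 p = lagr br ρ A eta f φ 𝒱 p := by
  have h1 := he.trace_eq hf (Q := fun h k => inner ℝ (covDir ρ A h φ p) (covDir ρ A k φ p))
    (fun k => isLinearMap_inner_left (isLinearMap_covDir φ p) _)
    (fun k => isLinearMap_inner_right (isLinearMap_covDir φ p) _)
  have h2 := fun k l => he.trace_eq hf
    (Q := fun h h' => inner ℝ (curv br A k h p) (curv br A l h' p))
    (fun _ => isLinearMap_inner_left (isLinearMap_curv_right hbr hA k p) _)
    (fun _ => isLinearMap_inner_right (isLinearMap_curv_right hbr hA l p) _)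
  have h3 := fun k l => he.trace_eq hf
    (Q := fun h h' => inner ℝ (curv br A h k p) (curv br A h' l p))
    (fun _ => isLinearMap_inner_left (isLinearMap_curv hA k p) _)
    (fun _ => isLinearMap_inner_right (isLinearMap_curv hA l p) _)
  simp only [smul_eq_mul] at h1 h2 h3
  simp only [lagr, h1, mul_assoc, ← Finset.mul_sum, h2]
  -- The curvature term is a double trace; exchanging the sums lets the frame be changed in one
  -- index at a time.
  have h4 : ∀ X : Fin 4 → Fin 4 → ℝ, ∑ i, eta i * ∑ j, eta j * X i j
      = ∑ j, eta j * ∑ i, eta i * X i j := by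
    intro X
    simp only [Finset.mul_sum]
    rw [Finset.sum_comm]
    exact Finset.sum_congr rfl fun _ _ => Finset.sum_congr rfl fun _ _ => by ring
  rw [h4]
  simp only [h3]
  rw [h4]

/-- The symmetry carries the frame used in the contractions to another frame, and the contractions
do not depend on it. Thus `e` need not be moved along with `h` and `k`. -/
theorem stress_shift {e : Fin 4 → Spacetime} (he : IsFrame e)
    (hbr : ∀ u v, br u v = -br v u) (hA' : ContDiff ℝ ∞ A) (hφ' : ContDiff ℝ ∞ φ)
    (hA : ∀ p k, A (P.shift p) (P.lin k) = A p k) (hφ : ∀ p, φ (P.shift p) = φ p)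
    {𝒱 : Spacetime → ℝ} (h𝒱 : ∀ p, 𝒱 (P.shift p) = 𝒱 p) (h k p : Spacetime) :
    stress br ρ A eta e mink φ 𝒱 (P.lin h) (P.lin k) (P.shift p)
      = stress br ρ A eta e mink φ 𝒱 h k p := by
  have hD : ∀ k, covDir ρ A (P.lin k) φ (P.shift p) = covDir ρ A k φ p := fun k =>
    covDir_shift hA hφ (hφ'.differentiable (by simp) _) k
  have h1 := (P.isFrame_lin he).trace_eq he
    (Q := fun x y => inner ℝ (curv br A (P.lin h) x (P.shift p)) (curv br A (P.lin k) y (P.shift p)))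
    (fun _ => isLinearMap_inner_left (isLinearMap_curv_right hbr hA' _ _) _)
    (fun _ => isLinearMap_inner_right (isLinearMap_curv_right hbr hA' _ _) _)
  simp only [smul_eq_mul, curv_shift hA' hA] at h1
  have h2 : lagr br ρ A eta e φ 𝒱 (P.shift p) = lagr br ρ A eta e φ 𝒱 p := by
    rw [lagr_frame_eq he (P.isFrame_lin he) hbr hA']
    simp only [lagr, hD, curv_shift hA' hA, h𝒱]
  simp only [stress, hD, P.mink_lin, h2, ← h1]

end Fields

/-! ### Cutoffs in the rest frame -/

/-- A smooth cutoff function of a real variable. -/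
def cut (s : ℝ) : ℝ := Real.smoothTransition (2 - s)

theorem contDiff_cut : ContDiff ℝ ∞ cut :=
  Real.smoothTransition.contDiff.comp (contDiff_const.sub contDiff_id)

theorem cut_of_le {s : ℝ} (h : s ≤ 1) : cut s = 1 :=
  Real.smoothTransition.one_of_one_le (by linarith)

theorem cut_of_ge {s : ℝ} (h : 2 ≤ s) : cut s = 0 :=
  Real.smoothTransition.zero_of_nonpos (by linarith)

theorem abs_cut_le (s : ℝ) : |cut s| ≤ 1 := by
  rw [cut, abs_of_nonneg (Real.smoothTransition.nonneg _)]
  exact Real.smoothTransition.le_one _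

theorem deriv_cut_of_lt {s : ℝ} (h : s < 1) : deriv cut s = 0 := by
  have : cut =ᶠ[𝓝 s] fun _ => 1 := by
    filter_upwards [Iio_mem_nhds h] with x hx using cut_of_le (le_of_lt hx)
  rw [this.deriv_eq, deriv_const]

theorem deriv_cut_of_gt {s : ℝ} (h : 2 < s) : deriv cut s = 0 := by
  have : cut =ᶠ[𝓝 s] fun _ => 0 := by
    filter_upwards [Ioi_mem_nhds h] with x hx using cut_of_ge (le_of_lt hx)
  rw [this.deriv_eq, deriv_const]

theorem exists_deriv_cut_bound : ∃ C, 0 ≤ C ∧ ∀ s, |deriv cut s| ≤ C := by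
  have hc : Continuous (deriv cut) := contDiff_cut.continuous_deriv (by simp)
  obtain ⟨C, hC⟩ := (isCompact_Icc (a := (1 : ℝ)) (b := 2)).exists_bound_of_continuousOn
    hc.continuousOn
  refine ⟨C, (abs_nonneg _).trans (hC 1 ⟨le_rfl, by norm_num⟩), fun s => ?_⟩
  by_cases hs : s ∈ Set.Icc (1 : ℝ) 2
  · exact hC s hs
  · have h0 : 0 ≤ C := (abs_nonneg _).trans (hC 1 ⟨le_rfl, by norm_num⟩)
    rw [Set.mem_Icc, not_and_or, not_le, not_le] at hs
    rcases hs with hs | hs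
    · rw [deriv_cut_of_lt hs]; simpa
    · rw [deriv_cut_of_gt hs]; simpa

/-- The part of `p` orthogonal to the four-velocity. -/
def restPart (v : Space) (p : Spacetime) : Spacetime := p - mink p (fourVel v) • fourVel v

/-- The squared distance from the axis of motion in the rest frame. -/
def rad2 (v : Space) (p : Spacetime) : ℝ := ∑ i : Fin 3, mink (boostFrame v i.succ) p ^ 2

theorem restPart_eq {v : Space} (hv : ‖v‖ < 1) (p : Spacetime) :
    restPart v p = ∑ i : Fin 3, (-mink (boostFrame v i.succ) p) • boostFrame v i.succ := by
  have h := isFrame_boostFrame hv p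
  rw [Fin.sum_univ_succ] at h
  simp only [eta, Fin.cons_zero, Fin.cons_succ, one_mul, neg_one_mul, boostFrame_zero] at h
  rw [restPart, mink_symm p, sub_eq_iff_eq_add']
  exact h.symm

theorem rad2_eq_restPart {v : Space} (hv : ‖v‖ < 1) (p : Spacetime) :
    rad2 v p = -mink (restPart v p) (restPart v p) := by
  have h1 : ∀ i : Fin 3, mink (boostFrame v i.succ) (restPart v p)
      = mink (boostFrame v i.succ) p := by
    intro i
    rw [restPart, (isLinearMap_mink_right _).map_sub, (isLinearMap_mink_right _).map_smul,
      mink_symm (boostFrame v i.succ) (fourVel v), mink_fourVel_boostFrame hv]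
    simp
  nth_rewrite 1 [restPart_eq hv]
  have h2 := map_sum ((isLinearMap_mink_left (restPart v p)).mk')
    (fun i : Fin 3 => (-mink (boostFrame v i.succ) p) • boostFrame v i.succ) Finset.univ
  simp only [IsLinearMap.mk'_apply, (isLinearMap_mink_left _).map_smul, h1] at h2
  rw [h2, rad2, ← Finset.sum_neg_distrib]
  exact Finset.sum_congr rfl fun i _ => by simp only [smul_eq_mul]; ring

/-- Length contraction: with y = x - t v one has `rad2` = ‖y‖² + γ² ⟪y, v⟫². Hence functions
supported near the axis in the rest frame are supported in a tube in the original frame, and a Hardy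
weight around the moving centre t v controls the weight in `rad2`. -/
theorem norm_sub_sq_le_rad2 {v : Space} (hv : ‖v‖ < 1) (p : Spacetime) :
    ‖p.2 - p.1 • v‖ ^ 2 ≤ rad2 v p := by
  obtain ⟨h0, h1⟩ := lorentz_factor hv
  have h2 : rad2 v p = mink p (fourVel v) ^ 2 - mink p p := by
    rw [rad2_eq_restPart hv]
    have h3 := mink_fourVel_self hv
    rw [restPart, (isLinearMap_mink_left _).map_sub, (isLinearMap_mink_right p).map_sub,
      (isLinearMap_mink_right (_ • _)).map_sub, (isLinearMap_mink_left _).map_smul,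
      (isLinearMap_mink_left _).map_smul, (isLinearMap_mink_right p).map_smul,
      (isLinearMap_mink_right _).map_smul, h3, mink_symm (fourVel v) p]
    simp only [smul_eq_mul]
    ring
  have h4 : inner ℝ p.2 v = p.1 * ‖v‖ ^ 2 + inner ℝ (p.2 - p.1 • v) v := by
    rw [inner_sub_left, real_inner_smul_left, real_inner_self_eq_norm_sq]; ring
  have h5 : ‖p.2‖ ^ 2 = ‖p.2 - p.1 • v‖ ^ 2 + 2 * p.1 * inner ℝ (p.2 - p.1 • v) v
      + p.1 ^ 2 * ‖v‖ ^ 2 := by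
    rw [inner_sub_left, real_inner_smul_left, real_inner_self_eq_norm_sq,
      @norm_sub_sq ℝ, norm_smul, real_inner_smul_right, mul_pow, Real.norm_eq_abs, sq_abs]
    simp only [RCLike.re_to_real]
    ring
  rw [h2]
  simp only [fourVel, mink, Prod.smul_mk, real_inner_smul_right, smul_eq_mul, mul_one,
    real_inner_self_eq_norm_sq]
  rw [h5, h4]
  set γ := (√(1 - ‖v‖ ^ 2))⁻¹
  set s := inner ℝ (p.2 - p.1 • v) v
  have : (p.1 * γ - γ * (p.1 * ‖v‖ ^ 2 + s)) ^ 2 - (p.1 * p.1 - (‖p.2 - p.1 • v‖ ^ 2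
      + 2 * p.1 * s + p.1 ^ 2 * ‖v‖ ^ 2)) = ‖p.2 - p.1 • v‖ ^ 2 + γ ^ 2 * s ^ 2 := by
    linear_combination (p.1 ^ 2 * (1 - ‖v‖ ^ 2) - 2 * p.1 * s) * h1
  rw [this]
  have : 0 ≤ γ ^ 2 * s ^ 2 := by positivity
  linarith

theorem rad2_nonneg (v : Space) (p : Spacetime) : 0 ≤ rad2 v p :=
  Finset.sum_nonneg fun _ _ => sq_nonneg _

theorem contDiff_rad2 (v : Space) : ContDiff ℝ ∞ (rad2 v) :=
  ContDiff.sum fun _ _ => (contDiff_mink contDiff_const contDiff_id).pow 2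

theorem mink_sq_le_rad2 (v : Space) (p : Spacetime) (i : Fin 3) :
    mink (boostFrame v i.succ) p ^ 2 ≤ rad2 v p :=
  Finset.single_le_sum (f := fun i : Fin 3 => mink (boostFrame v i.succ) p ^ 2)
    (fun _ _ => sq_nonneg _) (Finset.mem_univ i)

theorem fderiv_mink (q p h : Spacetime) : fderiv ℝ (fun p => mink q p) p h = mink q h := by
  have h1 : fderiv ℝ (fun p => mink q p) p
      = ((isLinearMap_mink_right q).mk' _).toContinuousLinearMap := by
    exact ((isLinearMap_mink_right q).mk' _).toContinuousLinearMap.fderiv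
  rw [h1]; rfl

theorem hasFDerivAt_mink (q p : Spacetime) :
    HasFDerivAt (fun p => mink q p) (fderiv ℝ (fun p => mink q p) p) p :=
  ((contDiff_mink contDiff_const contDiff_id).differentiable (n := 1) (by simp) p).hasFDerivAt

theorem fderiv_rad2 (v : Space) (p h : Spacetime) : fderiv ℝ (rad2 v) p h
    = 2 * ∑ i : Fin 3, mink (boostFrame v i.succ) p * mink (boostFrame v i.succ) h := by
  have h1 : HasFDerivAt (rad2 v) _ p :=
    HasFDerivAt.fun_sum fun i (_ : i ∈ Finset.univ) =>
      (hasFDerivAt_mink (boostFrame v (Fin.succ i)) p).pow 2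
  rw [h1.fderiv]
  simp only [sum_apply, smul_apply, fderiv_mink, smul_eq_mul, Finset.mul_sum]
  exact Finset.sum_congr rfl fun i _ => by norm_num; ring

/-- The distance from the axis is constant along the four-velocity, so cutoffs in it produce no
time-derivative terms in the rest frame. -/
theorem fderiv_rad2_zero {v : Space} (hv : ‖v‖ < 1) (p : Spacetime) :
    fderiv ℝ (rad2 v) p (boostFrame v 0) = 0 := by
  rw [fderiv_rad2, boostFrame_zero]
  simp [mink_symm _ (fourVel v), mink_fourVel_boostFrame hv]

theorem fderiv_rad2_succ {v : Space} (hv : ‖v‖ < 1) (p : Spacetime) (j : Fin 3) :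
    fderiv ℝ (rad2 v) p (boostFrame v j.succ) = -2 * mink (boostFrame v j.succ) p := by
  rw [fderiv_rad2]
  simp [mink_boostFrame hv]

/-- The cutoff at distance `n` from the axis of motion. -/
def cutoff (v : Space) (n : ℝ) (p : Spacetime) : ℝ := cut (rad2 v p / n ^ 2)

theorem contDiff_cutoff (v : Space) (n : ℝ) : ContDiff ℝ ∞ (cutoff v n) :=
  contDiff_cut.comp ((contDiff_rad2 v).div_const _)

theorem fderiv_cutoff (v : Space) (n : ℝ) (p h : Spacetime) : fderiv ℝ (cutoff v n) p h
    = deriv cut (rad2 v p / n ^ 2) * (fderiv ℝ (rad2 v) p h / n ^ 2) := by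
  have h1 : HasDerivAt cut (deriv cut (rad2 v p / n ^ 2)) (rad2 v p / n ^ 2) :=
    (contDiff_cut.differentiable (by simp) _).hasDerivAt
  have h2 : HasFDerivAt (fun p => rad2 v p / n ^ 2) _ p :=
    (((contDiff_rad2 v).differentiable (by simp) p).hasFDerivAt).mul_const ((n ^ 2)⁻¹)
  have h3 : HasFDerivAt (cutoff v n) _ p := h1.comp_hasFDerivAt p h2
  rw [h3.fderiv]
  simp [div_eq_inv_mul]

theorem cutoff_eq_zero {v : Space} (hv : ‖v‖ < 1) {n : ℝ} (hn : 0 < n) {p : Spacetime}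
    (hp : 2 * n ≤ ‖p.2 - p.1 • v‖) : cutoff v n p = 0 := by
  apply cut_of_ge
  rw [le_div_iff₀ (by positivity)]
  have := norm_sub_sq_le_rad2 hv p
  nlinarith

theorem tendsto_cutoff (v : Space) (p : Spacetime) :
    Tendsto (fun n : ℕ => cutoff v (n + 1) p) atTop (𝓝 1) := by
  have h1 : Tendsto (fun n : ℕ => rad2 v p / ((n : ℝ) + 1) ^ 2) atTop (𝓝 0) := by
    refine Tendsto.div_atTop tendsto_const_nhds ?_
    exact (tendsto_pow_atTop two_ne_zero).comp
      (tendsto_atTop_add_const_right _ _ tendsto_natCast_atTop_atTop)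
  have h2 := (contDiff_cut.continuous.tendsto 0).comp h1
  rwa [cut_of_le zero_le_one] at h2

/-- The derivative is exactly zero as soon as the point lies in the region where the cutoff equals
1, so error terms converge pointwise whatever they are multiplied by. -/
theorem tendsto_deriv_cut (v : Space) (p : Spacetime) :
    ∀ᶠ n : ℕ in atTop, deriv cut (rad2 v p / ((n : ℝ) + 1) ^ 2) = 0 := by
  have h1 : Tendsto (fun n : ℕ => rad2 v p / ((n : ℝ) + 1) ^ 2) atTop (𝓝 0) := by
    refine Tendsto.div_atTop tendsto_const_nhds ?_
    exact (tendsto_pow_atTop two_ne_zero).comp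
      (tendsto_atTop_add_const_right _ _ tendsto_natCast_atTop_atTop)
  filter_upwards [h1.eventually (Iio_mem_nhds zero_lt_one)] with n hn using deriv_cut_of_lt hn

/-- The translation (T, l) is (T / γ) u, which the projection orthogonal to u removes; the linear
part is a Lorentz map fixing u and commutes with the projection. -/
theorem restPart_shift (P : Period) (p : Spacetime) :
    restPart P.vel (P.shift p) = P.lin (restPart P.vel p) := by
  obtain ⟨h0, h1⟩ := lorentz_factor P.norm_vel_lt
  set γ := (√(1 - ‖P.vel‖ ^ 2))⁻¹ with hγ
  have h2 : ((P.T, P.l) : Spacetime) = (P.T * γ⁻¹) • fourVel P.vel := by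
    rw [fourVel, ← hγ, smul_smul, mul_assoc, inv_mul_cancel₀ h0.ne', mul_one, Prod.smul_mk,
      P.T_smul_vel, smul_eq_mul, mul_one]
  rw [restPart, Period.shift, h2, (isLinearMap_mink_left _).map_add,
    (isLinearMap_mink_left _).map_smul, mink_fourVel_self P.norm_vel_lt, restPart, map_sub,
    map_smul, P.lin_fourVel]
  conv_lhs =>
    enter [2, 1, 1]
    rw [← P.lin_fourVel, P.mink_lin]
  simp only [smul_eq_mul]
  module

theorem rad2_shift (P : Period) (p : Spacetime) : rad2 P.vel (P.shift p) = rad2 P.vel p := by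
  rw [rad2_eq_restPart P.norm_vel_lt, rad2_eq_restPart P.norm_vel_lt, restPart_shift, P.mink_lin]

/-- The divergence theorem over one period, in an arbitrary frame. -/
theorem integral_slab_frame_div_eq_zero (P : Period) {e : Fin 4 → Spacetime} (he : IsFrame e)
    {G : Spacetime → Spacetime → ℝ}
    (hG : ∀ h, ContDiff ℝ 1 (G h)) (hl : ∀ p, IsLinearMap ℝ (fun h => G h p)) {R : ℝ}
    (hR : ∀ h (p : Spacetime), R ≤ ‖p.2 - p.1 • P.vel‖ → G h p = 0)
    (hper : ∀ p, G (dir 0) (P.shift p) = G (dir 0) p) :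
    ∫ p in P.slab, ∑ α, eta α * fderiv ℝ (G (e α)) p (e α) = 0 := by
  have h1 := integral_slab_div_eq_zero P (J := fun μ p => eta μ * G (dir μ) p)
    (fun μ => contDiff_const.mul (hG _)) (R := R) (fun μ p hp => by simp [hR _ p hp])
    (P.isPeriodicScalar_of_shift fun p => by rw [hper])
  rw [← h1]
  congr 1
  ext p
  -- The divergence is the trace of the bilinear form `h, k ↦ ∂_h (G k)`, so it may be computed in
  -- the coordinate frame, where `eta μ` has been absorbed into the current.
  have h2 := he.trace_eq isFrame_dir (Q := fun h k => fderiv ℝ (G k) p h)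
    (fun k => (fderiv ℝ (G k) p).toLinearMap.isLinear) (fun h => by
      have hd : ∀ k, DifferentiableAt ℝ (G k) p := fun k => (hG k).differentiable (by simp) p
      refine ⟨fun x y => ?_, fun c x => ?_⟩
      · have : G (x + y) = fun q => G x q + G y q := funext fun q => (hl q).map_add x y
        simp only [this, fderiv_fun_add (hd x) (hd y), add_apply]
      · have : G (c • x) = fun q => c • G x q := funext fun q => (hl q).map_smul c x
        simp only [this, fderiv_fun_const_smul (hd x), smul_apply])
  simp only [smul_eq_mul] at h2
  rw [h2]
  refine Finset.sum_congr rfl fun μ _ => ?_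
  rw [pd, fderiv_const_mul ((hG _).differentiable (by simp) p)]
  rfl

/-! ### Virial identities -/

section Virial

variable {W : Type*} [NormedAddCommGroup W] [InnerProductSpace ℝ W]
  {𝔤 : Type*} [NormedAddCommGroup 𝔤] [InnerProductSpace ℝ 𝔤]

/-- A solution of the field equations, periodic up to a symmetry and of finite energy, written
with a connection form `A`, the potential `𝒱 = V (φ†φ)` and the force `S = V' (φ†φ) φ` as functions
on spacetime. -/
structure IsSoliton (P : Period) (br : 𝔤 →L[ℝ] 𝔤 →L[ℝ] 𝔤) (ρ : 𝔤 →L[ℝ] W →L[ℝ] W)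
    (A : Spacetime → Spacetime →L[ℝ] 𝔤) (φ : Spacetime → W) (𝒱 : Spacetime → ℝ)
    (S : Spacetime → W) : Prop where
  rep : SkewRep br ρ
  adj : SkewRep br br
  antisymm : ∀ u v, br u v = -br v u
  smooth_A : ContDiff ℝ ∞ A
  smooth_φ : ContDiff ℝ ∞ φ
  smooth_𝒱 : ContDiff ℝ 1 𝒱
  fderiv_𝒱 : ∀ p k, fderiv ℝ 𝒱 p k = 2 * inner ℝ (S p) (covDir ρ A k φ p)
  scalar : ∀ p, ∑ α, eta α • covDir ρ A (dir α) (covDir ρ A (dir α) φ) p + S p = 0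
  gauge : ∀ k u p, inner ℝ (∑ α, eta α • covDir br A (dir α) (curv br A (dir α) k) p) u
    = -2 * inner ℝ (ρ u (φ p)) (covDir ρ A k φ p)
  shift_A : ∀ p k, A (P.shift p) (P.lin k) = A p k
  shift_φ : ∀ p, φ (P.shift p) = φ p
  shift_𝒱 : ∀ p, 𝒱 (P.shift p) = 𝒱 p
  memLp_covDir : ∀ μ, MemLp (covDir ρ A (dir μ) φ) 2 (volume.restrict P.slab)
  memLp_curv : ∀ μ ν, MemLp (curv br A (dir μ) (dir ν)) 2 (volume.restrict P.slab)
  integrable_𝒱 : IntegrableOn 𝒱 P.slab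
  integrable_S : IntegrableOn (fun p => inner ℝ (S p) (φ p)) P.slab

theorem sum_eta (f : Fin 4 → ℝ) : ∑ α, eta α * f α = f 0 - ∑ i : Fin 3, f i.succ := by
  rw [Fin.sum_univ_succ]
  simp [eta, sub_eq_add_neg]

theorem integrable_inner_of_memLp {ν : Measure Spacetime} {f g : Spacetime → W}
    (hf : MemLp f 2 ν) (hg : MemLp g 2 ν) : Integrable (fun p => (inner ℝ (f p) (g p) : ℝ)) ν :=
  (hf.norm.integrable_mul hg.norm).mono' (hf.1.inner hg.1)
    (Eventually.of_forall fun p => norm_inner_le_norm (𝕜 := ℝ) (f p) (g p))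

/-- Finiteness is assumed for the components in the original frame; those in the rest frame are
constant linear combinations of them. -/
theorem memLp_of_dir {F : Type*} [NormedAddCommGroup F] [NormedSpace ℝ F]
    {ν : Measure Spacetime} {f : Spacetime → Spacetime → F}
    (hl : ∀ p, IsLinearMap ℝ (fun h => f h p)) (hf : ∀ μ, MemLp (f (dir μ)) 2 ν) (h : Spacetime) :
    MemLp (f h) 2 ν := by
  have : f h = fun p => ∑ μ, (eta μ * mink (dir μ) h) • f (dir μ) p := by
    ext p
    nth_rewrite 1 [← isFrame_dir h]
    exact sum_isLinearMap (hl p) _ _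
  rw [this]
  exact memLp_finsetSum _ fun μ _ => (hf μ).const_smul _

namespace IsSoliton

variable {P : Period} {br : 𝔤 →L[ℝ] 𝔤 →L[ℝ] 𝔤} {ρ : 𝔤 →L[ℝ] W →L[ℝ] W}
  {A : Spacetime → Spacetime →L[ℝ] 𝔤} {φ : Spacetime → W} {𝒱 : Spacetime → ℝ}
  {S : Spacetime → W} (hs : IsSoliton P br ρ A φ 𝒱 S)
include hs

theorem memLp_covDir' (h : Spacetime) : MemLp (covDir ρ A h φ) 2 (volume.restrict P.slab) :=
  memLp_of_dir (fun p => isLinearMap_covDir φ p) hs.memLp_covDir h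

theorem memLp_curv' (h k : Spacetime) : MemLp (curv br A h k) 2 (volume.restrict P.slab) :=
  memLp_of_dir (f := fun h p => curv br A h k p) (fun p => isLinearMap_curv hs.smooth_A k p)
    (fun μ => memLp_of_dir (f := fun k p => curv br A (dir μ) k p)
      (fun p => isLinearMap_curv_right hs.antisymm hs.smooth_A (dir μ) p) (hs.memLp_curv μ) k) h

theorem integrable_inner_covDir (h k : Spacetime) :
    IntegrableOn (fun p => (inner ℝ (covDir ρ A h φ p) (covDir ρ A k φ p) : ℝ)) P.slab :=
  integrable_inner_of_memLp (hs.memLp_covDir' h) (hs.memLp_covDir' k)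

theorem integrable_inner_curv (h k h' k' : Spacetime) :
    IntegrableOn (fun p => (inner ℝ (curv br A h k p) (curv br A h' k' p) : ℝ)) P.slab :=
  integrable_inner_of_memLp (hs.memLp_curv' h k) (hs.memLp_curv' h' k')

theorem integrable_stress (e : Fin 4 → Spacetime) (h k : Spacetime) :
    IntegrableOn (stress br ρ A eta e mink φ 𝒱 h k) P.slab := by
  have h1 : IntegrableOn (lagr br ρ A eta e φ 𝒱) P.slab :=
    ((integrable_finsetSum _ fun α _ => (hs.integrable_inner_covDir _ _).const_mul _).sub
      hs.integrable_𝒱).sub ((integrable_finsetSum _ fun α _ => integrable_finsetSum _ fun β _ =>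
        (hs.integrable_inner_curv _ _ _ _).const_mul _).const_mul _)
  exact (((hs.integrable_inner_covDir _ _).const_mul _).sub
    (integrable_finsetSum _ fun β _ => (hs.integrable_inner_curv _ _ _ _).const_mul _)).sub
      (h1.const_mul _)

theorem conserved {e : Fin 4 → Spacetime} (he : IsFrame e) (k p : Spacetime) :
    ∑ α, eta α * fderiv ℝ (stress br ρ A eta e mink φ 𝒱 (e α) k) p (e α) = 0 := by
  refine stress_conserved hs.rep hs.adj hs.antisymm hs.smooth_A hs.smooth_φ
    (hs.smooth_𝒱.differentiable (by simp) p) (hs.fderiv_𝒱 p) ?_ ?_ he k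
  · rw [he.box_eq isFrame_dir hs.smooth_A hs.smooth_φ]
    exact hs.scalar p
  · intro β u
    rw [he.divCurv_eq isFrame_dir hs.smooth_A]
    exact hs.gauge _ u p

/-- V' itself may be discontinuous; along a solution the field equation expresses the force by
derivatives of φ. -/
theorem continuous_S : Continuous S := by
  have : S = fun p => -∑ α, eta α • covDir ρ A (dir α) (covDir ρ A (dir α) φ) p :=
    funext fun p => (neg_eq_of_add_eq_zero_right (hs.scalar p)).symm
  rw [this]
  exact (continuous_finsetSum _ fun α _ => ((contDiff_covDir hs.smooth_A
    (contDiff_covDir hs.smooth_A hs.smooth_φ _) _).continuous).const_smul _).neg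

end IsSoliton

/-- On the support of the derivative of the cutoff `rad2` ≤ 2 n², which bounds the product of two
rest-frame coordinates. -/
theorem abs_deriv_cut_mul_le {C : ℝ} (hC : ∀ s, |deriv cut s| ≤ C) (v : Space) (p : Spacetime)
    (n : ℝ) (hn : 0 < n) (i j : Fin 3) :
    |deriv cut (rad2 v p / n ^ 2) * (mink (boostFrame v i.succ) p * mink (boostFrame v j.succ) p
      / n ^ 2)| ≤ 2 * C := by
  have hC0 : 0 ≤ C := (abs_nonneg _).trans (hC 0)
  rcases lt_or_ge 2 (rad2 v p / n ^ 2) with h | h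
  · rw [deriv_cut_of_gt h, zero_mul, abs_zero]; positivity
  · rw [abs_mul, mul_comm 2 C]
    refine mul_le_mul (hC _) (le_trans ?_ h) (abs_nonneg _) hC0
    rw [abs_div, abs_of_pos (by positivity : 0 < n ^ 2)]
    gcongr
    have h1 := mink_sq_le_rad2 v p i
    have h2 := mink_sq_le_rad2 v p j
    rw [abs_le]
    constructor <;> nlinarith [sq_nonneg (mink (boostFrame v i.succ) p
      + mink (boostFrame v j.succ) p), sq_nonneg (mink (boostFrame v i.succ) p
      - mink (boostFrame v j.succ) p)]

/-- The gradient of the cutoff, squared, is bounded by the Hardy weight uniformly in n. On its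
support `rad2` ≤ 2 n² and 1 + `rad2` ≤ 3 n² (as n ≥ 1), so 4 x_j² (1 + `rad2`) ≤ 4 · 2 n² · 3 n² =
24 n⁴. -/
theorem sq_deriv_cut_mul_le {C : ℝ} (hC : ∀ s, |deriv cut s| ≤ C) (v : Space) (p : Spacetime)
    (n : ℝ) (hn : 1 ≤ n) (j : Fin 3) :
    (deriv cut (rad2 v p / n ^ 2) * (2 * mink (boostFrame v j.succ) p / n ^ 2)) ^ 2
      ≤ 24 * C ^ 2 * (1 + rad2 v p)⁻¹ := by
  have hC0 : 0 ≤ C := (abs_nonneg _).trans (hC 0)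
  have hr := rad2_nonneg v p
  have hn0 : 0 < n ^ 2 := by positivity
  rcases lt_or_ge 2 (rad2 v p / n ^ 2) with h | h
  · rw [deriv_cut_of_gt h]; norm_num; positivity
  · rw [mul_pow]
    have h1 : deriv cut (rad2 v p / n ^ 2) ^ 2 ≤ C ^ 2 := sq_le_sq' (abs_le.1 (hC _)).1
      (abs_le.1 (hC _)).2
    have h2 : (2 * mink (boostFrame v j.succ) p / n ^ 2) ^ 2 ≤ 24 * (1 + rad2 v p)⁻¹ := by
      rw [div_le_iff₀ hn0] at h
      rw [← div_eq_mul_inv, div_pow, div_le_div_iff₀ (by positivity) (by positivity)]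
      have h3 := mink_sq_le_rad2 v p j
      have h4 : 1 ≤ n ^ 2 := by nlinarith
      have h5 : mink (boostFrame v j.succ) p ^ 2 * (1 + rad2 v p) ≤ (2 * n ^ 2) * (3 * n ^ 2) :=
        mul_le_mul (by linarith) (by linarith) (by linarith) (by positivity)
      nlinarith
    calc _ ≤ C ^ 2 * (24 * (1 + rad2 v p)⁻¹) := mul_le_mul h1 h2 (sq_nonneg _) (sq_nonneg _)
      _ = _ := by ring

namespace IsSoliton

variable {P : Period} {br : 𝔤 →L[ℝ] 𝔤 →L[ℝ] 𝔤} {ρ : 𝔤 →L[ℝ] W →L[ℝ] W}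
  {A : Spacetime → Spacetime →L[ℝ] 𝔤} {φ : Spacetime → W} {𝒱 : Spacetime → ℝ}
  {S : Spacetime → W}

/-- The divergence theorem for the current χ Θ(·, X), where X is the position vector orthogonal to
u, the generator of dilations of the rest space. Conservation leaves only derivatives of X, which
give the spatial trace, and derivatives of the cutoff χ. -/
theorem integral_cutoff_stress (hs : IsSoliton P br ρ A φ 𝒱 S) {n : ℝ} (hn : 0 < n) :
    ∫ p in P.slab, (cutoff P.vel n p * ∑ i : Fin 3, stress br ρ A eta (boostFrame P.vel) mink φ 𝒱
        (boostFrame P.vel i.succ) (boostFrame P.vel i.succ) p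
      + ∑ i : Fin 3, ∑ j : Fin 3, 2 * (deriv cut (rad2 P.vel p / n ^ 2) *
        (mink (boostFrame P.vel i.succ) p * mink (boostFrame P.vel j.succ) p / n ^ 2)) *
        stress br ρ A eta (boostFrame P.vel) mink φ 𝒱
          (boostFrame P.vel j.succ) (boostFrame P.vel i.succ) p) = 0 := by
  have hv := P.norm_vel_lt
  have he := isFrame_boostFrame hv
  obtain ⟨e, hee⟩ : ∃ e, e = boostFrame P.vel := ⟨_, rfl⟩
  have hT1 : ∀ h k, ContDiff ℝ 1 (stress br ρ A eta e mink φ 𝒱 h k) := fun h k =>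
    contDiff_stress (n := 1) hs.smooth_A hs.smooth_φ hs.smooth_𝒱 h k
  have hTl : ∀ k p, IsLinearMap ℝ (fun h => stress br ρ A eta e mink φ 𝒱 h k p) := fun k p =>
    isLinearMap_stress hs.smooth_A isLinearMap_mink_left k p
  have hTs : ∀ h k p, stress br ρ A eta e mink φ 𝒱 h k p = stress br ρ A eta e mink φ 𝒱 k h p :=
    stress_symm mink_symm
  have hTp : ∀ h k p, stress br ρ A eta e mink φ 𝒱 (P.lin h) (P.lin k) (P.shift p)
      = stress br ρ A eta e mink φ 𝒱 h k p := by
    rw [hee]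
    exact stress_shift he hs.antisymm hs.smooth_A hs.smooth_φ hs.shift_A hs.shift_φ hs.shift_𝒱
  have hcons : ∀ k p, ∑ α, eta α * fderiv ℝ (stress br ρ A eta e mink φ 𝒱 (e α) k) p (e α) = 0 := by
    rw [hee]; exact hs.conserved he
  rw [← hee]
  generalize stress br ρ A eta e mink φ 𝒱 = T at *
  have hχ : ContDiff ℝ 1 (cutoff P.vel n) := (contDiff_cutoff _ _).of_le (by simp)
  have hm : ∀ q : Spacetime, ContDiff ℝ 1 (fun p => mink q p) := fun q =>
    contDiff_mink contDiff_const contDiff_id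
  set G : Spacetime → Spacetime → ℝ := fun h p =>
    ∑ i : Fin 3, cutoff P.vel n p * (-mink (e i.succ) p) * T h (e i.succ) p with hGdef
  have hG : ∀ h, ContDiff ℝ 1 (G h) := fun h =>
    ContDiff.sum fun i _ => (hχ.mul (hm _).neg).mul (hT1 _ _)
  -- This form, without coordinates, shows the invariance under the symmetry, which maps X to its
  -- image under the linear part.
  have hGX : ∀ h p, G h p = cutoff P.vel n p * T h (restPart P.vel p) p := by
    intro h p
    have h1 := map_sum ((hTl h p).mk')
      (fun i : Fin 3 => (-mink (boostFrame P.vel i.succ) p) • boostFrame P.vel i.succ) Finset.univ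
    simp only [IsLinearMap.mk'_apply, (hTl h p).map_smul] at h1
    rw [hTs, restPart_eq hv, h1, Finset.mul_sum]
    simp only [hGdef, hee, hTs h, smul_eq_mul, mul_assoc]
  have key := integral_slab_frame_div_eq_zero P (hee ▸ he : IsFrame e) hG (fun p => by
      refine ⟨fun x y => ?_, fun c x => ?_⟩
      · simp only [hGdef, (hTl _ p).map_add, mul_add, Finset.sum_add_distrib]
      · simp only [hGdef, (hTl _ p).map_smul, smul_eq_mul, Finset.mul_sum]
        exact Finset.sum_congr rfl fun _ _ => by ring)
    (R := 2 * n) (fun h p hp => by simp [hGdef, cutoff_eq_zero hv hn hp])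
    (fun p => by
      rw [hGX, hGX, restPart_shift, cutoff, rad2_shift, cutoff]
      conv_lhs => rw [← P.lin_dir_zero, hTp])
  rw [← neg_eq_zero, ← integral_neg, ← key]
  congr 1
  ext p
  have hd : ∀ α, fderiv ℝ (G (e α)) p (e α) = ∑ i : Fin 3,
      ((fderiv ℝ (cutoff P.vel n) p (e α) * (-mink (e i.succ) p)
        - cutoff P.vel n p * mink (e i.succ) (e α)) * T (e α) (e i.succ) p
      + cutoff P.vel n p * (-mink (e i.succ) p) * fderiv ℝ (T (e α) (e i.succ)) p (e α)) := by
    intro α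
    have h1 : HasFDerivAt (G (e α)) _ p := HasFDerivAt.fun_sum fun i (_ : i ∈ Finset.univ) =>
      (((hχ.differentiable (by simp) p).hasFDerivAt).mul
        (hasFDerivAt_mink (e (Fin.succ i)) p).neg).mul
        ((hT1 (e α) (e (Fin.succ i))).differentiable (by simp) p).hasFDerivAt
    rw [h1.fderiv]
    simp only [sum_apply, add_apply, smul_apply, neg_apply, fderiv_mink, smul_eq_mul,
      Pi.mul_apply, Pi.neg_apply]
    exact Finset.sum_congr rfl fun _ _ => by ring
  -- The terms with derivatives of the stress tensor vanish by conservation.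
  have hz : ∑ α, eta α * ∑ i : Fin 3, cutoff P.vel n p * (-mink (e i.succ) p)
      * fderiv ℝ (T (e α) (e i.succ)) p (e α) = 0 := by
    simp only [Finset.mul_sum]
    rw [Finset.sum_comm]
    refine Finset.sum_eq_zero fun i _ => ?_
    have := congrArg (fun x => cutoff P.vel n p * (-mink (e i.succ) p) * x) (hcons (e i.succ) p)
    simp only [mul_zero, Finset.mul_sum] at this
    rw [← this]
    exact Finset.sum_congr rfl fun _ _ => by ring
  simp only [hd, Finset.sum_add_distrib, mul_add]
  rw [hz, add_zero, sum_eta]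
  have e0 : ∀ i : Fin 3, mink (e i.succ) (e 0) = 0 := fun i => by
    rw [hee, mink_symm]; exact mink_fourVel_boostFrame hv i
  have e1 : fderiv ℝ (cutoff P.vel n) p (e 0) = 0 := by
    rw [fderiv_cutoff, hee, fderiv_rad2_zero hv]; simp
  have e2 : ∀ j : Fin 3, fderiv ℝ (cutoff P.vel n) p (e j.succ)
      = deriv cut (rad2 P.vel p / n ^ 2) * (-2 * mink (e j.succ) p / n ^ 2) := fun j => by
    rw [fderiv_cutoff, hee, fderiv_rad2_succ hv]
  have e3 : ∀ i j : Fin 3, mink (e i.succ) (e j.succ) = if i = j then -1 else 0 := fun i j => by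
    rw [hee, mink_boostFrame hv]
  simp only [e0, e1, e2, e3]
  simp only [zero_mul, mul_zero, sub_zero, Finset.sum_const_zero, sub_mul,
    Finset.sum_sub_distrib, mul_ite, ite_mul, Finset.sum_ite_eq', Finset.mem_univ, if_true]
  rw [neg_add, Finset.mul_sum, Finset.sum_comm, zero_sub, neg_sub, sub_eq_add_neg]
  simp only [← Finset.sum_neg_distrib]
  congr 1
  · exact Finset.sum_congr rfl fun _ _ => by ring
  · exact Finset.sum_congr rfl fun _ _ => Finset.sum_congr rfl fun _ _ => by ring

/-- The virial theorem: the spatial trace of the stress tensor in the rest frame integrates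
to zero. -/
theorem integral_trace_stress (hs : IsSoliton P br ρ A φ 𝒱 S) :
    ∫ p in P.slab, ∑ i : Fin 3, stress br ρ A eta (boostFrame P.vel) mink φ 𝒱
        (boostFrame P.vel i.succ) (boostFrame P.vel i.succ) p = 0 := by
  obtain ⟨C, hC0, hC⟩ := exists_deriv_cut_bound
  have hint := hs.integrable_stress (boostFrame P.vel)
  have hcont : ∀ h k, Continuous (stress br ρ A eta (boostFrame P.vel) mink φ 𝒱 h k) := fun h k =>
    (contDiff_stress (n := 1) hs.smooth_A hs.smooth_φ hs.smooth_𝒱 h k).continuous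
  have hzero := fun n : ℕ => hs.integral_cutoff_stress (n := n + 1) (by positivity)
  generalize stress br ρ A eta (boostFrame P.vel) mink φ 𝒱 = T at *
  refine tendsto_nhds_unique (tendsto_integral_of_dominated_convergence
    (F := fun (n : ℕ) p => cutoff P.vel (n + 1) p * ∑ i : Fin 3, T
        (boostFrame P.vel i.succ) (boostFrame P.vel i.succ) p
      + ∑ i : Fin 3, ∑ j : Fin 3, 2 * (deriv cut (rad2 P.vel p / ((n : ℝ) + 1) ^ 2) *
        (mink (boostFrame P.vel i.succ) p * mink (boostFrame P.vel j.succ) p / ((n : ℝ) + 1) ^ 2)) *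
        T (boostFrame P.vel j.succ) (boostFrame P.vel i.succ) p)
    -- The factor 4 C is the coefficient 2 of the error term times the bound 2 C of
    -- `abs_deriv_cut_mul_le`.
    (fun p => |∑ i : Fin 3, T (boostFrame P.vel i.succ) (boostFrame P.vel i.succ) p|
      + ∑ i : Fin 3, ∑ j : Fin 3, 4 * C *
        |T (boostFrame P.vel j.succ) (boostFrame P.vel i.succ) p|) ?_ ?_ ?_ ?_)
    (by simp only [hzero]; exact tendsto_const_nhds)
  · intro n
    have h1 : Continuous (cutoff P.vel ((n : ℝ) + 1)) := (contDiff_cutoff _ _).continuous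
    have h2 : Continuous (deriv cut) := contDiff_cut.continuous_deriv (by simp)
    have h3 : Continuous (rad2 P.vel) := (contDiff_rad2 _).continuous
    have h4 : ∀ q : Spacetime, Continuous (fun p => mink q p) := fun q =>
      (contDiff_mink (n := 1) contDiff_const contDiff_id).continuous
    refine Continuous.aestronglyMeasurable ?_
    fun_prop
  · exact (integrable_finsetSum _ fun i _ => hint _ _).abs.add
      (integrable_finsetSum _ fun i _ => integrable_finsetSum _ fun j _ =>
        (hint _ _).abs.const_mul _)
  · refine fun n => Eventually.of_forall fun p => ?_
    rw [Real.norm_eq_abs]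
    refine (abs_add_le _ _).trans (add_le_add ?_ ?_)
    · rw [abs_mul]
      exact mul_le_of_le_one_left (abs_nonneg _) (abs_cut_le _)
    · refine (Finset.abs_sum_le_sum_abs _ _).trans (Finset.sum_le_sum fun i _ => ?_)
      refine (Finset.abs_sum_le_sum_abs _ _).trans (Finset.sum_le_sum fun j _ => ?_)
      rw [abs_mul, abs_mul, abs_of_pos (zero_lt_two' ℝ)]
      refine mul_le_mul_of_nonneg_right ?_ (abs_nonneg _)
      have := abs_deriv_cut_mul_le hC P.vel p ((n : ℝ) + 1) (by positivity) i j
      linarith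
  · refine Eventually.of_forall fun p => ?_
    have h1 := (tendsto_cutoff P.vel p).mul_const
      (∑ i : Fin 3, T (boostFrame P.vel i.succ) (boostFrame P.vel i.succ) p)
    rw [one_mul] at h1
    refine h1.congr' ?_
    filter_upwards [tendsto_deriv_cut P.vel p] with n hn
    simp [hn]

/-- The divergence theorem for the current χ ⟪φ, D φ⟫: the derivative of φ yields the quadratic
terms, the second derivative is replaced by the field equation. -/
theorem integral_cutoff_scalar (hs : IsSoliton P br ρ A φ 𝒱 S) {n : ℝ} (hn : 0 < n) :
    ∫ p in P.slab, (cutoff P.vel n p * (∑ α, eta α * inner ℝ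
        (covDir ρ A (boostFrame P.vel α) φ p) (covDir ρ A (boostFrame P.vel α) φ p)
        - inner ℝ (S p) (φ p))
      + ∑ j : Fin 3, deriv cut (rad2 P.vel p / n ^ 2) *
        (2 * mink (boostFrame P.vel j.succ) p / n ^ 2) *
        inner ℝ (φ p) (covDir ρ A (boostFrame P.vel j.succ) φ p)) = 0 := by
  have hv := P.norm_vel_lt
  have he := isFrame_boostFrame hv
  obtain ⟨e, hee⟩ : ∃ e, e = boostFrame P.vel := ⟨_, rfl⟩
  rw [← hee] at he ⊢
  have hD : ∀ h, ContDiff ℝ ∞ (covDir ρ A h φ) := fun h => contDiff_covDir hs.smooth_A hs.smooth_φ h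
  have hχ : ContDiff ℝ 1 (cutoff P.vel n) := (contDiff_cutoff _ _).of_le (by simp)
  set G : Spacetime → Spacetime → ℝ := fun h p =>
    cutoff P.vel n p * inner ℝ (φ p) (covDir ρ A h φ p) with hGdef
  have hG : ∀ h, ContDiff ℝ 1 (G h) := fun h =>
    hχ.mul ((hs.smooth_φ.of_le (by simp)).inner ℝ ((hD h).of_le (by simp)))
  have key := integral_slab_frame_div_eq_zero P he hG (fun p => by
      refine ⟨fun x y => ?_, fun c x => ?_⟩
      · simp only [hGdef, (isLinearMap_covDir (ρ := ρ) (A := A) φ p).map_add, inner_add_right,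
          mul_add]
      · simp only [hGdef, (isLinearMap_covDir (ρ := ρ) (A := A) φ p).map_smul,
          real_inner_smul_right, smul_eq_mul]
        ring)
    (R := 2 * n) (fun h p hp => by simp [hGdef, cutoff_eq_zero hv hn hp])
    (fun p => by
      simp only [hGdef, cutoff, rad2_shift, hs.shift_φ]
      conv_lhs => rw [← P.lin_dir_zero, covDir_shift hs.shift_A hs.shift_φ
        (hs.smooth_φ.differentiable (by simp) _)])
  rw [← key]
  congr 1
  ext p
  have hd : ∀ α, fderiv ℝ (G (e α)) p (e α) =
      fderiv ℝ (cutoff P.vel n) p (e α) * inner ℝ (φ p) (covDir ρ A (e α) φ p)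
      + cutoff P.vel n p * inner ℝ (covDir ρ A (e α) φ p) (covDir ρ A (e α) φ p)
      + cutoff P.vel n p * inner ℝ (covDir ρ A (e α) (covDir ρ A (e α) φ) p) (φ p) := by
    intro α
    have d1 := hs.smooth_φ.differentiable (by simp) p
    have d2 := (hD (e α)).differentiable (by simp) p
    have h1 : HasFDerivAt (G (e α)) _ p :=
      ((hχ.differentiable (by simp) p).hasFDerivAt).mul (d1.inner ℝ d2).hasFDerivAt
    rw [h1.fderiv]
    simp only [add_apply, smul_apply, smul_eq_mul,
      fderiv_inner_covDir (A := A) hs.rep.skew d1 d2]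
    rw [real_inner_comm (φ p)]
    ring
  have hz : ∑ α, eta α * (cutoff P.vel n p *
      inner ℝ (covDir ρ A (e α) (covDir ρ A (e α) φ) p) (φ p))
      = -(cutoff P.vel n p * inner ℝ (S p) (φ p)) := by
    have h1 := hs.scalar p
    rw [← he.box_eq isFrame_dir hs.smooth_A hs.smooth_φ] at h1
    rw [← mul_neg, ← inner_neg_left, ← eq_neg_of_add_eq_zero_left h1, sum_inner, Finset.mul_sum]
    exact Finset.sum_congr rfl fun _ _ => by rw [real_inner_smul_left]; ring
  have e1 : fderiv ℝ (cutoff P.vel n) p (e 0) = 0 := by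
    rw [fderiv_cutoff, hee, fderiv_rad2_zero hv]; simp
  have e2 : ∀ j : Fin 3, fderiv ℝ (cutoff P.vel n) p (e j.succ)
      = deriv cut (rad2 P.vel p / n ^ 2) * (-2 * mink (e j.succ) p / n ^ 2) := fun j => by
    rw [fderiv_cutoff, hee, fderiv_rad2_succ hv]
  simp only [hd, mul_add, Finset.sum_add_distrib]
  have h5 := sum_eta fun x => fderiv ℝ (cutoff P.vel n) p (e x)
    * inner ℝ (φ p) (covDir ρ A (e x) φ p)
  simp only [e1, e2] at h5
  have h3 : ∑ α, eta α * (cutoff P.vel n p *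
      inner ℝ (covDir ρ A (e α) φ p) (covDir ρ A (e α) φ p))
      = cutoff P.vel n p * ∑ α, eta α *
        inner ℝ (covDir ρ A (e α) φ p) (covDir ρ A (e α) φ p) := by
    rw [Finset.mul_sum]; exact Finset.sum_congr rfl fun _ _ => by ring
  have h4 : ∑ j : Fin 3, deriv cut (rad2 P.vel p / n ^ 2) * (-2 * mink (e j.succ) p / n ^ 2) *
      inner ℝ (φ p) (covDir ρ A (e j.succ) φ p)
      = -∑ j : Fin 3, deriv cut (rad2 P.vel p / n ^ 2) * (2 * mink (e j.succ) p / n ^ 2) *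
      inner ℝ (φ p) (covDir ρ A (e j.succ) φ p) := by
    rw [← Finset.sum_neg_distrib]; exact Finset.sum_congr rfl fun _ _ => by ring
  rw [hz, h3, h5, h4]
  ring

/-- The scalar field equation, integrated against the scalar field. -/
theorem integral_scalar (hs : IsSoliton P br ρ A φ 𝒱 S)
    (hH : IntegrableOn (fun p => ‖φ p‖ ^ 2 * (1 + rad2 P.vel p)⁻¹) P.slab) :
    ∫ p in P.slab, (∑ α, eta α * inner ℝ
        (covDir ρ A (boostFrame P.vel α) φ p) (covDir ρ A (boostFrame P.vel α) φ p)
        - inner ℝ (S p) (φ p)) = 0 := by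
  obtain ⟨C, hC0, hC⟩ := exists_deriv_cut_bound
  have hD : ∀ h, Continuous (covDir ρ A h φ) := fun h =>
    (contDiff_covDir hs.smooth_A hs.smooth_φ h).continuous
  have hzero := fun n : ℕ => hs.integral_cutoff_scalar (n := n + 1) (by positivity)
  have hφ := hs.smooth_φ.continuous
  have hS := hs.continuous_S
  have hint : IntegrableOn (fun p => ∑ α, eta α * inner ℝ
        (covDir ρ A (boostFrame P.vel α) φ p) (covDir ρ A (boostFrame P.vel α) φ p)
        - inner ℝ (S p) (φ p)) P.slab :=
    (integrable_finsetSum _ fun α _ => (hs.integrable_inner_covDir _ _).const_mul _).sub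
      hs.integrable_S
  refine tendsto_nhds_unique (tendsto_integral_of_dominated_convergence
    (F := fun (n : ℕ) p => cutoff P.vel (n + 1) p * (∑ α, eta α * inner ℝ
        (covDir ρ A (boostFrame P.vel α) φ p) (covDir ρ A (boostFrame P.vel α) φ p)
        - inner ℝ (S p) (φ p))
      + ∑ j : Fin 3, deriv cut (rad2 P.vel p / ((n : ℝ) + 1) ^ 2) *
        (2 * mink (boostFrame P.vel j.succ) p / ((n : ℝ) + 1) ^ 2) *
        inner ℝ (φ p) (covDir ρ A (boostFrame P.vel j.succ) φ p))
    (fun p => |∑ α, eta α * inner ℝ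
        (covDir ρ A (boostFrame P.vel α) φ p) (covDir ρ A (boostFrame P.vel α) φ p)
        - inner ℝ (S p) (φ p)|
      + ∑ j : Fin 3, (24 * C ^ 2 * (‖φ p‖ ^ 2 * (1 + rad2 P.vel p)⁻¹)
        + inner ℝ (covDir ρ A (boostFrame P.vel j.succ) φ p)
          (covDir ρ A (boostFrame P.vel j.succ) φ p))) ?_ ?_ ?_ ?_)
    (by simp only [hzero]; exact tendsto_const_nhds)
  · intro n
    have h1 : Continuous (cutoff P.vel ((n : ℝ) + 1)) := (contDiff_cutoff _ _).continuous
    have h2 : Continuous (deriv cut) := contDiff_cut.continuous_deriv (by simp)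
    have h3 : Continuous (rad2 P.vel) := (contDiff_rad2 _).continuous
    have h4 : ∀ q : Spacetime, Continuous (fun p => mink q p) := fun q =>
      (contDiff_mink (n := 1) contDiff_const contDiff_id).continuous
    refine Continuous.aestronglyMeasurable ?_
    fun_prop
  · exact hint.abs.add (integrable_finsetSum _ fun j _ => (hH.const_mul _).add
      (hs.integrable_inner_covDir _ _))
  · refine fun n => Eventually.of_forall fun p => ?_
    rw [Real.norm_eq_abs]
    refine (abs_add_le _ _).trans (add_le_add ?_ ?_)
    · rw [abs_mul]
      exact mul_le_of_le_one_left (abs_nonneg _) (abs_cut_le _)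
    · refine (Finset.abs_sum_le_sum_abs _ _).trans (Finset.sum_le_sum fun j _ => ?_)
      have h1 := sq_deriv_cut_mul_le hC P.vel p ((n : ℝ) + 1)
        (by linarith [Nat.cast_nonneg (α := ℝ) n]) j
      generalize deriv cut (rad2 P.vel p / ((n : ℝ) + 1) ^ 2) *
        (2 * mink (boostFrame P.vel j.succ) p / ((n : ℝ) + 1) ^ 2) = a at *
      rw [abs_mul, real_inner_self_eq_norm_sq]
      have h2 := abs_real_inner_le_norm (φ p) (covDir ρ A (boostFrame P.vel j.succ) φ p)
      set x := ‖φ p‖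
      set y := ‖covDir ρ A (boostFrame P.vel j.succ) φ p‖
      have h3 : |a| * |inner ℝ (φ p) (covDir ρ A (boostFrame P.vel j.succ) φ p)| ≤ |a| * (x * y) :=
        mul_le_mul_of_nonneg_left h2 (abs_nonneg _)
      have h4 : a ^ 2 * x ^ 2 ≤ 24 * C ^ 2 * (1 + rad2 P.vel p)⁻¹ * x ^ 2 :=
        mul_le_mul_of_nonneg_right h1 (sq_nonneg _)
      -- Cauchy–Schwarz splits the error into the Hardy density of φ and the square of a covariant
      -- derivative, both integrable and independent of n.
      have h5 : |a| * (x * y) ≤ a ^ 2 * x ^ 2 + y ^ 2 := by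
        nlinarith [sq_nonneg (|a| * x - y), sq_abs a, sq_nonneg (|a| * x), sq_nonneg y]
      linarith
  · refine Eventually.of_forall fun p => ?_
    have h1 := (tendsto_cutoff P.vel p).mul_const (∑ α, eta α * inner ℝ
        (covDir ρ A (boostFrame P.vel α) φ p) (covDir ρ A (boostFrame P.vel α) φ p)
        - inner ℝ (S p) (φ p))
    rw [one_mul] at h1
    refine h1.congr' ?_
    filter_upwards [tendsto_deriv_cut P.vel p] with n hn
    simp [hn]

end IsSoliton

end Virial

/-! ### Hardy's inequality -/

section Hardy

variable {W : Type*} [NormedAddCommGroup W] [InnerProductSpace ℝ W]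

theorem hasDerivAt_max_sq (x : ℝ) : HasDerivAt (fun x : ℝ => max x 0 ^ 2) (2 * max x 0) x := by
  rcases lt_trichotomy x 0 with h | rfl | h
  · have : (fun x : ℝ => max x 0 ^ 2) =ᶠ[𝓝 x] fun _ => 0 := by
      filter_upwards [Iio_mem_nhds h] with y hy
      rw [max_eq_right (le_of_lt hy)]; norm_num
    rw [max_eq_right h.le, mul_zero]
    exact (hasDerivAt_const x (0 : ℝ)).congr_of_eventuallyEq this
  · rw [max_self, mul_zero, hasDerivAt_iff_isLittleO]
    simp only [max_self, smul_zero, sub_zero]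
    have h1 : (fun x : ℝ => max x 0 ^ 2 - 0 ^ 2) =O[𝓝 0] fun x : ℝ => x ^ 2 := by
      refine Asymptotics.IsBigO.of_bound 1 (Eventually.of_forall fun y => ?_)
      rw [one_mul, Real.norm_eq_abs, Real.norm_eq_abs, abs_of_nonneg (sq_nonneg y),
        zero_pow two_ne_zero, sub_zero, abs_of_nonneg (sq_nonneg _)]
      rcases le_total y 0 with h | h
      · rw [max_eq_right h, zero_pow two_ne_zero]; positivity
      · rw [max_eq_left h]
    refine h1.trans_isLittleO ?_
    simpa using Asymptotics.isLittleO_pow_pow (𝕜 := ℝ) (m := 1) (n := 2) (by norm_num)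
  · have : (fun x : ℝ => max x 0 ^ 2) =ᶠ[𝓝 x] fun x => x ^ 2 := by
      filter_upwards [Ioi_mem_nhds h] with y hy
      rw [max_eq_left (le_of_lt hy)]
    rw [max_eq_left h.le]
    exact (by simpa using hasDerivAt_pow 2 x : HasDerivAt (fun x : ℝ => x ^ 2) (2 * x) x)
      |>.congr_of_eventuallyEq this

theorem contDiff_max_sq : ContDiff ℝ 1 (fun x : ℝ => max x 0 ^ 2) := by
  rw [contDiff_one_iff_deriv]
  refine ⟨fun x => (hasDerivAt_max_sq x).differentiableAt, ?_⟩
  rw [funext fun x => (hasDerivAt_max_sq x).deriv]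
  fun_prop

/-- Let r = ‖x - c‖ and s = 1 / (1 + r²). The field s (x - c) has divergence 3 s - 2 r² s² ≥ s.
Multiply it by the truncation q = u² of ‖φ‖², with u = (√(‖φ‖² + ε²) - 2 ε)₊, which is C¹ and of
compact support because φ tends to 0. Its divergence integrates to zero, and by Kato's inequality
|∂_i u| ≤ ‖D_i φ‖ where u > 0. The only property of D that enters is the product rule for ‖φ‖², so
covariant derivatives are allowed. -/
theorem integral_hardy_aux {φ : Space → W} (hφ : ContDiff ℝ 1 φ)
    (hlim : Tendsto φ (cocompact Space) (𝓝 0)) {D : Fin 3 → Space → W}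
    (hD : ∀ x i, fderiv ℝ (fun y => ‖φ y‖ ^ 2) x (EuclideanSpace.single i 1)
      = 2 * inner ℝ (φ x) (D i x))
    (hint : Integrable fun x => ∑ i, ‖D i x‖ ^ 2) (c : Space) {ε : ℝ} (hε : 0 < ε) :
    Integrable (fun x => max (√(‖φ x‖ ^ 2 + ε ^ 2) - 2 * ε) 0 ^ 2 * (1 + ‖x - c‖ ^ 2)⁻¹) ∧
    ∫ x, max (√(‖φ x‖ ^ 2 + ε ^ 2) - 2 * ε) 0 ^ 2 * (1 + ‖x - c‖ ^ 2)⁻¹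
      ≤ 4 * ∫ x, ∑ i, ‖D i x‖ ^ 2 := by
  have hpos : ∀ x, 0 < ‖φ x‖ ^ 2 + ε ^ 2 := fun x => by positivity
  have hn : ContDiff ℝ 1 (fun x => ‖φ x‖ ^ 2) := hφ.norm_sq ℝ
  have hψ : ContDiff ℝ 1 (fun x => √(‖φ x‖ ^ 2 + ε ^ 2)) :=
    (hn.add contDiff_const).sqrt fun x => (hpos x).ne'
  set q : Space → ℝ := fun x => max (√(‖φ x‖ ^ 2 + ε ^ 2) - 2 * ε) 0 ^ 2 with hq
  have hq1 : ContDiff ℝ 1 q := contDiff_max_sq.comp (hψ.sub contDiff_const)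
  set s : Space → ℝ := fun x => (1 + ‖x - c‖ ^ 2)⁻¹ with hsdef
  have hs0 : ∀ x, 0 < 1 + ‖x - c‖ ^ 2 := fun x => by positivity
  have hb : ContDiff ℝ 1 (fun x : Space => 1 + ‖x - c‖ ^ 2) :=
    contDiff_const.add ((contDiff_id.sub contDiff_const).norm_sq ℝ)
  have hs1 : ContDiff ℝ 1 s := hb.inv fun x => (hs0 x).ne'
  have hcoord : ∀ i : Fin 3, ContDiff ℝ 1 (fun x : Space => (x - c) i) := fun i =>
    ((EuclideanSpace.proj (𝕜 := ℝ) i).contDiff).comp (contDiff_id.sub contDiff_const)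
  set f : Fin 3 → Space → ℝ := fun i x => q x * ((x - c) i * s x) with hf
  have hf1 : ∀ i, ContDiff ℝ 1 (f i) := fun i => hq1.mul ((hcoord i).mul hs1)
  have hqc : HasCompactSupport q := by
    have h1 : ∀ᶠ x in cocompact Space, q x = 0 := by
      have h2 : Tendsto (fun x => ‖φ x‖) (cocompact Space) (𝓝 0) := by
        simpa using hlim.norm
      filter_upwards [h2.eventually (Iio_mem_nhds hε)] with x hx
      have h3 : √(‖φ x‖ ^ 2 + ε ^ 2) ≤ 2 * ε := by
        rw [Real.sqrt_le_left (by positivity)]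
        have : ‖φ x‖ < ε := hx
        nlinarith [norm_nonneg (φ x)]
      simp only [hq]
      rw [max_eq_right (by linarith), zero_pow two_ne_zero]
    obtain ⟨K, hK, hK'⟩ := mem_cocompact.1 h1
    exact HasCompactSupport.intro hK fun x hx => hK' hx
  have hfc : ∀ i, HasCompactSupport (f i) := fun i => hqc.mul_right
  have hdq : ∀ x i, |fderiv ℝ q x (EuclideanSpace.single i 1)|
      ≤ 2 * max (√(‖φ x‖ ^ 2 + ε ^ 2) - 2 * ε) 0 * ‖D i x‖ := by
    intro x i
    have h1 : HasFDerivAt (fun x => √(‖φ x‖ ^ 2 + ε ^ 2)) _ x :=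
      (((hn.differentiable (by simp) x).hasFDerivAt).add_const (ε ^ 2)).sqrt (hpos x).ne'
    have h2 : HasFDerivAt q _ x := (hasDerivAt_max_sq _).comp_hasFDerivAt x (h1.sub_const (2 * ε))
    rw [h2.fderiv]
    simp only [smul_apply, hD, smul_eq_mul]
    have h3 : 0 < √(‖φ x‖ ^ 2 + ε ^ 2) := Real.sqrt_pos.2 (hpos x)
    have h4 : ‖φ x‖ ≤ √(‖φ x‖ ^ 2 + ε ^ 2) := Real.le_sqrt_of_sq_le (by nlinarith [sq_nonneg ε])
    have h5 : |1 / (2 * √(‖φ x‖ ^ 2 + ε ^ 2)) * (2 * inner ℝ (φ x) (D i x))| ≤ ‖D i x‖ := by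
      have h6 := abs_real_inner_le_norm (φ x) (D i x)
      have : 1 / (2 * √(‖φ x‖ ^ 2 + ε ^ 2)) * (2 * inner ℝ (φ x) (D i x))
          = inner ℝ (φ x) (D i x) / √(‖φ x‖ ^ 2 + ε ^ 2) := by field_simp
      rw [this, abs_div, abs_of_pos h3, div_le_iff₀ h3]
      nlinarith [mul_le_mul_of_nonneg_left h4 (norm_nonneg (D i x))]
    rw [abs_mul, abs_of_nonneg (by positivity)]
    exact mul_le_mul_of_nonneg_left h5 (by positivity)
  have hdf : ∀ x i, fderiv ℝ (f i) x (EuclideanSpace.single i 1)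
      = fderiv ℝ q x (EuclideanSpace.single i 1) * ((x - c) i * s x)
        + q x * (s x - 2 * (x - c) i ^ 2 * s x ^ 2) := by
    intro x i
    have h1 : HasFDerivAt (fun x : Space => (x - c) i) (EuclideanSpace.proj (𝕜 := ℝ) i) x :=
      (EuclideanSpace.proj (𝕜 := ℝ) i : Space →L[ℝ] ℝ).hasFDerivAt.comp x
        ((hasFDerivAt_id x).sub_const c)
    have h2 : HasFDerivAt (fun x : Space => 1 + ‖x - c‖ ^ 2) _ x :=
      (((hasFDerivAt_id x).sub_const c).norm_sq).const_add 1
    have h3 : HasFDerivAt s _ x := (hasDerivAt_inv (hs0 x).ne').comp_hasFDerivAt x h2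
    have h4 : HasFDerivAt (f i) _ x :=
      ((hq1.differentiable (by simp) x).hasFDerivAt).mul (h1.mul h3)
    rw [h4.fderiv]
    have h5 : inner ℝ (x - c) (EuclideanSpace.single i (1 : ℝ)) = (x - c) i := by
      rw [real_inner_comm]; exact inner_single_space i _
    have h6 : (EuclideanSpace.proj (𝕜 := ℝ) i : Space →L[ℝ] ℝ) (EuclideanSpace.single i 1) = 1 := by
      simp
    simp only [add_apply, smul_apply, smul_eq_mul, h6,
      ContinuousLinearMap.comp_apply, innerSL_apply_apply, ContinuousLinearMap.id_apply, id, h5]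
    simp only [hsdef, inv_pow]
    ring
  have hw : ∀ x, ∑ i, (x - c) i ^ 2 = ‖x - c‖ ^ 2 := fun x =>
    (EuclideanSpace.real_norm_sq_eq _).symm
  -- With 2 u |D_i| |y_i| ≤ u² y_i² / 2 + 2 |D_i|², y = s (x - c), the divergence is at least (3 - 2
  -- - 1/2) u² s - 2 Σ |D_i|², since r² s ≤ 1. Doubling gives the claim and the constant 4.
  have hpt : ∀ x, q x * s x ≤ 2 * (∑ i, fderiv ℝ (f i) x (EuclideanSpace.single i 1))
      + 4 * ∑ i, ‖D i x‖ ^ 2 := by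
    intro x
    have hsx : 0 < s x := inv_pos.2 (hs0 x)
    have hs2 : ‖x - c‖ ^ 2 * s x ≤ 1 := by
      simp only [hsdef]
      rw [← div_eq_mul_inv, div_le_one (hs0 x)]; linarith
    set u := max (√(‖φ x‖ ^ 2 + ε ^ 2) - 2 * ε) 0 with hu
    have hu0 : 0 ≤ u := le_max_right _ _
    have hqu : q x = u ^ 2 := rfl
    have h1 : ∀ i, -(1 / 2 * u ^ 2 * ((x - c) i * s x) ^ 2 + 2 * ‖D i x‖ ^ 2)
        ≤ fderiv ℝ q x (EuclideanSpace.single i 1) * ((x - c) i * s x) := by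
      intro i
      have h2 := hdq x i
      have h3 : |fderiv ℝ q x (EuclideanSpace.single i 1) * ((x - c) i * s x)|
          ≤ 2 * u * ‖D i x‖ * |(x - c) i * s x| := by
        rw [abs_mul]; exact mul_le_mul_of_nonneg_right h2 (abs_nonneg _)
      have h4 := (abs_le.1 h3).1
      have h5 : (u * |(x - c) i * s x|) ^ 2 = u ^ 2 * ((x - c) i * s x) ^ 2 := by
        rw [mul_pow, sq_abs]
      nlinarith [sq_nonneg (u * |(x - c) i * s x| - 2 * ‖D i x‖)]
    have h2 : ∑ i, fderiv ℝ (f i) x (EuclideanSpace.single i 1) ≥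
        -(1 / 2 * u ^ 2 * (‖x - c‖ ^ 2 * s x ^ 2) + 2 * ∑ i, ‖D i x‖ ^ 2)
        + u ^ 2 * (3 * s x - 2 * ‖x - c‖ ^ 2 * s x ^ 2) := by
      rw [← hw x]
      simp only [hdf, hqu, Fin.sum_univ_three]
      have a0 := h1 0
      have a1 := h1 1
      have a2 := h1 2
      linarith
    have h3 : u ^ 2 * (‖x - c‖ ^ 2 * s x ^ 2) ≤ u ^ 2 * s x := by
      have : ‖x - c‖ ^ 2 * s x ^ 2 ≤ s x := by nlinarith
      exact mul_le_mul_of_nonneg_left this (sq_nonneg u)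
    rw [hqu]
    nlinarith
  have hfi : ∀ i, Integrable fun x => fderiv ℝ (f i) x (EuclideanSpace.single i 1) := fun i =>
    (((hf1 i).continuous_fderiv (by simp)).clm_apply
      continuous_const).integrable_of_hasCompactSupport ((hfc i).fderiv_apply ℝ _)
  have hqs : Integrable fun x => q x * s x :=
    (hq1.continuous.mul hs1.continuous).integrable_of_hasCompactSupport hqc.mul_right
  refine ⟨hqs, ?_⟩
  refine (integral_mono hqs (((integrable_finsetSum _ fun i _ => hfi i).const_mul 2).add
    (hint.const_mul 4)) hpt).trans_eq ?_
  rw [integral_add' ((integrable_finsetSum _ fun i _ => hfi i).const_mul 2) (hint.const_mul 4),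
    integral_const_mul, integral_const_mul, integral_finsetSum _ fun i _ => hfi i]
  simp only [integral_fderiv_space_eq_zero (hf1 _) (hfc _)]
  simp

/-- Hardy's inequality for a field with covariant derivatives `D`. -/
theorem lintegral_hardy {φ : Space → W} (hφ : ContDiff ℝ 1 φ)
    (hlim : Tendsto φ (cocompact Space) (𝓝 0)) {D : Fin 3 → Space → W}
    (hD : ∀ x i, fderiv ℝ (fun y => ‖φ y‖ ^ 2) x (EuclideanSpace.single i 1)
      = 2 * inner ℝ (φ x) (D i x))
    (hint : Integrable fun x => ∑ i, ‖D i x‖ ^ 2) (c : Space) :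
    ∫⁻ x, ENNReal.ofReal (‖φ x‖ ^ 2 * (1 + ‖x - c‖ ^ 2)⁻¹)
      ≤ ENNReal.ofReal (4 * ∫ x, ∑ i, ‖D i x‖ ^ 2) := by
  -- The truncations with ε = 1 / (n + 1) converge pointwise to the Hardy density, and Fatou's lemma
  -- carries the uniform bound to the limit without prior integrability of ‖φ‖².
  set F : ℕ → Space → ENNReal := fun n x => ENNReal.ofReal
    (max (√(‖φ x‖ ^ 2 + (1 / ((n : ℝ) + 1)) ^ 2) - 2 * (1 / ((n : ℝ) + 1))) 0 ^ 2
      * (1 + ‖x - c‖ ^ 2)⁻¹) with hF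
  have hpt : ∀ x, Tendsto (fun n => F n x) atTop
      (𝓝 (ENNReal.ofReal (‖φ x‖ ^ 2 * (1 + ‖x - c‖ ^ 2)⁻¹))) := by
    intro x
    refine ENNReal.tendsto_ofReal ?_
    have h1 : Continuous fun ε : ℝ => max (√(‖φ x‖ ^ 2 + ε ^ 2) - 2 * ε) 0 ^ 2
      * (1 + ‖x - c‖ ^ 2)⁻¹ := by fun_prop
    have h2 := (h1.tendsto 0).comp (tendsto_one_div_add_atTop_nhds_zero_nat (𝕜 := ℝ))
    simpa [Function.comp_def] using h2
  calc ∫⁻ x, ENNReal.ofReal (‖φ x‖ ^ 2 * (1 + ‖x - c‖ ^ 2)⁻¹)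
      = ∫⁻ x, liminf (fun n => F n x) atTop := by
        congr 1; ext x; exact (hpt x).liminf_eq.symm
    _ ≤ liminf (fun n => ∫⁻ x, F n x) atTop := by
        refine lintegral_liminf_le fun n => ?_
        have := hφ.continuous
        have h1 : ∀ x : Space, 1 + ‖x - c‖ ^ 2 ≠ 0 := fun x => by positivity
        have h2 : Continuous fun x =>
            max (√(‖φ x‖ ^ 2 + (1 / ((n : ℝ) + 1)) ^ 2) - 2 * (1 / ((n : ℝ) + 1))) 0 ^ 2
            * (1 + ‖x - c‖ ^ 2)⁻¹ := by fun_prop (disch := exact h1 _)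
        exact h2.measurable.ennreal_ofReal
    _ ≤ ENNReal.ofReal (4 * ∫ x, ∑ i, ‖D i x‖ ^ 2) := by
        refine liminf_le_of_frequently_le' (Frequently.of_forall fun n => ?_)
        have h1 := integral_hardy_aux hφ hlim hD hint c
          (ε := 1 / ((n : ℝ) + 1)) (by positivity)
        rw [← ofReal_integral_eq_lintegral_ofReal h1.1
          (Eventually.of_forall fun x => by positivity)]
        exact ENNReal.ofReal_le_ofReal h1.2

variable {𝔤 : Type*} [NormedAddCommGroup 𝔤] [InnerProductSpace ℝ 𝔤] {P : Period}
  {br : 𝔤 →L[ℝ] 𝔤 →L[ℝ] 𝔤} {ρ : 𝔤 →L[ℝ] W →L[ℝ] W}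
  {A : Spacetime → Spacetime →L[ℝ] 𝔤} {φ : Spacetime → W} {𝒱 : Spacetime → ℝ}
  {S : Spacetime → W}

/-- Hardy's inequality on almost every time slice, centred at the point t v of the axis, integrated
over the period. The weight in `rad2` is smaller by `norm_sub_sq_le_rad2`. -/
theorem IsSoliton.integrable_hardy (hs : IsSoliton P br ρ A φ 𝒱 S) (hlim : VanishesAtInfinity φ) :
    IntegrableOn (fun p => ‖φ p‖ ^ 2 * (1 + rad2 P.vel p)⁻¹) P.slab := by
  have hφ := hs.smooth_φ
  have hr := (contDiff_rad2 P.vel).continuous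
  have hr0 := rad2_nonneg P.vel
  have hφc := hφ.continuous
  have hint : Integrable (fun p : Spacetime => ∑ i : Fin 3, ‖covDir ρ A (dir i.succ) φ p‖ ^ 2)
      (((volume : Measure ℝ).restrict (Set.Icc 0 P.T)).prod volume) := by
    rw [← P.volume_restrict_slab]
    exact integrable_finsetSum _ fun i _ => (hs.memLp_covDir i.succ).integrable_norm_pow (by simp)
  have hm : ∀ p : Spacetime, 1 + rad2 P.vel p ≠ 0 := fun p => by
    have := hr0 p; positivity
  have hcont : Continuous fun p => ‖φ p‖ ^ 2 * (1 + rad2 P.vel p)⁻¹ := by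
    fun_prop (disch := exact hm _)
  refine ⟨hcont.aestronglyMeasurable, ?_⟩
  rw [hasFiniteIntegral_iff_ofReal (Eventually.of_forall fun p => by
    have := hr0 p; positivity), P.volume_restrict_slab,
    lintegral_prod _ hcont.measurable.ennreal_ofReal.aemeasurable]
  refine lt_of_le_of_lt (lintegral_mono_ae (g := fun t => ENNReal.ofReal
    (4 * ∫ x, ∑ i : Fin 3, ‖covDir ρ A (dir i.succ) φ (t, x)‖ ^ 2)) ?_) ?_
  · filter_upwards [hint.prod_right_ae] with t ht
    have h1 := lintegral_hardy (φ := fun x => φ (t, x))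
      ((hφ.of_le (by simp)).comp (contDiff_prodMk_right t)) (hlim t)
      (D := fun i x => covDir ρ A (dir i.succ) φ (t, x)) ?_ ht (t • P.vel)
    · refine le_trans (lintegral_mono fun x => ENNReal.ofReal_le_ofReal ?_) h1
      have h2 := norm_sub_sq_le_rad2 P.norm_vel_lt (t, x)
      gcongr
    · intro x i
      have d1 := hφ.differentiable (by simp) (t, x)
      have h2 : HasFDerivAt (fun p => (inner ℝ (φ p) (φ p) : ℝ))
        (fderiv ℝ (fun p => (inner ℝ (φ p) (φ p) : ℝ)) (t, x)) (t, x) :=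
        (d1.inner ℝ d1).hasFDerivAt
      have h3 := h2.comp x (hasFDerivAt_prodMk_right t x)
      simp only [Function.comp_def, real_inner_self_eq_norm_sq] at h3
      rw [h3.fderiv]
      have h4 := fderiv_inner_covDir (A := A) hs.rep.skew d1 d1 (dir i.succ)
      rw [real_inner_comm (φ (t, x)) (covDir ρ A (dir i.succ) φ (t, x)), ← two_mul] at h4
      rw [← h4]
      simp only [real_inner_self_eq_norm_sq]
      rfl
  · have h1 := (hint.integral_prod_left.const_mul 4)
    exact (hasFiniteIntegral_iff_ofReal (Eventually.of_forall fun t => by positivity)).1 h1.2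

end Hardy

/-! ### Absence of solitons -/

section Absence

variable {W : Type*} [NormedAddCommGroup W] [InnerProductSpace ℝ W]
  {𝔤 : Type*} [NormedAddCommGroup 𝔤] [InnerProductSpace ℝ 𝔤]

/-- Vanishing almost everywhere becomes vanishing everywhere because the slab is the closure of its
interior. -/
theorem Period.eq_zero_of_integral_eq_zero (P : Period) {f : Spacetime → ℝ} (hf : Continuous f)
    (hi : IntegrableOn f P.slab) (h0 : ∀ p, 0 ≤ f p) (h : ∫ p in P.slab, f p = 0) :
    ∀ p ∈ P.slab, f p = 0 := by
  have h1 := (integral_eq_zero_iff_of_nonneg h0 hi).1 h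
  refine Measure.eqOn_of_ae_eq h1 hf.continuousOn continuousOn_const ?_
  rw [Period.slab, interior_prod_eq, closure_prod_eq, interior_Icc, interior_univ, closure_univ,
    closure_Ioo P.T_pos.ne]

/-- For such `w` the direction (0, w) is purely spatial both in the original frame and in the rest
frame. -/
theorem exists_ne_zero_inner_eq_zero (v : Space) : ∃ w : Space, w ≠ 0 ∧ inner ℝ v w = 0 := by
  have h1 := Submodule.finrank_add_finrank_orthogonal (ℝ ∙ v)
  have h2 := finrank_span_le_card (R := ℝ) ({v} : Set Space)
  rw [Set.toFinset_singleton, Finset.card_singleton] at h2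
  have h3 : Module.finrank ℝ Space = 3 := by simp
  have h4 : (ℝ ∙ v)ᗮ ≠ ⊥ := by
    intro h
    rw [h, finrank_bot] at h1
    omega
  obtain ⟨w, hw, hw0⟩ := Submodule.exists_mem_ne_zero_of_ne_bot h4
  exact ⟨w, hw0, Submodule.mem_orthogonal_singleton_iff_inner_right.1 hw⟩

theorem eq_zero_of_sum_norm_sq_eq_zero {F : Type*} [NormedAddCommGroup F] {ι : Type*} [Fintype ι]
    {f : ι → F}
    (h : ∑ i, ‖f i‖ ^ 2 = 0) (i : ι) : f i = 0 :=
  norm_eq_zero.1 (pow_eq_zero_iff two_ne_zero |>.1 ((Finset.sum_eq_zero_iff_of_nonneg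
    fun _ _ => sq_nonneg _).1 h i (Finset.mem_univ i)))

namespace IsSoliton

variable {P : Period} {br : 𝔤 →L[ℝ] 𝔤 →L[ℝ] 𝔤} {ρ : 𝔤 →L[ℝ] W →L[ℝ] W}
  {A : Spacetime → Spacetime →L[ℝ] 𝔤} {φ : Spacetime → W} {𝒱 : Spacetime → ℝ}
  {S : Spacetime → W}

variable (br A P) in
/-- The energy density of the gauge field in the rest frame. -/
def ymEnergy (p : Spacetime) : ℝ :=
  1 / 2 * ∑ i : Fin 3, ‖curv br A (boostFrame P.vel 0) (boostFrame P.vel i.succ) p‖ ^ 2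
  + 1 / 4 * ∑ i : Fin 3, ∑ j : Fin 3,
      ‖curv br A (boostFrame P.vel i.succ) (boostFrame P.vel j.succ) p‖ ^ 2

theorem ymEnergy_nonneg (p : Spacetime) : 0 ≤ ymEnergy P br A p := by
  unfold ymEnergy; positivity

theorem continuous_ymEnergy (hA : ContDiff ℝ ∞ A) : Continuous (ymEnergy P br A) := by
  have h : ∀ h k, Continuous (curv br A h k) := fun h k => (contDiff_curv hA h k).continuous
  unfold ymEnergy
  fun_prop

variable (hs : IsSoliton P br ρ A φ 𝒱 S)
include hs

theorem integrable_ymEnergy : IntegrableOn (ymEnergy P br A) P.slab := by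
  have h : ∀ h k, IntegrableOn (fun p => ‖curv br A h k p‖ ^ 2) P.slab := fun h k =>
    (hs.memLp_curv' h k).integrable_norm_pow (by simp)
  exact ((integrable_finsetSum _ fun i _ => h _ _).const_mul _).add
    ((integrable_finsetSum _ fun i _ => integrable_finsetSum _ fun j _ => h _ _).const_mul _)

theorem curv_boostFrame_eq_zero {p : Spacetime} (h : ymEnergy P br A p = 0) (α β : Fin 4) :
    curv br A (boostFrame P.vel α) (boostFrame P.vel β) p = 0 := by
  have h1 : 0 ≤ ∑ i : Fin 3, ‖curv br A (boostFrame P.vel 0) (boostFrame P.vel i.succ) p‖ ^ 2 :=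
    Finset.sum_nonneg fun _ _ => sq_nonneg _
  have h2 : 0 ≤ ∑ i : Fin 3, ∑ j : Fin 3,
      ‖curv br A (boostFrame P.vel i.succ) (boostFrame P.vel j.succ) p‖ ^ 2 :=
    Finset.sum_nonneg fun _ _ => Finset.sum_nonneg fun _ _ => sq_nonneg _
  rw [ymEnergy] at h
  have h3 := eq_zero_of_sum_norm_sq_eq_zero
    (f := fun i : Fin 3 => curv br A (boostFrame P.vel 0) (boostFrame P.vel i.succ) p)
    (by linarith)
  have h4 := fun i : Fin 3 => eq_zero_of_sum_norm_sq_eq_zero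
    (f := fun j : Fin 3 => curv br A (boostFrame P.vel i.succ) (boostFrame P.vel j.succ) p)
    ((Finset.sum_eq_zero_iff_of_nonneg fun i _ => Finset.sum_nonneg fun j _ => sq_nonneg _).1
      (by linarith : ∑ i : Fin 3, ∑ j : Fin 3,
        ‖curv br A (boostFrame P.vel i.succ) (boostFrame P.vel j.succ) p‖ ^ 2 = 0) i
      (Finset.mem_univ i))
  refine Fin.cases ?_ (fun i => ?_) α <;> refine Fin.cases ?_ (fun j => ?_) β
  · exact curv_self hs.antisymm _ p
  · exact h3 j
  · rw [curv_antisymm hs.antisymm, neg_eq_zero]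
    exact h3 i
  · exact h4 i j

theorem curv_eq_zero_of_ymEnergy_eq_zero {p : Spacetime} (h : ymEnergy P br A p = 0)
    (k l : Spacetime) : curv br A k l p = 0 := by
  have he := isFrame_boostFrame P.norm_vel_lt
  rw [← he k, sum_isLinearMap (isLinearMap_curv hs.smooth_A l p)]
  refine Finset.sum_eq_zero fun α _ => ?_
  rw [← he l, sum_isLinearMap (isLinearMap_curv_right hs.antisymm hs.smooth_A _ p)]
  simp [hs.curv_boostFrame_eq_zero h]

theorem curv_eq_zero_of_slab (h : ∀ p ∈ P.slab, ymEnergy P br A p = 0) (k l p : Spacetime) :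
    curv br A k l p = 0 := by
  suffices ∀ p k l, curv br A k l p = 0 from this p k l
  refine P.forall_of_slab (fun q => ⟨fun hq k l => ?_, fun hq k l => ?_⟩)
    fun p hp k l => hs.curv_eq_zero_of_ymEnergy_eq_zero (h p hp) k l
  · rw [← curv_shift hs.smooth_A hs.shift_A]
    exact hq _ _
  · rw [← P.lin.apply_symm_apply k, ← P.lin.apply_symm_apply l, curv_shift hs.smooth_A hs.shift_A]
    exact hq _ _

theorem eq_zero_of_slab (h : ∀ p ∈ P.slab, φ p = 0) (p : Spacetime) : φ p = 0 :=
  P.forall_of_slab (p := fun p => φ p = 0) (fun q => by rw [hs.shift_φ]) h p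

/-- Since the metric is -1 on unit spatial vectors, the metric term contributes three times the
Lagrangian. For the gauge field, electric terms then occur with -1 + 3/2 = 1/2 and magnetic ones
with 1 - 3/4 = 1/4, the coefficients of its energy. -/
theorem trace_stress (p : Spacetime) :
    ∑ i : Fin 3, stress br ρ A eta (boostFrame P.vel) mink φ 𝒱
        (boostFrame P.vel i.succ) (boostFrame P.vel i.succ) p
      = 3 * ‖covDir ρ A (boostFrame P.vel 0) φ p‖ ^ 2
        - ∑ i : Fin 3, ‖covDir ρ A (boostFrame P.vel i.succ) φ p‖ ^ 2 - 3 * 𝒱 p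
        + ymEnergy P br A p := by
  have hv := P.norm_vel_lt
  have h0 := curv_self (A := A) hs.antisymm (boostFrame P.vel 0) p
  have h1 : ∀ i : Fin 3, ‖curv br A (boostFrame P.vel i.succ) (boostFrame P.vel 0) p‖
      = ‖curv br A (boostFrame P.vel 0) (boostFrame P.vel i.succ) p‖ := fun i => by
    rw [curv_antisymm hs.antisymm, norm_neg]
  simp only [stress, lagr, mul_assoc, ← Finset.mul_sum, sum_eta, real_inner_self_eq_norm_sq, h0, h1,
    mink_boostFrame hv, if_true, norm_zero, ymEnergy, Finset.sum_sub_distrib,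
    Finset.sum_const, Finset.card_univ, Fintype.card_fin, nsmul_eq_mul]
  push_cast
  ring

/-- The trace identity minus `a` times the scalar identity. The value a = 3 eliminates the time
derivative of φ, the value a = 1 its gradient. -/
theorem integral_virial (a : ℝ) :
    IntegrableOn (fun p => (3 - a) * ‖covDir ρ A (boostFrame P.vel 0) φ p‖ ^ 2
        + (a - 1) * ∑ i : Fin 3, ‖covDir ρ A (boostFrame P.vel i.succ) φ p‖ ^ 2
        + (a * inner ℝ (S p) (φ p) - 3 * 𝒱 p) + ymEnergy P br A p) P.slab ∧
    (VanishesAtInfinity φ →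
      ∫ p in P.slab, ((3 - a) * ‖covDir ρ A (boostFrame P.vel 0) φ p‖ ^ 2
        + (a - 1) * ∑ i : Fin 3, ‖covDir ρ A (boostFrame P.vel i.succ) φ p‖ ^ 2
        + (a * inner ℝ (S p) (φ p) - 3 * 𝒱 p) + ymEnergy P br A p) = 0) := by
  have hD : ∀ h, IntegrableOn (fun p => ‖covDir ρ A h φ p‖ ^ 2) P.slab := fun h =>
    (hs.memLp_covDir' h).integrable_norm_pow (by simp)
  refine ⟨((((hD _).const_mul _).add ((integrable_finsetSum _ fun i _ => hD _).const_mul _)).add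
    ((hs.integrable_S.const_mul _).sub (hs.integrable_𝒱.const_mul _))).add hs.integrable_ymEnergy,
    fun hlim => ?_⟩
  have h1 := hs.integral_trace_stress
  have h2 := hs.integral_scalar (hs.integrable_hardy hlim)
  have i1 : IntegrableOn (fun p => ∑ i : Fin 3, stress br ρ A eta (boostFrame P.vel) mink φ 𝒱
        (boostFrame P.vel i.succ) (boostFrame P.vel i.succ) p) P.slab :=
    integrable_finsetSum _ fun i _ => hs.integrable_stress _ _ _
  have i2 : IntegrableOn (fun p => ∑ α, eta α * inner ℝ
        (covDir ρ A (boostFrame P.vel α) φ p) (covDir ρ A (boostFrame P.vel α) φ p)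
        - inner ℝ (S p) (φ p)) P.slab :=
    (integrable_finsetSum _ fun α _ => (hs.integrable_inner_covDir _ _).const_mul _).sub
      hs.integrable_S
  have h3 := integral_sub i1 (i2.const_mul a)
  rw [integral_const_mul, h1, h2, mul_zero, sub_zero] at h3
  rw [← h3]
  congr 1
  ext p
  rw [hs.trace_stress, sum_eta]
  simp only [real_inner_self_eq_norm_sq]
  ring

theorem continuous_virial (a : ℝ) :
    Continuous (fun p => (3 - a) * ‖covDir ρ A (boostFrame P.vel 0) φ p‖ ^ 2
        + (a - 1) * ∑ i : Fin 3, ‖covDir ρ A (boostFrame P.vel i.succ) φ p‖ ^ 2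
        + (a * inner ℝ (S p) (φ p) - 3 * 𝒱 p) + ymEnergy P br A p) := by
  have hD : ∀ h, Continuous (covDir ρ A h φ) := fun h =>
    (contDiff_covDir hs.smooth_A hs.smooth_φ h).continuous
  have h1 := hs.continuous_S
  have h2 := hs.smooth_φ.continuous
  have h3 := hs.smooth_𝒱.continuous
  have h4 := continuous_ymEnergy (P := P) (br := br) hs.smooth_A
  fun_prop

/-- A field that is covariantly constant along a spatial line vanishes on it. -/
theorem eq_zero_of_covDir_eq_zero (hlim : VanishesAtInfinity φ) {w : Space} (hw : w ≠ 0) (t : ℝ)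
    (h : ∀ x, covDir ρ A (0, w) φ (t, x) = 0) (x : Space) : φ (t, x) = 0 := by
  have hd : ∀ s : ℝ, HasDerivAt (fun s : ℝ => (inner ℝ (φ (t, x + s • w)) (φ (t, x + s • w)) : ℝ))
      0 s := by
    intro s
    have d1 := hs.smooth_φ.differentiable (by simp) (t, x + s • w)
    have h2 : HasFDerivAt (fun p => (inner ℝ (φ p) (φ p) : ℝ))
      (fderiv ℝ (fun p => (inner ℝ (φ p) (φ p) : ℝ)) (t, x + s • w)) (t, x + s • w) :=
      (d1.inner ℝ d1).hasFDerivAt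
    have h3 : HasDerivAt (fun s : ℝ => ((t, x + s • w) : Spacetime)) (0, w) s := by
      have h4 := ((hasDerivAt_id s).smul_const w).const_add x
      rw [one_smul] at h4
      exact (hasDerivAt_const s t).prodMk h4
    have h5 := h2.comp_hasDerivAt s h3
    rw [fderiv_inner_covDir (A := A) hs.rep.skew d1 d1, h, inner_zero_left, inner_zero_right,
      add_zero] at h5
    exact h5
  have hconst : ∀ s : ℝ, (inner ℝ (φ (t, x + s • w)) (φ (t, x + s • w)) : ℝ)
      = inner ℝ (φ (t, x)) (φ (t, x)) := fun s => by
    have := is_const_of_deriv_eq_zero (fun s => (hd s).differentiableAt) (fun s => (hd s).deriv) s 0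
    simpa using this
  -- The norm of φ is constant on the line, which leaves every compact set of space, where φ tends
  -- to 0.
  have h1 : Tendsto (fun s : ℝ => x + s • w) atTop (cocompact Space) := by
    refine tendsto_cocompact_of_tendsto_dist_comp_atTop x ?_
    simp only [dist_self_add_left, norm_smul]
    exact tendsto_norm_atTop_atTop.atTop_mul_const (norm_pos_iff.2 hw)
  have h2 := (hlim t).comp h1
  have h3 := h2.inner (𝕜 := ℝ) h2
  simp only [Function.comp_def, hconst, inner_zero_left] at h3
  exact inner_self_eq_zero.1 (tendsto_nhds_unique tendsto_const_nhds h3)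

theorem trivial_of_le (hlim : VanishesAtInfinity φ)
    (h : ∀ p, 0 ≤ inner ℝ (S p) (φ p) - 𝒱 p) :
    (∀ p, φ p = 0) ∧ ∀ h k p, curv br A h k p = 0 := by
  have hv := P.norm_vel_lt
  have h0 : ∀ p ∈ P.slab, _ := P.eq_zero_of_integral_eq_zero (hs.continuous_virial 3)
    (hs.integral_virial 3).1 (fun p => by
      have h1 := h p
      have h2 := ymEnergy_nonneg (P := P) (br := br) (A := A) p
      have h3 : 0 ≤ ∑ i : Fin 3, ‖covDir ρ A (boostFrame P.vel i.succ) φ p‖ ^ 2 := by positivity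
      linarith) ((hs.integral_virial 3).2 hlim)
  have hp : ∀ p ∈ P.slab, ∑ i : Fin 3, ‖covDir ρ A (boostFrame P.vel i.succ) φ p‖ ^ 2 = 0 ∧
      ymEnergy P br A p = 0 := fun p hp => by
    have h1 := h p
    have h2 := ymEnergy_nonneg (P := P) (br := br) (A := A) p
    have h3 : 0 ≤ ∑ i : Fin 3, ‖covDir ρ A (boostFrame P.vel i.succ) φ p‖ ^ 2 := by positivity
    have h4 := h0 p hp
    constructor <;> linarith
  refine ⟨hs.eq_zero_of_slab ?_, hs.curv_eq_zero_of_slab fun p h => (hp p h).2⟩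
  rintro ⟨t, x⟩ htx
  obtain ⟨w, hw0, hw⟩ := exists_ne_zero_inner_eq_zero P.vel
  refine hs.eq_zero_of_covDir_eq_zero hlim hw0 t (fun y => ?_) x
  have h1 := eq_zero_of_sum_norm_sq_eq_zero (hp (t, y) ⟨htx.1, Set.mem_univ _⟩).1
  -- Thus (0, w) is a combination of the spatial rest-frame vectors, along all of which the
  -- covariant derivative vanishes.
  have h2 : mink (boostFrame P.vel 0) (0, w) = 0 := by
    simp [boostFrame_zero, fourVel, mink, real_inner_smul_left, hw]
  rw [← isFrame_boostFrame hv (0, w), sum_isLinearMap (isLinearMap_covDir φ _), Fin.sum_univ_succ,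
    h2, mul_zero, zero_smul, zero_add]
  refine Finset.sum_eq_zero fun i _ => ?_
  rw [h1, smul_zero]

theorem trivial_of_lt (hlim : VanishesAtInfinity φ) (hz : ∀ p, φ p = 0 → 𝒱 p = 0)
    (h : ∀ p, φ p ≠ 0 → 0 < inner ℝ (S p) (φ p) - 3 * 𝒱 p) :
    (∀ p, φ p = 0) ∧ ∀ h k p, curv br A h k p = 0 := by
  have hn : ∀ p, 0 ≤ inner ℝ (S p) (φ p) - 3 * 𝒱 p := fun p => by
    by_cases hp : φ p = 0
    · simp [hp, hz p hp]
    · exact (h p hp).le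
  have h0 : ∀ p ∈ P.slab, _ := P.eq_zero_of_integral_eq_zero (hs.continuous_virial 1)
    (hs.integral_virial 1).1 (fun p => by
      have h1 := hn p
      have h2 := ymEnergy_nonneg (P := P) (br := br) (A := A) p
      have h3 := sq_nonneg ‖covDir ρ A (boostFrame P.vel 0) φ p‖
      linarith) ((hs.integral_virial 1).2 hlim)
  have hp : ∀ p ∈ P.slab, inner ℝ (S p) (φ p) - 3 * 𝒱 p = 0 ∧
      ymEnergy P br A p = 0 := fun p hp => by
    have h1 := hn p
    have h2 := ymEnergy_nonneg (P := P) (br := br) (A := A) p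
    have h3 := sq_nonneg ‖covDir ρ A (boostFrame P.vel 0) φ p‖
    have h4 := h0 p hp
    constructor <;> linarith
  exact ⟨hs.eq_zero_of_slab fun p hps => by_contra fun hne => (h p hne).ne' (hp p hps).1,
    hs.curv_eq_zero_of_slab fun p h => (hp p h).2⟩

end IsSoliton

end Absence

/-! ### Flat connections are pure gauges -/

section PureGauge

variable {𝔸 : Type*} [NormedRing 𝔸] [NormedAlgebra ℝ 𝔸]

/-- The identity on the ball of radius `B`, cut off to `0` outside the ball of radius `2 B`. -/
def clip (B : ℝ) (x : 𝔸) : 𝔸 := max 0 (min 1 (2 - ‖x‖ / B)) • x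

theorem clip_of_norm_le {B : ℝ} (hB : 0 < B) {x : 𝔸} (hx : ‖x‖ ≤ B) : clip B x = x := by
  have : ‖x‖ / B ≤ 1 := (div_le_one hB).2 hx
  rw [clip, min_eq_left (by linarith), max_eq_right zero_le_one, one_smul]

theorem clip_of_le_norm {B : ℝ} (hB : 0 < B) {x : 𝔸} (hx : 2 * B ≤ ‖x‖) : clip B x = 0 := by
  have : 2 ≤ ‖x‖ / B := (le_div_iff₀ hB).2 hx
  rw [clip, max_eq_left ((min_le_right _ _).trans (by linarith)), zero_smul]

theorem norm_clip_le {B : ℝ} (hB : 0 < B) (x : 𝔸) : ‖clip B x‖ ≤ 2 * B := by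
  rcases le_total (2 * B) ‖x‖ with h | h
  · rw [clip_of_le_norm hB h, norm_zero]; positivity
  · rw [clip, norm_smul, Real.norm_of_nonneg (le_max_left _ _)]
    have : max 0 (min 1 (2 - ‖x‖ / B)) ≤ 1 := max_le zero_le_one (min_le_left _ _)
    nlinarith [norm_nonneg x]

/-- The constant is 1 + 2: the scalar factor is at most 1, and it has slope 1 / B against a vector
of norm at most 2 B. -/
theorem norm_clip_sub_le {B : ℝ} (hB : 0 < B) (x y : 𝔸) :
    ‖clip B x - clip B y‖ ≤ 3 * ‖x - y‖ := by
  have key : ∀ x y : 𝔸, ‖y‖ ≤ 2 * B → ‖clip B x - clip B y‖ ≤ 3 * ‖x - y‖ := by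
    intro x y hy
    have h1 : clip B x - clip B y = max 0 (min 1 (2 - ‖x‖ / B)) • (x - y)
        + (max 0 (min 1 (2 - ‖x‖ / B)) - max 0 (min 1 (2 - ‖y‖ / B))) • y := by
      rw [clip, clip]; module
    have h2 : max 0 (min 1 (2 - ‖x‖ / B)) ≤ 1 := max_le zero_le_one (min_le_left _ _)
    have h3 : |max 0 (min 1 (2 - ‖x‖ / B)) - max 0 (min 1 (2 - ‖y‖ / B))| ≤ ‖x - y‖ / B := by
      refine (abs_max_sub_max_le_max _ _ _ _).trans ?_
      rw [sub_self, abs_zero, max_eq_right (abs_nonneg _)]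
      refine (abs_min_sub_min_le_max _ _ _ _).trans ?_
      rw [sub_self, abs_zero, max_eq_right (abs_nonneg _)]
      have : 2 - ‖x‖ / B - (2 - ‖y‖ / B) = -((‖x‖ - ‖y‖) / B) := by ring
      rw [this, abs_neg, abs_div, abs_of_pos hB]
      exact div_le_div_of_nonneg_right (abs_norm_sub_norm_le x y) hB.le
    rw [h1]
    refine (norm_add_le _ _).trans ?_
    rw [norm_smul, norm_smul, Real.norm_of_nonneg (le_max_left _ _), Real.norm_eq_abs]
    have h4 : ‖x - y‖ / B * (2 * B) = 2 * ‖x - y‖ := by field_simp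
    have h5 : |max 0 (min 1 (2 - ‖x‖ / B)) - max 0 (min 1 (2 - ‖y‖ / B))| * ‖y‖
        ≤ ‖x - y‖ / B * (2 * B) := mul_le_mul h3 hy (norm_nonneg _) (by positivity)
    nlinarith [norm_nonneg (x - y)]
  rcases le_total ‖y‖ (2 * B) with h | h
  · exact key x y h
  rcases le_total ‖x‖ (2 * B) with h' | h'
  · rw [norm_sub_rev, norm_sub_rev x]; exact key y x h'
  · rw [clip_of_le_norm hB h, clip_of_le_norm hB h', sub_zero, norm_zero]; positivity

/-- A linear differential equation whose coefficients generate motions that preserve a compact set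
has a solution in this set. -/
theorem exists_transport [CompleteSpace 𝔸] {b : ℝ → 𝔸} (hb : Continuous b) {K : Set 𝔸} (hK : IsCompact K)
    (h1 : (1 : 𝔸) ∈ K)
    (hexp : ∀ s τ : ℝ, ∀ u ∈ K, NormedSpace.exp (τ • b s) * u ∈ K) :
    ∃ w : ℝ → 𝔸, w 0 = 1 ∧ (∀ s ∈ Set.Icc (0 : ℝ) 1, w s ∈ K) ∧
      ∀ s ∈ Set.Icc (0 : ℝ) 1, HasDerivWithinAt w (b s * w s) (Set.Icc 0 1) s := by
  obtain ⟨M, hM⟩ := (isCompact_Icc (a := (0 : ℝ)) (b := 1)).exists_bound_of_continuousOn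
    hb.continuousOn
  have hM0 : 0 ≤ M := (norm_nonneg _).trans (hM 0 (by simp))
  obtain ⟨B, hB0, hB⟩ := hK.isBounded.exists_pos_norm_le
  have hlip : ∀ s ∈ Set.Icc (0 : ℝ) 1, ∀ x y,
      ‖b s * clip B x - b s * clip B y‖ ≤ 3 * M * ‖x - y‖ := by
    intro s hs x y
    rw [← mul_sub]
    refine (norm_mul_le _ _).trans ?_
    calc ‖b s‖ * ‖clip B x - clip B y‖ ≤ M * (3 * ‖x - y‖) :=
          mul_le_mul (hM s hs) (norm_clip_sub_le hB0 x y) (norm_nonneg _) hM0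
      _ = 3 * M * ‖x - y‖ := by ring
  -- Clipping makes the vector field bounded by 2 M B and globally Lipschitz, so a solution exists
  -- on all of [0, 1] at once; it solves the linear equation wherever it stays in K.
  have hPL : IsPicardLindelof (fun s x => b s * clip B x) (tmin := 0) (tmax := 1)
      ⟨0, by simp⟩ (1 : 𝔸) (M * (2 * B)).toNNReal 0 (M * (2 * B)).toNNReal (3 * M).toNNReal := by
    refine ⟨fun s hs => LipschitzOnWith.of_dist_le_mul fun x _ y _ => ?_, fun x _ => ?_,
      fun s hs x _ => ?_, ?_⟩
    · rw [dist_eq_norm, dist_eq_norm, Real.coe_toNNReal _ (by positivity)]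
      exact hlip s hs x y
    · exact (hb.mul continuous_const).continuousOn
    · rw [Real.coe_toNNReal _ (by positivity)]
      exact (norm_mul_le _ _).trans (mul_le_mul (hM s hs) (norm_clip_le hB0 x) (norm_nonneg _) hM0)
    · simp
  obtain ⟨w, hw0, hw⟩ := hPL.exists_eq_forall_mem_Icc_hasDerivWithinAt₀
  have hwc : ContinuousOn w (Set.Icc 0 1) := fun s hs => (hw s hs).continuousWithinAt
  -- The distance from K satisfies a Gronwall inequality with initial value 0. At time s the
  -- solution is compared with the curve through a nearest point γ of K generated by `b s`, which
  -- remains in K.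
  have hmem : ∀ s ∈ Set.Icc (0 : ℝ) 1, w s ∈ K := by
    have hgr := le_gronwallBound_of_liminf_deriv_right_le (f := fun s => Metric.infDist (w s) K)
      (f' := fun s => 3 * M * Metric.infDist (w s) K) (δ := 0) (K := 3 * M) (ε := 0)
      (a := 0) (b := 1)
      ((Metric.continuous_infDist_pt K).comp_continuousOn hwc) ?_
      (by simp only [hw0]; exact (Metric.infDist_zero_of_mem h1).le)
      (fun s _ => by simp)
    · intro s hs
      have h2 := hgr s hs
      rw [gronwallBound_ε0_δ0] at h2
      exact (hK.isClosed.mem_iff_infDist_zero ⟨1, h1⟩).2 (le_antisymm h2 Metric.infDist_nonneg)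
    · intro s hs r hr
      have hs' : s ∈ Set.Icc (0 : ℝ) 1 := ⟨hs.1, hs.2.le⟩
      obtain ⟨γ, hγK, hγ⟩ := hK.exists_infDist_eq_dist ⟨1, h1⟩ (w s)
      have hd1 : HasDerivWithinAt w (b s * clip B (w s)) (Set.Ici s) s :=
        (hw s hs').mono_of_mem_nhdsWithin (mem_of_superset (Icc_mem_nhdsGE hs.2)
          (Set.Icc_subset_Icc_left hs.1))
      have hd2 : HasDerivAt (fun z : ℝ => NormedSpace.exp ((z - s) • b s) * γ) (b s * γ) s := by
        have h3 := hasDerivAt_exp_smul_const' (𝕂 := ℝ) (b s) (0 : ℝ)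
        have h4 := (h3.scomp_of_eq s ((hasDerivAt_id s).sub_const s) (by simp)).mul_const γ
        simpa [Function.comp_def] using h4
      have hd3 := hd1.sub hd2.hasDerivWithinAt
      have hbd : ‖b s * clip B (w s) - b s * γ‖ < r := by
        refine lt_of_le_of_lt ?_ hr
        have h5 := hlip s hs' (w s) γ
        rw [clip_of_norm_le hB0 (hB γ hγK)] at h5
        rwa [hγ, dist_eq_norm]
      have h6 := hd3.liminf_right_slope_norm_le hbd
      refine h6.mp (eventually_mem_nhdsWithin.mono fun z hz h7 => lt_of_le_of_lt ?_ h7)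
      have hzs : 0 < z - s := sub_pos.2 hz
      refine mul_le_mul_of_nonneg_left (sub_le_sub ?_ ?_) (inv_nonneg.2 hzs.le)
      · rw [Pi.sub_apply, ← dist_eq_norm]
        exact Metric.infDist_le_dist_of_mem (hexp s (z - s) γ hγK)
      · simp [hγ, dist_eq_norm]
  refine ⟨w, hw0, hmem, fun s hs => ?_⟩
  have := hw s hs
  rwa [clip_of_norm_le hB0 (hB _ (hmem s hs))] at this

variable {E : Type*} [NormedAddCommGroup E] [NormedSpace ℝ E]

theorem exists_taylor_bound [ProperSpace E] {F : Type*} [NormedAddCommGroup F] [NormedSpace ℝ F]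
    {a : E → F} (ha : ContDiff ℝ ∞ a) (R : ℝ) :
    ∃ M, 0 ≤ M ∧ (∀ x, ‖x‖ ≤ R → ‖a x‖ ≤ M ∧ ‖fderiv ℝ a x‖ ≤ M) ∧
      ∀ x h, ‖x‖ ≤ R → ‖x + h‖ ≤ R → ‖a (x + h) - a x - fderiv ℝ a x h‖ ≤ M * ‖h‖ ^ 2 := by
  have hc := isCompact_closedBall (0 : E) R
  have ha1 : ContDiff ℝ ∞ (fderiv ℝ a) := ha.fderiv_right (by simp)
  obtain ⟨M0, h0⟩ := hc.exists_bound_of_continuousOn ha.continuous.continuousOn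
  obtain ⟨M1, h1⟩ := hc.exists_bound_of_continuousOn ha1.continuous.continuousOn
  obtain ⟨M2, h2⟩ := hc.exists_bound_of_continuousOn
    (ha1.continuous_fderiv (by simp)).continuousOn
  simp only [mem_closedBall_zero_iff] at h0 h1 h2
  refine ⟨max 0 (max M0 (max M1 M2)), le_max_left _ _, fun x hx => ⟨(h0 x hx).trans ?_,
    (h1 x hx).trans ?_⟩, fun x h hx hxh => ?_⟩
  · simp
  · simp
  · set M := max 0 (max M0 (max M1 M2))
    have hM : M2 ≤ M := by simp [M]
    have hM0 : 0 ≤ M := le_max_left _ _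
    -- On the ball of radius ‖h‖ around `x`, within the large ball, the derivative differs from the
    -- one at `x` by at most M ‖h‖; the mean value inequality then gives the quadratic error.
    have hs := (convex_closedBall (0 : E) R).inter (convex_closedBall x ‖h‖)
    have h3 : ∀ y ∈ Metric.closedBall (0 : E) R ∩ Metric.closedBall x ‖h‖,
        ‖fderiv ℝ a y - fderiv ℝ a x‖ ≤ M * ‖h‖ := by
      rintro y ⟨hy, hy'⟩
      have h4 := (convex_closedBall (0 : E) R).norm_image_sub_le_of_norm_fderiv_le (𝕜 := ℝ)
        (f := fderiv ℝ a) (C := M) (fun z _ => ha1.differentiable (by simp) z)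
        (fun z hz => (h2 z (mem_closedBall_zero_iff.1 hz)).trans hM)
        (mem_closedBall_zero_iff.2 hx) hy
      refine h4.trans (mul_le_mul_of_nonneg_left ?_ hM0)
      rwa [← dist_eq_norm]
    have h5 := hs.norm_image_sub_le_of_norm_fderiv_le' (𝕜 := ℝ) (f := a) (x := x) (y := x + h)
      (fun z _ => ha.differentiable (by simp) z) h3
      ⟨mem_closedBall_zero_iff.2 hx, by simp⟩
      ⟨mem_closedBall_zero_iff.2 hxh, by simp⟩
    rw [add_sub_cancel_left] at h5
    linarith [h5, (by ring : M * ‖h‖ * ‖h‖ = M * ‖h‖ ^ 2)]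

/-- The error made by the first-order variation of parallel transport along a ray. -/
theorem norm_transport_error_le {M Q B s : ℝ} (hs : s ∈ Set.Icc (0 : ℝ) 1) {p h : E}
    {a a' : E →L[ℝ] 𝔸} {D : E →L[ℝ] E →L[ℝ] 𝔸} {w : 𝔸}
    (ha : ‖a‖ ≤ M) (hD : ‖D‖ ≤ M) (ha' : ‖a' - a - D (s • h)‖ ≤ M * ‖h‖ ^ 2) (hw : ‖w‖ ≤ B)
    (hp : ‖p + h‖ ≤ Q) (hh : ‖h‖ ≤ 1)
    (hflat : D p h - D h p = a p * a h - a h * a p) :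
    ‖a' (p + h) * (w + s • (a h * w)) - (a p * w + (a h * w + s • (D p h * w + a h * (a p * w))))‖
      ≤ (M + M * Q + M * M + 2 * (M * Q * M)) * B * ‖h‖ ^ 2 := by
  have hM0 : 0 ≤ M := (norm_nonneg _).trans ha
  have hB0 : 0 ≤ B := (norm_nonneg _).trans hw
  have hQ0 : 0 ≤ Q := (norm_nonneg _).trans hp
  have hn := norm_nonneg h
  obtain ⟨r, hr⟩ : ∃ r, r = a' - a - D (s • h) := ⟨_, rfl⟩
  have ha'' : a' = a + s • D h + r := by rw [hr, map_smul]; abel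
  rw [← hr] at ha'
  -- Flatness exchanges `D p h` for `D h p` plus a commutator, after which all terms of order 0 and
  -- 1 in `h` cancel.
  have e1 : a' (p + h) * (w + s • (a h * w))
      - (a p * w + (a h * w + s • (D p h * w + a h * (a p * w))))
      = s • (D h h * w) + r (p + h) * w + s • (a h * (a h * w))
        + s • s • (D h (p + h) * (a h * w)) + s • (r (p + h) * (a h * w)) := by
    have hf : D p h * w = D h p * w + (a p * (a h * w) - a h * (a p * w)) := by
      rw [← mul_assoc, ← mul_assoc, ← sub_mul, ← add_mul, ← hflat, add_sub_cancel]
    rw [hf, ha'']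
    simp only [add_apply, smul_apply, map_add, add_mul, mul_add, smul_mul_assoc, mul_smul_comm,
      smul_add, smul_sub]
    abel
  have hsm : ∀ x : 𝔸, ‖s • x‖ ≤ ‖x‖ := fun x => by
    rw [norm_smul, Real.norm_of_nonneg hs.1]
    exact mul_le_of_le_one_left (norm_nonneg _) hs.2
  have nah : ‖a h‖ ≤ M * ‖h‖ := (a.le_opNorm h).trans (mul_le_mul_of_nonneg_right ha hn)
  have nDh : ‖D h‖ ≤ M * ‖h‖ := (D.le_opNorm h).trans (mul_le_mul_of_nonneg_right hD hn)
  have nDhh : ‖D h h‖ ≤ M * ‖h‖ * ‖h‖ :=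
    ((D h).le_opNorm h).trans (mul_le_mul_of_nonneg_right nDh hn)
  have nDhp : ‖D h (p + h)‖ ≤ M * ‖h‖ * Q :=
    ((D h).le_opNorm _).trans (mul_le_mul nDh hp (norm_nonneg _) (by positivity))
  have nr : ‖r (p + h)‖ ≤ M * ‖h‖ ^ 2 * Q :=
    (r.le_opNorm _).trans (mul_le_mul ha' hp (norm_nonneg _) (by positivity))
  have nahw : ‖a h * w‖ ≤ M * ‖h‖ * B :=
    (norm_mul_le _ _).trans (mul_le_mul nah hw (norm_nonneg _) (by positivity))
  have t1 : ‖s • (D h h * w)‖ ≤ M * ‖h‖ * ‖h‖ * B :=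
    (hsm _).trans ((norm_mul_le _ _).trans (mul_le_mul nDhh hw (norm_nonneg _) (by positivity)))
  have t2 : ‖r (p + h) * w‖ ≤ M * ‖h‖ ^ 2 * Q * B :=
    (norm_mul_le _ _).trans (mul_le_mul nr hw (norm_nonneg _) (by positivity))
  have t3 : ‖s • (a h * (a h * w))‖ ≤ M * ‖h‖ * (M * ‖h‖ * B) :=
    (hsm _).trans ((norm_mul_le _ _).trans (mul_le_mul nah nahw (norm_nonneg _) (by positivity)))
  have t4 : ‖s • s • (D h (p + h) * (a h * w))‖ ≤ M * ‖h‖ * Q * (M * ‖h‖ * B) :=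
    (hsm _).trans ((hsm _).trans ((norm_mul_le _ _).trans
      (mul_le_mul nDhp nahw (norm_nonneg _) (by positivity))))
  have t5 : ‖s • (r (p + h) * (a h * w))‖ ≤ M * ‖h‖ ^ 2 * Q * (M * B) :=
    (hsm _).trans ((norm_mul_le _ _).trans (mul_le_mul nr (nahw.trans (by
      have : M * ‖h‖ ≤ M := mul_le_of_le_one_right hM0 hh
      exact mul_le_mul_of_nonneg_right this hB0)) (norm_nonneg _) (by positivity)))
  rw [e1]
  refine ((norm_add_le _ _).trans (add_le_add ((norm_add_le _ _).trans (add_le_add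
    ((norm_add_le _ _).trans (add_le_add ((norm_add_le _ _).trans (add_le_add t1 t2)) t3)) t4))
    t5)).trans_eq ?_
  ring

/-- A flat connection on a vector space is a pure gauge. -/
theorem exists_pure_gauge [CompleteSpace 𝔸] [ProperSpace E] {a : E → E →L[ℝ] 𝔸} (ha : ContDiff ℝ ∞ a)
    (hflat : ∀ p h k, fderiv ℝ a p h k - fderiv ℝ a p k h = a p h * a p k - a p k * a p h)
    {K : Set 𝔸} (hK : IsCompact K) (h1 : (1 : 𝔸) ∈ K)
    (hexp : ∀ (p h : E) (τ : ℝ), ∀ u ∈ K, NormedSpace.exp (τ • a p h) * u ∈ K) :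
    ∃ U : E → 𝔸, ContDiff ℝ ∞ U ∧ (∀ p, U p ∈ K) ∧ ∀ p h, fderiv ℝ U p h = a p h * U p := by
  have hac : Continuous a := ha.continuous
  have hray : ∀ p : E, Continuous fun s : ℝ => a (s • p) p := fun p => by fun_prop
  -- `w p` is the transport along the ray from 0 to `p`; the gauge transformation is its end point
  -- `w p 1`.
  choose w hw0 hwK hw using fun p : E => exists_transport (hray p) hK h1
    fun s τ u hu => hexp (s • p) p τ u hu
  obtain ⟨B, hB0, hB⟩ := hK.isBounded.exists_pos_norm_le
  have hwIci : ∀ p, ∀ s ∈ Set.Ico (0 : ℝ) 1,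
      HasDerivWithinAt (w p) (a (s • p) p * w p s) (Set.Ici s) s := fun p s hs =>
    (hw p s ⟨hs.1, hs.2.le⟩).mono_of_mem_nhdsWithin (mem_of_superset (Icc_mem_nhdsGE hs.2)
      (Set.Icc_subset_Icc_left hs.1))
  have hwc : ∀ p, ContinuousOn (w p) (Set.Icc 0 1) := fun p s hs => (hw p s hs).continuousWithinAt
  have hderiv : ∀ p, HasFDerivAt (fun p => w p 1)
      (((ContinuousLinearMap.mul ℝ 𝔸).flip (w p 1)).comp (a p)) p := by
    intro p
    obtain ⟨M, hM0, hM, hT⟩ := exists_taylor_bound ha (‖p‖ + 1)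
    set Q := ‖p‖ + 1
    have hQ : 0 ≤ Q := by positivity
    set C := (M + M * Q + M * M + 2 * (M * Q * M)) * B
    have hC : 0 ≤ C := by positivity
    -- If U is the gauge transformation, `w p s` is U (s p), whose variation along `h` must be s a(s
    -- p)(h) `w p s`. This guess solves the equation of the ray to `p + h` up to an error quadratic
    -- in `h`, and Gronwall's inequality carries the bound to s = 1.
    have hbound : ∀ h, ‖h‖ ≤ 1 →
        ‖w (p + h) 1 - w p 1 - a p h * w p 1‖ ≤ gronwallBound 0 (M * Q) C 1 * ‖h‖ ^ 2 := by
      intro h hh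
      have hph : ‖p + h‖ ≤ Q := (norm_add_le _ _).trans (by linarith)
      have hsc : ∀ s ∈ Set.Icc (0 : ℝ) 1, ∀ x : E, ‖s • x‖ ≤ ‖x‖ := fun s hs x => by
        rw [norm_smul, Real.norm_of_nonneg hs.1]
        exact mul_le_of_le_one_left (norm_nonneg _) hs.2
      have hdz : ∀ s ∈ Set.Ico (0 : ℝ) 1, HasDerivWithinAt
          (fun s => w p s + s • (a (s • p) h * w p s))
          (a (s • p) p * w p s + (a (s • p) h * w p s + s • (fderiv ℝ a (s • p) p h * w p s
            + a (s • p) h * (a (s • p) p * w p s)))) (Set.Ici s) s := by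
        intro s hs
        have d1 : HasDerivAt (fun s : ℝ => s • p) p s := by
          simpa using (hasDerivAt_id s).smul_const p
        have d2 : HasDerivAt (fun s : ℝ => a (s • p)) (fderiv ℝ a (s • p) p) s :=
          (ha.differentiable (by simp) (s • p)).hasFDerivAt.comp_hasDerivAt s d1
        have d3 : HasDerivAt (fun s : ℝ => a (s • p) h) (fderiv ℝ a (s • p) p h) s := by
          simpa using d2.clm_apply (hasDerivAt_const s h)
        have d4 := (hasDerivWithinAt_id s (Set.Ici s)).smul
          (d3.hasDerivWithinAt.mul (hwIci p s hs))
        have d5 := (hwIci p s hs).add d4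
        convert! d5 using 1
        simp only [id, Pi.mul_apply, one_smul]
        abel
      have hg := norm_le_gronwallBound_of_norm_deriv_right_le
        (f := fun s => w (p + h) s - (w p s + s • (a (s • p) h * w p s)))
        (f' := fun s => a (s • (p + h)) (p + h) * w (p + h) s
          - (a (s • p) p * w p s + (a (s • p) h * w p s + s • (fderiv ℝ a (s • p) p h * w p s
            + a (s • p) h * (a (s • p) p * w p s)))))
        (δ := 0) (K := M * Q) (ε := C * ‖h‖ ^ 2) (a := 0) (b := 1) ?_
        (fun s hs => (hwIci (p + h) s hs).sub (hdz s hs)) (by simp [hw0]) ?_ 1 (by simp)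
      · have h2 : gronwallBound 0 (M * Q) (C * ‖h‖ ^ 2) 1 = gronwallBound 0 (M * Q) C 1 * ‖h‖ ^ 2 := by
          by_cases h0 : M * Q = 0
          · simp [h0, gronwallBound_K0]
          · simp only [gronwallBound_of_K_ne_0 h0]; ring
        rw [sub_zero, h2] at hg
        simpa [sub_sub] using hg
      · have hc : Continuous fun s : ℝ => a (s • p) h := by fun_prop
        exact (hwc _).sub ((hwc _).add (continuousOn_id.smul (hc.continuousOn.mul (hwc _))))
      · intro s hs
        have hs' : s ∈ Set.Icc (0 : ℝ) 1 := ⟨hs.1, hs.2.le⟩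
        have hsp : ‖s • p‖ ≤ Q := (hsc s hs' p).trans (by simp [Q])
        have hsph : ‖s • p + s • h‖ ≤ Q := by
          rw [← smul_add]; exact (hsc s hs' _).trans hph
        have h3 := norm_transport_error_le (a := a (s • p)) (a' := a (s • p + s • h))
          (D := fderiv ℝ a (s • p)) hs' (hM _ hsp).1 (hM _ hsp).2
          ((hT _ _ hsp hsph).trans (mul_le_mul_of_nonneg_left
            (pow_le_pow_left₀ (norm_nonneg _) (hsc s hs' h) 2) hM0))
          (hB _ (hwK p s hs')) hph hh (hflat _ _ _)
        have h4 : ‖a (s • p + s • h) (p + h)‖ ≤ M * Q :=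
          ((a _).le_opNorm _).trans (mul_le_mul (hM _ hsph).1 hph (norm_nonneg _) hM0)
        have h5 : a (s • (p + h)) (p + h) * w (p + h) s
          - (a (s • p) p * w p s + (a (s • p) h * w p s + s • (fderiv ℝ a (s • p) p h * w p s
            + a (s • p) h * (a (s • p) p * w p s))))
          = a (s • p + s • h) (p + h) * (w (p + h) s - (w p s + s • (a (s • p) h * w p s)))
            + (a (s • p + s • h) (p + h) * (w p s + s • (a (s • p) h * w p s))
              - (a (s • p) p * w p s + (a (s • p) h * w p s + s • (fderiv ℝ a (s • p) p h * w p s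
            + a (s • p) h * (a (s • p) p * w p s))))) := by
          rw [smul_add, mul_sub]; abel
        rw [h5]
        exact (norm_add_le _ _).trans (add_le_add ((norm_mul_le _ _).trans
          (mul_le_mul_of_nonneg_right h4 (norm_nonneg _))) h3)
    rw [hasFDerivAt_iff_isLittleO_nhds_zero]
    have hO : (fun h => w (p + h) 1 - w p 1
        - (((ContinuousLinearMap.mul ℝ 𝔸).flip (w p 1)).comp (a p)) h) =O[𝓝 0]
        fun h : E => ‖h‖ ^ 2 := by
      refine Asymptotics.IsBigO.of_bound (gronwallBound 0 (M * Q) C 1) ?_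
      filter_upwards [Metric.closedBall_mem_nhds (0 : E) one_pos] with h hh
      simpa using hbound h (mem_closedBall_zero_iff.1 hh)
    exact hO.trans_isLittleO (Asymptotics.isLittleO_norm_pow_id one_lt_two)
  have hfd : fderiv ℝ (fun p => w p 1)
      = fun p => ((ContinuousLinearMap.mul ℝ 𝔸).flip (w p 1)).comp (a p) :=
    funext fun p => (hderiv p).fderiv
  refine ⟨fun p => w p 1, ?_, fun p => hwK p 1 (by simp), fun p h => by rw [hfd]; simp⟩
  rw [contDiff_infty]
  intro n
  -- The equation dU = a U raises the regularity of U by one order at each step.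
  induction n with
  | zero =>
    exact contDiff_zero.2 (continuous_iff_continuousAt.2 fun p => (hderiv p).continuousAt)
  | succ n ih =>
    push_cast
    refine contDiff_succ_iff_fderiv.2 ⟨fun p => (hderiv p).differentiableAt, by simp, ?_⟩
    rw [hfd]
    exact (((ContinuousLinearMap.mul ℝ 𝔸).flip.contDiff).comp ih).clm_comp
      (ha.of_le (by exact_mod_cast le_top))

end PureGauge

/-! ### The Lie algebra and its representations in terms of a basis -/

section Algebra

attribute [local instance] InnerProductSpace.complexToReal

/-- The coupling constant is absorbed into bracket and representation, so that the general theory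
has none. -/
theorem SkewRep.smul {W : Type*} [NormedAddCommGroup W] [InnerProductSpace ℝ W]
    {𝔤 : Type*} [NormedAddCommGroup 𝔤] [InnerProductSpace ℝ 𝔤]
    {br : 𝔤 →L[ℝ] 𝔤 →L[ℝ] 𝔤} {ρ : 𝔤 →L[ℝ] W →L[ℝ] W} (h : SkewRep br ρ) (g : ℝ) :
    SkewRep (g • br) (g • ρ) where
  rep u v w := by simp only [smul_apply, map_smul, h.rep, smul_sub]
  skew u v w := by
    simp only [smul_apply, real_inner_smul_left, real_inner_smul_right, h.skew, mul_neg]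

variable {N d : ℕ} (𝒢 : GaugeGroup N d)

theorem GaugeGroup.cyclic (a b c : Fin d) : 𝒢.C a b c = 𝒢.C b c a := by
  rw [𝒢.antisymm₁₂, 𝒢.antisymm₂₃, neg_neg]

/-- The Lie bracket in the basis `t`. -/
def GaugeGroup.bracket :
    EuclideanSpace ℝ (Fin d) →L[ℝ] EuclideanSpace ℝ (Fin d) →L[ℝ] EuclideanSpace ℝ (Fin d) :=
  (LinearMap.mk₂ ℝ (fun u v => WithLp.toLp 2 fun a => ∑ b, ∑ c, 𝒢.C a b c * u b * v c)
    (fun u u' v => by ext a; simp [mul_add, add_mul, Finset.sum_add_distrib])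
    (fun r u v => by ext a; simp [Finset.mul_sum, mul_assoc, mul_left_comm r])
    (fun u v v' => by ext a; simp [mul_add, Finset.sum_add_distrib])
    (fun r u v => by ext a; simp [Finset.mul_sum, mul_left_comm r])).toContinuousBilinearMap

theorem GaugeGroup.bracket_apply (u v : EuclideanSpace ℝ (Fin d)) (a : Fin d) :
    𝒢.bracket u v a = ∑ b, ∑ c, 𝒢.C a b c * u b * v c := rfl

theorem GaugeGroup.bracket_antisymm (u v : EuclideanSpace ℝ (Fin d)) :
    𝒢.bracket u v = -𝒢.bracket v u := by
  ext a
  rw [PiLp.neg_apply, bracket_apply, bracket_apply, Finset.sum_comm, ← Finset.sum_neg_distrib]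
  refine Finset.sum_congr rfl fun b _ => ?_
  rw [← Finset.sum_neg_distrib]
  refine Finset.sum_congr rfl fun c _ => ?_
  rw [𝒢.antisymm₂₃]; ring

/-- The anti-Hermitian matrix `-i u ^ a t ^ a`. -/
def GaugeGroup.toMatrix : EuclideanSpace ℝ (Fin d) →ₗ[ℝ] Matrix (Fin N) (Fin N) ℂ where
  toFun u := -(Complex.I • ∑ a, (u a : ℂ) • 𝒢.t a)
  map_add' u v := by simp [add_smul, Finset.sum_add_distrib, add_comm]
  map_smul' r u := by simp [mul_smul, ← Finset.smul_sum, smul_comm Complex.I]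

theorem GaugeGroup.toMatrix_apply (u : EuclideanSpace ℝ (Fin d)) :
    𝒢.toMatrix u = -(Complex.I • ∑ a, (u a : ℂ) • 𝒢.t a) := rfl

theorem GaugeGroup.toMatrix_injective : Function.Injective 𝒢.toMatrix := by
  rw [← LinearMap.ker_eq_bot, LinearMap.ker_eq_bot']
  intro u hu
  rw [toMatrix_apply, neg_eq_zero, smul_eq_zero_iff_right Complex.I_ne_zero] at hu
  ext a
  exact Fintype.linearIndependent_iff.1 𝒢.linInd (fun a => u a) (by simpa using hu) a

theorem sum_bracket_smul {M : Type*} [AddCommGroup M] [Module ℂ M]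
    (m : Fin d → M) (u v : EuclideanSpace ℝ (Fin d)) :
    ∑ a, ((𝒢.bracket u v a : ℝ) : ℂ) • m a
      = ∑ b, ∑ c, ((u b * v c : ℝ) : ℂ) • ∑ a, (𝒢.C b c a : ℂ) • m a := by
  simp only [𝒢.bracket_apply, Complex.ofReal_sum, Finset.sum_smul, Finset.smul_sum, smul_smul]
  rw [Finset.sum_comm]
  refine Finset.sum_congr rfl fun b _ => ?_
  rw [Finset.sum_comm]
  refine Finset.sum_congr rfl fun c _ => Finset.sum_congr rfl fun a _ => ?_
  rw [𝒢.cyclic a b c]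
  congr 1
  push_cast; ring

/-- The factor -i in `toMatrix` is the one for which the structure constants turn into commutators
without a sign. -/
theorem GaugeGroup.toMatrix_bracket (u v : EuclideanSpace ℝ (Fin d)) :
    𝒢.toMatrix (𝒢.bracket u v) = 𝒢.toMatrix u * 𝒢.toMatrix v - 𝒢.toMatrix v * 𝒢.toMatrix u := by
  have h : ∀ u v : EuclideanSpace ℝ (Fin d), 𝒢.toMatrix u * 𝒢.toMatrix v
      = -∑ b, ∑ c, ((u b * v c : ℝ) : ℂ) • (𝒢.t b * 𝒢.t c) := by
    intro u v
    simp only [toMatrix_apply, neg_mul_neg, smul_mul_smul_comm, Complex.I_mul_I, neg_smul,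
      one_smul, Finset.sum_mul_sum, Complex.ofReal_mul]
  rw [h u v, h v u, Finset.sum_comm (f := fun b c => ((v b * u c : ℝ) : ℂ) • (𝒢.t b * 𝒢.t c)),
    toMatrix_apply, sum_bracket_smul, neg_sub_neg, ← neg_sub, ← Finset.sum_sub_distrib]
  simp only [← Finset.sum_sub_distrib, mul_comm (v _) (u _), ← smul_sub, 𝒢.comm, Finset.smul_sum,
    smul_comm Complex.I]

theorem GaugeGroup.skewRep_bracket : SkewRep 𝒢.bracket 𝒢.bracket where
  rep u v w := by
    -- The Jacobi identity for `C` is inherited from matrix commutators, since the `t a` are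
    -- linearly independent.
    apply 𝒢.toMatrix_injective
    simp only [map_sub, toMatrix_bracket]
    noncomm_ring
  skew u v w := by
    simp only [PiLp.inner_apply, bracket_apply, RCLike.inner_apply, conj_trivial, Finset.mul_sum,
      Finset.sum_mul, ← Finset.sum_neg_distrib]
    rw [Finset.sum_comm, Finset.sum_comm_cycle, Finset.sum_comm]
    refine Finset.sum_comm.trans (Finset.sum_congr rfl fun c _ => Finset.sum_congr rfl fun b _ =>
      Finset.sum_congr rfl fun a _ => ?_)
    rw [𝒢.cyclic, 𝒢.antisymm₁₂ c b a, 𝒢.cyclic, 𝒢.antisymm₂₃]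
    ring

variable {𝒢} {W : Type*} [NormedAddCommGroup W] [InnerProductSpace ℂ W] [FiniteDimensional ℂ W]
  (𝒯 : Generators 𝒢 W)

/-- The representation `-i u ^ a T ^ a` of the Lie algebra. -/
def Generators.repr : EuclideanSpace ℝ (Fin d) →L[ℝ] W →L[ℝ] W :=
  (LinearMap.mk₂ ℝ (fun u w => -(Complex.I • ∑ a, (u a : ℂ) • 𝒯.T a w))
    (fun u u' v => by simp [add_smul, Finset.sum_add_distrib, add_comm])
    (fun r u v => by simp [mul_smul, ← Finset.smul_sum, smul_comm Complex.I])
    (fun u v v' => by simp [Finset.sum_add_distrib, add_comm])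
    (fun r u v => by
      simp [ContinuousLinearMap.map_smul_of_tower, ← Finset.smul_sum, smul_comm _ r])).toContinuousBilinearMap

theorem Generators.repr_apply (u : EuclideanSpace ℝ (Fin d)) (w : W) :
    𝒯.repr u w = -(Complex.I • ∑ a, (u a : ℂ) • 𝒯.T a w) := rfl

/-- The real part of the Hermitian product, combined with the factor -i, is the imaginary part in
the gauge current. -/
theorem Generators.inner_repr (u : EuclideanSpace ℝ (Fin d)) (v w : W) :
    inner ℝ (𝒯.repr u v) w = -∑ a, u a * (inner ℂ (𝒯.T a v) w).im := by
  rw [real_inner_eq_re_inner ℂ, repr_apply, inner_neg_left, inner_smul_left, sum_inner]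
  simp only [inner_smul_left, Complex.conj_ofReal, Complex.conj_I, RCLike.re_to_complex,
    Complex.neg_re, Complex.mul_re, Complex.neg_im, Complex.I_re, Complex.I_im, Complex.im_sum,
    Complex.mul_im, Complex.ofReal_re, Complex.ofReal_im]
  simp

theorem Generators.skewRep_repr : SkewRep 𝒢.bracket 𝒯.repr where
  rep u v w := by
    have h : ∀ u v : EuclideanSpace ℝ (Fin d), 𝒯.repr u (𝒯.repr v w)
        = -∑ b, ∑ c, ((u b * v c : ℝ) : ℂ) • 𝒯.T b (𝒯.T c w) := by
      intro u v
      simp only [repr_apply, map_neg, map_smul, map_sum, Finset.smul_sum, smul_smul,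
        Finset.sum_neg_distrib, neg_neg]
      rw [Finset.sum_comm, ← Finset.sum_neg_distrib]
      refine Finset.sum_congr rfl fun b _ => ?_
      rw [← Finset.sum_neg_distrib]
      refine Finset.sum_congr rfl fun c _ => ?_
      rw [← neg_smul]
      congr 1
      push_cast
      linear_combination (u b * v c : ℂ) * Complex.I_mul_I
    rw [h u v, h v u,
      Finset.sum_comm (f := fun b c => ((v b * u c : ℝ) : ℂ) • 𝒯.T b (𝒯.T c w)),
      repr_apply, sum_bracket_smul, neg_sub_neg, ← neg_sub, ← Finset.sum_sub_distrib]
    simp only [← Finset.sum_sub_distrib, mul_comm (v _) (u _), ← smul_sub, 𝒯.comm,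
      Finset.smul_sum, smul_comm Complex.I]
  skew u v w := by
    rw [inner_repr, real_inner_comm, inner_repr, neg_neg, ← Finset.sum_neg_distrib]
    refine Finset.sum_congr rfl fun a _ => ?_
    rw [𝒯.hermitian, ← inner_conj_symm, Complex.conj_im, mul_neg, neg_neg]

end Algebra

/-! ### Connection forms in coordinates -/

section Coordinates

attribute [local instance] InnerProductSpace.complexToReal

/-- The coordinate functions of spacetime. -/
def coord : Fin 4 → Spacetime →L[ℝ] ℝ :=
  Fin.cons (ContinuousLinearMap.fst ℝ ℝ Space)
    (fun i : Fin 3 => (EuclideanSpace.proj i).comp (ContinuousLinearMap.snd ℝ ℝ Space))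

theorem coord_dir (μ ν : Fin 4) : coord μ (dir ν) = if μ = ν then 1 else 0 := by
  refine Fin.cases ?_ (fun i => ?_) μ <;> refine Fin.cases ?_ (fun j => ?_) ν
  · simp [coord, dir]
  · simp [coord, dir, (Fin.succ_ne_zero j).symm]
  · simp [coord, dir]
  · simp [coord, dir]

variable {N d : ℕ} {𝒢 : GaugeGroup N d} {g : ℝ} {A : Spacetime → Fin 4 → Fin d → ℝ} {P : Period}

/-- The connection form with components `A`. -/
def connForm (A : Spacetime → Fin 4 → Fin d → ℝ) (p : Spacetime) :
    Spacetime →L[ℝ] EuclideanSpace ℝ (Fin d) :=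
  ∑ μ, (coord μ).smulRight (WithLp.toLp 2 (A p μ))

theorem connForm_apply (p h : Spacetime) (a : Fin d) :
    connForm A p h a = ∑ μ, coord μ h * A p μ a := by
  simp [connForm]

theorem connForm_dir (p : Spacetime) (μ : Fin 4) :
    connForm A p (dir μ) = WithLp.toLp 2 (A p μ) := by
  ext a; simp [connForm_apply, coord_dir]

theorem contDiff_connForm (hA : ∀ μ a, ContDiff ℝ ∞ (fun p => A p μ a)) :
    ContDiff ℝ ∞ (connForm A) :=
  ContDiff.sum fun μ _ => contDiff_const.smulRight (contDiff_euclidean.2 fun a => hA μ a)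

/-- Rotating both the direction and the vector components preserves their pairing. -/
theorem connForm_shift (hA : IsPeriodicVector P A) (p k : Spacetime) :
    connForm A (P.shift p) (P.lin k) = connForm A p k := by
  obtain ⟨t, x⟩ := p
  ext a
  rw [connForm_apply, connForm_apply]
  refine (Fin.sum_univ_succ _).trans (Eq.trans ?_ (Fin.sum_univ_succ _).symm)
  have h := hA t (rotIso P.Ω x + P.l) a
  rw [P.back_shift] at h
  have h1 := sum_mul_space (rotIso P.Ω k.2)
    (rotIso P.Ω (WithLp.toLp 2 fun j => A (t, x) j.succ a))
  rw [LinearIsometryEquiv.inner_map_map, ← sum_mul_space] at h1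
  rw [P.shift_apply, h.1]
  refine congrArg₂ (· + ·) rfl (Eq.trans (Finset.sum_congr rfl fun i _ => ?_) h1)
  rw [h.2 i]
  rfl

theorem fderiv_euclidean_apply {E : Type*} [NormedAddCommGroup E] [NormedSpace ℝ E]
    {f : E → EuclideanSpace ℝ (Fin d)} {p : E} (hf : DifferentiableAt ℝ f p) (h : E) (a : Fin d) :
    fderiv ℝ f p h a = fderiv ℝ (fun q => f q a) p h := by
  have h1 := ((EuclideanSpace.proj (𝕜 := ℝ) a).hasFDerivAt.comp p hf.hasFDerivAt).fderiv
  have h2 : (fun q => f q a) = (EuclideanSpace.proj (𝕜 := ℝ) a) ∘ f := rfl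
  rw [h2, h1]
  rfl

theorem curv_connForm (hA : ∀ μ a, ContDiff ℝ ∞ (fun p => A p μ a)) (μ ν : Fin 4) (p : Spacetime)
    (a : Fin d) : curv (g • 𝒢.bracket) (connForm A) (dir μ) (dir ν) p a
      = fieldStrength 𝒢 g A μ ν a p := by
  have hd : ∀ ν, DifferentiableAt ℝ (fun q => connForm A q (dir ν)) p := fun ν =>
    ((contDiff_connForm hA).clm_apply contDiff_const).differentiable (by simp) p
  simp only [curv, PiLp.add_apply, PiLp.sub_apply, fderiv_euclidean_apply (hd _)]
  simp only [smul_apply, PiLp.smul_apply, GaugeGroup.bracket_apply, connForm_dir, fieldStrength, pd, smul_eq_mul]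

theorem covDir_curv_connForm (hA : ∀ μ a, ContDiff ℝ ∞ (fun p => A p μ a)) (l μ ν : Fin 4)
    (p : Spacetime) (a : Fin d) :
    covDir (g • 𝒢.bracket) (connForm A) (dir l) (curv (g • 𝒢.bracket) (connForm A) (dir μ) (dir ν))
      p a = pd l (fieldStrength 𝒢 g A μ ν a) p
        + g * ∑ b, ∑ c, 𝒢.C a b c * A p l b * fieldStrength 𝒢 g A μ ν c p := by
  have hd := (contDiff_curv (br := g • 𝒢.bracket) (contDiff_connForm hA) (dir μ)
    (dir ν)).differentiable (by simp) p
  simp only [covDir, PiLp.add_apply, fderiv_euclidean_apply hd, smul_apply, PiLp.smul_apply,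
    GaugeGroup.bracket_apply, connForm_dir, curv_connForm hA, pd, smul_eq_mul]

variable {W : Type*} [NormedAddCommGroup W] [InnerProductSpace ℂ W] {𝒯 : Generators 𝒢 W}

theorem covDir_connForm [FiniteDimensional ℂ W] (μ : Fin 4) (ψ : Spacetime → W) :
    covDir (g • 𝒯.repr) (connForm A) (dir μ) ψ = covD 𝒯 g A μ ψ := by
  ext p
  simp only [covDir, covD, pd, smul_apply, connForm_dir, Generators.repr_apply, smul_neg,
    sub_eq_add_neg, mul_comm Complex.I, mul_smul]
  rfl

/-! ### The potential along the field -/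

section Potential

variable {V : ℝ → ℝ} {φ : Spacetime → W}

/-- The one-sided derivative at 0 suffices for a full derivative, because ‖φ‖² takes values in [0,
∞) only. -/
theorem hasFDerivAt_potential (hV : IsPotential V) (hφ : ContDiff ℝ ∞ φ) (p : Spacetime) :
    HasFDerivAt (fun q => V (‖φ q‖ ^ 2))
      ((2 : ℝ) • (innerSL ℝ (dV V (‖φ p‖ ^ 2) • φ p)).comp (fderiv ℝ φ p)) p := by
  have h1 : HasFDerivAt (fun q => ‖φ q‖ ^ 2) _ p :=
    ((hφ.differentiable (by simp)) p).hasFDerivAt.norm_sq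
  have h2 : HasDerivWithinAt V (dV V (‖φ p‖ ^ 2)) (Set.Ici 0) (‖φ p‖ ^ 2) :=
    (hV.differentiable _ (sq_nonneg ‖φ p‖)).hasDerivWithinAt
  have h3 := h2.comp_hasFDerivWithinAt p h1.hasFDerivWithinAt (s := Set.univ)
    (fun q _ => sq_nonneg ‖φ q‖)
  rw [hasFDerivWithinAt_univ] at h3
  convert! h3 using 1
  ext h <;> simp <;> ring

end Potential

/-! ### Solitons in coordinates -/

section Soliton

variable {V : ℝ → ℝ} {φ : Spacetime → W}

theorem memLp_two_of_le {F : Type*} [NormedAddCommGroup F] {f : Spacetime → F} (hf : Continuous f)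
    {b : Spacetime → ℝ} {s : Set Spacetime} (hb : IntegrableOn b s) (h : ∀ p, ‖f p‖ ^ 2 ≤ b p) :
    MemLp f 2 (volume.restrict s) := by
  have hm : AEStronglyMeasurable f (volume.restrict s) := hf.aestronglyMeasurable
  rw [memLp_two_iff_integrable_sq_norm hm]
  exact Integrable.mono' hb (hm.norm.pow 2) (Eventually.of_forall fun p => by
    rw [Real.norm_of_nonneg (sq_nonneg _)]; exact h p)

theorem memLp_curv_connForm (hA : GaugeAdmissible 𝒢 g A P) (μ ν : Fin 4) :
    MemLp (curv (g • 𝒢.bracket) (connForm A) (dir μ) (dir ν)) 2 (volume.restrict P.slab) := by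
  have hc : ∀ μ ν, Continuous (curv (g • 𝒢.bracket) (connForm A) (dir μ) (dir ν)) := fun μ ν =>
    (contDiff_curv (contDiff_connForm hA.smooth) _ _).continuous
  have hbr : ∀ u v, (g • 𝒢.bracket) u v = -(g • 𝒢.bracket) v u := fun u v => by
    simp only [smul_apply, 𝒢.bracket_antisymm u v, smul_neg]
  have hn : ∀ μ ν p, ‖curv (g • 𝒢.bracket) (connForm A) (dir μ) (dir ν) p‖ ^ 2
      = ∑ a, fieldStrength 𝒢 g A μ ν a p ^ 2 := fun μ ν p => by
    rw [EuclideanSpace.real_norm_sq_eq]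
    simp only [curv_connForm hA.smooth]
  have h0 : ∀ i : Fin 3, MemLp (curv (g • 𝒢.bracket) (connForm A) (dir 0) (dir i.succ)) 2
      (volume.restrict P.slab) := fun i => by
    refine memLp_two_of_le (hc _ _) (hA.finite_electric.const_mul 2) fun p => ?_
    rw [hn]
    have := Finset.single_le_sum (f := fun i : Fin 3 => ∑ a, fieldStrength 𝒢 g A 0 i.succ a p ^ 2)
      (fun i _ => Finset.sum_nonneg fun a _ => sq_nonneg _) (Finset.mem_univ i)
    linarith
  have hneg : ∀ μ ν, curv (g • 𝒢.bracket) (connForm A) (dir μ) (dir ν)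
      = -curv (g • 𝒢.bracket) (connForm A) (dir ν) (dir μ) := fun μ ν =>
    funext fun p => curv_antisymm hbr _ _ p
  refine Fin.cases ?_ (fun i => ?_) μ <;> refine Fin.cases ?_ (fun j => ?_) ν
  · have : curv (g • 𝒢.bracket) (connForm A) (dir 0) (dir 0) = 0 :=
      funext fun p => curv_self hbr _ p
    rw [this]
    exact MemLp.zero
  · exact h0 j
  · rw [hneg]
    exact (h0 i).neg
  · refine memLp_two_of_le (hc _ _) (hA.finite_magnetic.const_mul 4) fun p => ?_
    rw [hn]
    have h1 := Finset.single_le_sum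
      (f := fun j : Fin 3 => ∑ a, fieldStrength 𝒢 g A i.succ j.succ a p ^ 2)
      (fun i _ => Finset.sum_nonneg fun a _ => sq_nonneg _) (Finset.mem_univ j)
    have h2 := Finset.single_le_sum
      (f := fun i : Fin 3 => ∑ j : Fin 3, ∑ a, fieldStrength 𝒢 g A i.succ j.succ a p ^ 2)
      (fun i _ => Finset.sum_nonneg fun j _ => Finset.sum_nonneg fun a _ => sq_nonneg _)
      (Finset.mem_univ i)
    linarith

theorem isSoliton_of_solvesYMScalar [FiniteDimensional ℂ W] (hV : IsPotential V)
    (hA : GaugeAdmissible 𝒢 g A P) (hφ : ScalarAdmissible P V φ (fun μ => covD 𝒯 g A μ φ))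
    (h : SolvesYMScalar 𝒯 g V φ A) :
    IsSoliton P (g • 𝒢.bracket) (g • 𝒯.repr) (connForm A) φ (fun p => V (‖φ p‖ ^ 2))
      (fun p => dV V (‖φ p‖ ^ 2) • φ p) := by
  have hbr : ∀ u v, (g • 𝒢.bracket) u v = -(g • 𝒢.bracket) v u := fun u v => by
    simp only [smul_apply, 𝒢.bracket_antisymm u v, smul_neg]
  have hcA := contDiff_connForm hA.smooth
  have hrep := 𝒯.skewRep_repr.smul g
  have heq : ∀ p, ∑ α, eta α • covDir (g • 𝒯.repr) (connForm A) (dir α)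
      (covDir (g • 𝒯.repr) (connForm A) (dir α) φ) p + dV V (‖φ p‖ ^ 2) • φ p = 0 := fun p => by
    simpa only [covDir_connForm] using h.scalar p
  -- Continuity is read off from the field equation, since V' need not be continuous; it makes the
  -- potential along the field C¹.
  have hS : Continuous fun p => dV V (‖φ p‖ ^ 2) • φ p := by
    have : (fun p => dV V (‖φ p‖ ^ 2) • φ p) = fun p => -∑ α, eta α • covDir (g • 𝒯.repr)
        (connForm A) (dir α) (covDir (g • 𝒯.repr) (connForm A) (dir α) φ) p :=
      funext fun p => eq_neg_of_add_eq_zero_right (heq p)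
    rw [this]
    exact (continuous_finsetSum _ fun α _ => (contDiff_covDir hcA
      (contDiff_covDir hcA hφ.smooth _) _).continuous.const_smul (eta α)).neg
  have hd := hasFDerivAt_potential hV hφ.smooth
  have hshift := fun p => P.shift_of_isPeriodicScalar hφ.periodic p
  refine ⟨hrep, 𝒢.skewRep_bracket.smul g, hbr, hcA, hφ.smooth, ?_, ?_, heq, ?_,
    connForm_shift hA.periodic, hshift, fun p => by simp only [hshift], ?_,
    memLp_curv_connForm hA, hφ.finite_potential, ?_⟩
  · refine contDiff_one_iff_fderiv.2 ⟨fun p => (hd p).differentiableAt, ?_⟩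
    rw [funext fun p => (hd p).fderiv]
    exact (((innerSL ℝ).continuous.comp hS).clm_comp
      (hφ.smooth.continuous_fderiv (by simp))).const_smul (2 : ℝ)
  · intro p k
    rw [(hd p).fderiv, covDir, inner_add_right]
    -- By skewness the connection term is orthogonal to φ, so the partial derivative in the gradient
    -- of the potential may be replaced by the covariant one.
    have h1 : inner ℝ (φ p) ((g • 𝒯.repr) (connForm A p k) (φ p)) = 0 := by
      have := hrep.skew (connForm A p k) (φ p) (φ p)
      rw [real_inner_comm] at this
      linarith
    rw [real_inner_smul_left _ ((g • 𝒯.repr) (connForm A p k) (φ p)), h1]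
    simp only [smul_apply, ContinuousLinearMap.comp_apply, innerSL_apply_apply, smul_eq_mul,
      mul_zero, add_zero]
  · intro k u p
    -- The gauge equation is given for coordinate directions; both sides are linear in `k`.
    have hl : IsLinearMap ℝ fun k => ∑ α, eta α • covDir (g • 𝒢.bracket) (connForm A) (dir α)
        (curv (g • 𝒢.bracket) (connForm A) (dir α) k) p := by
      have h1 := fun α => isLinearMap_covDir_right (ρ := g • 𝒢.bracket) (A := connForm A)
        (f := fun k => curv (g • 𝒢.bracket) (connForm A) (dir α) k)
        (fun k => (contDiff_curv hcA (dir α) k).differentiable (by simp))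
        (fun q => isLinearMap_curv_right hbr hcA (dir α) q) (dir α) p
      exact ⟨fun x y => by simp only [(h1 _).map_add, smul_add, Finset.sum_add_distrib],
        fun c x => by simp only [(h1 _).map_smul, smul_comm _ c, Finset.smul_sum]⟩
    have hr := isLinearMap_inner_right (isLinearMap_covDir (ρ := g • 𝒯.repr) (A := connForm A) φ p)
      ((g • 𝒯.repr) u (φ p))
    rw [← isFrame_dir k, sum_isLinearMap (isLinearMap_inner_left hl u),
      sum_isLinearMap hr, Finset.mul_sum]
    refine Finset.sum_congr rfl fun ν _ => ?_
    rw [smul_eq_mul, smul_eq_mul, mul_left_comm (-2 : ℝ)]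
    congr 1
    have h1 : ∑ α, eta α • covDir (g • 𝒢.bracket) (connForm A) (dir α)
        (curv (g • 𝒢.bracket) (connForm A) (dir α) (dir ν)) p
        = WithLp.toLp 2 fun a => divF 𝒢 g A ν a p := by
      ext a
      simp [divF, covDir_curv_connForm hA.smooth]
    rw [h1, covDir_connForm, smul_apply, smul_apply, real_inner_smul_left, 𝒯.inner_repr]
    simp only [PiLp.inner_apply, RCLike.inner_apply, conj_trivial, h.gauge, mul_neg, neg_mul,
      Finset.mul_sum, Finset.sum_neg_distrib, neg_neg]
    exact Finset.sum_congr rfl fun a _ => by ring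
  · intro μ
    rw [covDir_connForm]
    have hc : Continuous (covD 𝒯 g A μ φ) := by
      rw [← covDir_connForm]; exact (contDiff_covDir hcA hφ.smooth _).continuous
    revert hc
    refine Fin.cases (fun hc => ?_) (fun i hc => ?_) μ
    · exact memLp_two_of_le hc hφ.finite_kinetic fun p => le_rfl
    · exact memLp_two_of_le hc hφ.finite_gradient fun p =>
        Finset.single_le_sum (f := fun i : Fin 3 => ‖covD 𝒯 g A i.succ φ p‖ ^ 2)
          (fun i _ => sq_nonneg _) (Finset.mem_univ i)
  · simpa only [real_inner_smul_left, real_inner_self_eq_norm_sq] using hφ.finite_dV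

end Soliton

end Coordinates

/-! ### Triviality of the gauge field -/

section Trivial

variable {N d : ℕ}

theorem one_mem_matrices (G : Subgroup (Matrix.unitaryGroup (Fin N) ℂ)) :
    1 ∈ matrices G := ⟨1, G.one_mem, rfl⟩

theorem mul_mem_matrices {G : Subgroup (Matrix.unitaryGroup (Fin N) ℂ)}
    {x y : Matrix (Fin N) (Fin N) ℂ} (hx : x ∈ matrices G) (hy : y ∈ matrices G) :
    x * y ∈ matrices G := by
  obtain ⟨u, hu, rfl⟩ := hx
  obtain ⟨v, hv, rfl⟩ := hy
  exact ⟨u * v, G.mul_mem hu hv, rfl⟩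

/-- The set is closed, and the entries of a unitary matrix are bounded by 1. -/
theorem isCompact_matrices {G : Subgroup (Matrix.unitaryGroup (Fin N) ℂ)}
    (hG : IsClosed (G : Set (Matrix.unitaryGroup (Fin N) ℂ))) : IsCompact (matrices G) := by
  have h1 : IsCompact {x : Matrix (Fin N) (Fin N) ℂ | ∀ i, x i ∈ {y : Fin N → ℂ |
      ∀ j, y j ∈ Metric.closedBall (0 : ℂ) 1}} :=
    isCompact_pi_infinite fun _ => isCompact_pi_infinite fun _ => isCompact_closedBall 0 1
  refine h1.of_isClosed_subset ?_ ?_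
  · exact (isClosed_unitary (R := Matrix (Fin N) (Fin N) ℂ)).isClosedEmbedding_subtypeVal.isClosedMap
      _ hG
  · rintro _ ⟨u, -, rfl⟩ i j
    exact mem_closedBall_zero_iff.2 (entry_norm_bound_of_unitary u.2 i j)

variable {𝒢 : GaugeGroup N d} {g : ℝ} {A : Spacetime → Fin 4 → Fin d → ℝ}

/-- A gauge field without field strength is a pure gauge in every matrix representation. -/
theorem exists_gauge_of_curv_eq_zero {𝔤 : Type*} [NormedAddCommGroup 𝔤] [InnerProductSpace ℝ 𝔤]
    [FiniteDimensional ℝ 𝔤] {E : Type*} [NormedAddCommGroup E] [NormedSpace ℝ E] [ProperSpace E]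
    {𝔸 : Type*} [NormedRing 𝔸] [NormedAlgebra ℝ 𝔸] [FiniteDimensional ℝ 𝔸]
    {br : 𝔤 →L[ℝ] 𝔤 →L[ℝ] 𝔤} {A : E → E →L[ℝ] 𝔤} (hA : ContDiff ℝ ∞ A)
    (hF : ∀ h k p, curv br A h k p = 0) (Z : 𝔤 →ₗ[ℝ] 𝔸)
    (hZ : ∀ u v, Z (br u v) = Z u * Z v - Z v * Z u) {K : Set 𝔸} (hK : IsCompact K)
    (h1 : (1 : 𝔸) ∈ K) (hexp : ∀ u, ∀ x ∈ K, NormedSpace.exp (Z u) * x ∈ K) :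
    ∃ U : E → 𝔸, (∀ p, U p ∈ K) ∧ ∀ L : 𝔸 →ₗ[ℝ] ℂ, ContDiff ℝ ∞ (fun p => L (U p)) ∧
      ∀ p h, fderiv ℝ (fun q => L (U q)) p h = L (-Z (A p h) * U p) := by
  have := FiniteDimensional.complete ℝ 𝔸
  let a : E → E →L[ℝ] 𝔸 := fun p => (-LinearMap.toContinuousLinearMap Z).comp (A p)
  have ha : ∀ p h, a p h = -Z (A p h) := fun p h => rfl
  have hda : ∀ p h k, fderiv ℝ a p h k = -Z (fderiv ℝ (fun q => A q k) p h) := by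
    intro p h k
    have h1 := (hA.differentiable (by simp) p).hasFDerivAt
    have h2 : HasFDerivAt a _ p :=
      (hasFDerivAt_const (-LinearMap.toContinuousLinearMap Z) p).clm_comp h1
    rw [h2.fderiv, (h1.clm_apply (hasFDerivAt_const k p)).fderiv]
    simp
  obtain ⟨U, hU, hUK, hUd⟩ := exists_pure_gauge (a := a) (contDiff_const.clm_comp hA)
    (fun p h k => by
      rw [hda, hda, ← neg_sub', ← map_sub, eq_neg_of_add_eq_zero_left (hF h k p), map_neg, hZ,
        neg_neg, ha, ha, neg_mul_neg, neg_mul_neg])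
    hK h1 (fun p h τ u hu => by
      rw [ha, smul_neg, ← smul_neg, ← map_neg, ← map_smul]
      exact hexp _ u hu)
  refine ⟨U, hUK, fun L => ?_⟩
  have hL : (fun p => L (U p)) = LinearMap.toContinuousLinearMap L ∘ U := rfl
  refine ⟨hL ▸ (LinearMap.toContinuousLinearMap L).contDiff.comp hU, fun p h => ?_⟩
  rw [hL, ((LinearMap.toContinuousLinearMap L).hasFDerivAt.comp p
    (hU.differentiable (by simp) p).hasFDerivAt).fderiv]
  simp [hUd, ha]

-- The matrix algebra needs some norm for the transport equation; the result is stated through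
-- entries, so the choice does not matter. With `Z` = g · `toMatrix` the form -Z(A) is i g A^a t^a,
-- and its exponentials lie in G by the definition of the Lie algebra.
open scoped Matrix.Norms.Operator in
theorem gaugeTrivial_of_curv_eq_zero (hA : ∀ μ a, ContDiff ℝ ∞ (fun p => A p μ a))
    (hF : ∀ h k p, curv (g • 𝒢.bracket) (connForm A) h k p = 0) : GaugeTrivial 𝒢 g A := by
  refine ⟨fun μ ν a p => by rw [← curv_connForm hA, hF]; rfl, ?_⟩
  have hZ : ∀ u, (g • 𝒢.toMatrix) u = -((Complex.I * (g : ℂ)) • ∑ a, (u a : ℂ) • 𝒢.t a) :=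
    fun u => by
      rw [LinearMap.smul_apply, GaugeGroup.toMatrix_apply, smul_neg, mul_comm, mul_smul]
      rfl
  have hexp : ∀ u, ∀ x ∈ matrices 𝒢.G, NormedSpace.exp ((g • 𝒢.toMatrix) u) * x ∈ matrices 𝒢.G := by
    intro u x hx
    have hX : ∑ a, (u a : ℂ) • 𝒢.t a ∈ lieAlg 𝒢.G := by
      rw [← 𝒢.span_eq]
      exact Submodule.sum_mem _ fun b _ =>
        Submodule.smul_mem _ (u b) (Submodule.subset_span ⟨b, rfl⟩)
    have h1 : (g • 𝒢.toMatrix) u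
        = (Complex.I * ((-g : ℝ) : ℂ)) • ∑ a, (u a : ℂ) • 𝒢.t a := by
      rw [hZ, ← neg_smul]
      congr 1
      push_cast; ring
    rw [h1]
    exact mul_mem_matrices (hX (-g)) hx
  obtain ⟨U, hUK, hU⟩ := exists_gauge_of_curv_eq_zero (𝔸 := Matrix (Fin N) (Fin N) ℂ)
    (contDiff_connForm hA) hF (g • 𝒢.toMatrix)
    (fun u v => by
      simp only [LinearMap.smul_apply, smul_apply, map_smul, GaugeGroup.toMatrix_bracket,
        smul_mul_smul_comm, ← smul_sub, smul_smul])
    (isCompact_matrices 𝒢.closed) (one_mem_matrices 𝒢.G) hexp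
  refine ⟨U, hUK, fun i j => (hU (Matrix.entryLinearMap ℝ ℂ i j)).1, fun μ p i j => ?_⟩
  have h2 := (hU (Matrix.entryLinearMap ℝ ℂ i j)).2 p (dir μ)
  rw [hZ, neg_neg, connForm_dir] at h2
  exact h2

end Trivial

/-! ### Absence of solitons -/

section NoSolitons

variable {N d : ℕ} {𝒢 : GaugeGroup N d} {g : ℝ} {A : Spacetime → Fin 4 → Fin d → ℝ} {P : Period}
  {W : Type*} [NormedAddCommGroup W] [InnerProductSpace ℂ W]
  {𝒯 : Generators 𝒢 W} {V : ℝ → ℝ} {φ : Spacetime → W}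

attribute [local instance] InnerProductSpace.complexToReal

theorem trivial_of_le [FiniteDimensional ℂ W] (hV : IsPotential V)
    (hA : GaugeAdmissible 𝒢 g A P)
    (hφ : ScalarAdmissible P V φ (fun μ => covD 𝒯 g A μ φ)) (h : SolvesYMScalar 𝒯 g V φ A)
    (hle : ∀ p, 0 ≤ dV V (‖φ p‖ ^ 2) * ‖φ p‖ ^ 2 - V (‖φ p‖ ^ 2)) :
    (∀ p, φ p = 0) ∧ GaugeTrivial 𝒢 g A := by
  have hs := (isSoliton_of_solvesYMScalar hV hA hφ h).trivial_of_le hφ.vanishing fun p => by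
    simpa only [real_inner_smul_left, real_inner_self_eq_norm_sq] using hle p
  exact ⟨hs.1, gaugeTrivial_of_curv_eq_zero hA.smooth hs.2⟩

theorem trivial_of_lt [FiniteDimensional ℂ W] (hV : IsPotential V)
    (hA : GaugeAdmissible 𝒢 g A P)
    (hφ : ScalarAdmissible P V φ (fun μ => covD 𝒯 g A μ φ)) (h : SolvesYMScalar 𝒯 g V φ A)
    (hlt : ∀ p, φ p ≠ 0 → 0 < dV V (‖φ p‖ ^ 2) * ‖φ p‖ ^ 2 - 3 * V (‖φ p‖ ^ 2)) :
    (∀ p, φ p = 0) ∧ GaugeTrivial 𝒢 g A := by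
  have hs := (isSoliton_of_solvesYMScalar hV hA hφ h).trivial_of_lt hφ.vanishing
    (fun p hp => by simp [hp, hV.zero]) fun p hp => by
      simpa only [real_inner_smul_left, real_inner_self_eq_norm_sq] using hlt p hp
  exact ⟨hs.1, gaugeTrivial_of_curv_eq_zero hA.smooth hs.2⟩

/-! ### The theories of one field as special cases. -/

theorem fieldStrength_zero (μ ν : Fin 4) (a : Fin d) :
    fieldStrength 𝒢 g 0 μ ν a = 0 := by
  ext p
  simp [fieldStrength, pd]

theorem gaugeAdmissible_zero : GaugeAdmissible 𝒢 g 0 P where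
  smooth _ _ := contDiff_const
  vanishing _ _ _ := tendsto_const_nhds
  periodic _ _ _ := by simp
  finite_electric := by simp [fieldStrength_zero]
  finite_magnetic := by simp [fieldStrength_zero]

theorem covD_zero : covD 𝒯 0 0 = pd (E := W) := by
  ext μ ψ p
  simp [covD]

/-- At g = 0 the scalar field is no source, so the zero gauge field solves its equation for every φ.
-/
theorem solvesYMScalar_zero (h : SolvesScalar V φ) : SolvesYMScalar 𝒯 0 V φ 0 where
  scalar p := by simpa only [covD_zero] using h p
  gauge ν a p := by simp [divF, fieldStrength_zero, pd]

theorem scalarAdmissible_zero (hV : IsPotential V) :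
    ScalarAdmissible P V (0 : Spacetime → W) (fun μ => covD 𝒯 g A μ 0) := by
  have h : ∀ μ p, covD 𝒯 g A μ (0 : Spacetime → W) p = 0 := fun μ p => by simp [covD, pd]
  refine ⟨contDiff_const, fun _ => tendsto_const_nhds, fun _ _ => rfl, ?_, ?_, ?_, ?_⟩ <;>
  simp [h, hV.zero]

theorem solvesYMScalar_of_solvesYM (h : SolvesYM 𝒢 g A) : SolvesYMScalar 𝒯 g V 0 A where
  scalar p := by
    have h : ∀ μ, covD 𝒯 g A μ (0 : Spacetime → W) = 0 := fun μ => by ext p; simp [covD, pd]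
    simp [h]
  gauge ν a p := by simp [h ν a p]

end NoSolitons

end YMSoliton

end

theorem corollary1 {N d : ℕ} (𝒢 : GaugeGroup N d) (g : ℝ) (P : Period)
    {W : Type*} [NormedAddCommGroup W] [InnerProductSpace ℂ W] [FiniteDimensional ℂ W]
    (𝒯 : Generators 𝒢 W) (V : ℝ → ℝ) (hV : IsPotential V) :
    -- Yang–Mills field coupled to the scalar field, non-negative potential
    (∀ (φ : Spacetime → W) (A : Spacetime → Fin 4 → Fin d → ℝ),
      GaugeAdmissible 𝒢 g A P → ScalarAdmissible P V φ (fun μ => covD 𝒯 g A μ φ) →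
      SolvesYMScalar 𝒯 g V φ A →
      (∀ p, 0 ≤ V (‖φ p‖ ^ 2)) →
      (∀ p, 0 ≤ dV V (‖φ p‖ ^ 2) * ‖φ p‖ ^ 2 - V (‖φ p‖ ^ 2)) →
      (∀ p, φ p = 0) ∧ GaugeTrivial 𝒢 g A) ∧
    -- Yang–Mills field coupled to the scalar field, non-positive potential
    (∀ (φ : Spacetime → W) (A : Spacetime → Fin 4 → Fin d → ℝ),
      GaugeAdmissible 𝒢 g A P → ScalarAdmissible P V φ (fun μ => covD 𝒯 g A μ φ) →
      SolvesYMScalar 𝒯 g V φ A →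
      (∀ p, V (‖φ p‖ ^ 2) ≤ 0) →
      (∀ p, φ p ≠ 0 → 0 < dV V (‖φ p‖ ^ 2) * ‖φ p‖ ^ 2 - 3 * V (‖φ p‖ ^ 2)) →
      (∀ p, φ p = 0) ∧ GaugeTrivial 𝒢 g A) ∧
    -- scalar field alone, non-negative potential
    (∀ φ : Spacetime → W,
      ScalarAdmissible P V φ (fun μ => pd μ φ) → SolvesScalar V φ →
      (∀ p, 0 ≤ V (‖φ p‖ ^ 2)) →
      (∀ p, 0 ≤ dV V (‖φ p‖ ^ 2) * ‖φ p‖ ^ 2 - V (‖φ p‖ ^ 2)) →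
      ∀ p, φ p = 0) ∧
    -- scalar field alone, non-positive potential
    (∀ φ : Spacetime → W,
      ScalarAdmissible P V φ (fun μ => pd μ φ) → SolvesScalar V φ →
      (∀ p, V (‖φ p‖ ^ 2) ≤ 0) →
      (∀ p, φ p ≠ 0 → 0 < dV V (‖φ p‖ ^ 2) * ‖φ p‖ ^ 2 - 3 * V (‖φ p‖ ^ 2)) →
      ∀ p, φ p = 0) ∧
    -- pure Yang–Mills theory
    (∀ A : Spacetime → Fin 4 → Fin d → ℝ,
      GaugeAdmissible 𝒢 g A P → SolvesYM 𝒢 g A → GaugeTrivial 𝒢 g A) := by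
  -- The scalar theory is entered with g = 0 and A = 0, pure Yang–Mills theory with φ = 0, where the
  -- condition on the potential reduces to V 0 = 0.
  refine ⟨fun φ A hA hφ h _ hle => trivial_of_le hV hA hφ h hle,
    fun φ A hA hφ h _ hlt => trivial_of_lt hV hA hφ h hlt,
    fun φ hφ h _ hle => (trivial_of_le (𝒯 := 𝒯) (g := 0) (P := P) hV gaugeAdmissible_zero ?_
      (solvesYMScalar_zero h) hle).1,
    fun φ hφ h _ hlt => (trivial_of_lt (𝒯 := 𝒯) (g := 0) (P := P) hV gaugeAdmissible_zero ?_
      (solvesYMScalar_zero h) hlt).1,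
    fun A hA h => (trivial_of_le (𝒯 := 𝒯) hV hA (scalarAdmissible_zero hV)
      (solvesYMScalar_of_solvesYM h) fun p => ?_).2⟩
  · simpa only [covD_zero] using hφ
  · simpa only [covD_zero] using hφ
  · simp [hV.zero]
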